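/- Let $\mathbf H$ be the quaternions and $\mathbf O$ the Cayley octonions, and let $\mathbf K=\mathbf H$ or $\mathbf K=\mathbf O$. *The space $X_{\mathbf H}=SL_3(\mathbf H)/SU_3(\mathbf H)$.* With $J=\begin{pmatrix}0&-I\\ I&0\end{pmatrix}\in M_6(\mathbf C)$, the $3\times3$ quaternionic matrices are identified with $\{M\in M_6(\mathbf C): JMJ^{-1}=\overline M\}$ (a real $3\times 3$ matrix $N$ with $\mathrm{diag}(N,N)$), $G=SL_3(\mathbf H)$ consists of those with $\det M=1$, and $X_{\mathbf H}$ is the set of positive definite Hermitian $M\in SL_3(\mathbf H)$. The group $G$ acts by $g(x)=(gx^2g^*)^{1/2}$, and $d(x,y)=\log\|x^{-1}y\|+\log\|y^{-1}x\|$ with $\|\cdot\|$ the operator norm on $\mathbf H^3=\mathbf C^6$. *The space $X_{\mathbf O}=E_{6(-26)}/F_{4(-52)}$.* Let $\mathcal J$ be the real vector space of Hermitian $3\times 3$ matrices over $\mathbf O$, with product $M\star N=\frac12(MN+NM)$ and Freudenthal determinant $$\det\begin{pmatrix}\xi_1&x_3&\overline{x_2}\\ \overline{x_3}&\xi_2&x_1\\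 x_2&\overline{x_1}&\xi_3\end{pmatrix}=\xi_1\xi_2\xi_3-\sum_{i}\xi_i|x_i|^2+2\,\Re(x_1x_2x_3).$$ Then $G=E_{6(-26)}=\{g\in GL(\mathcal J):\det\circ g=\det\}$ and $F_{4(-52)}=\{g\in E_{6(-26)}:g(I)=I\}$. An $M\in\mathcal J$ is positive if some $k\in F_{4(-52)}$ maps it to a diagonal matrix with positive entries, and $X_{\mathbf O}$ is the set of positive $M\in\mathcal J$ with $\det M=1$. The group $G$ acts by $g\circ M=\sqrt{g(M\star M)}$, where $\sqrt P$ is the $Y\in X_{\mathbf O}$ with $Y\star Y=P$. If $M=g\circ I$ and $N=g\circ D$ with $g\in G$ and $D\in X_{\mathbf O}$ diagonal with entries $d_1,d_2,d_3$, then $d(M,N)=\log\max_i d_i+\log\max_i d_i^{-1}$. *Terminology.* For $t\in\mathbf R$, a pair $(x,y)$ of points of $X_{\mathbf K}$ is of shape $(t,0)$ if there is $g\in G$ with $g(x)=I$ and $g(y)=e^{-t/3}\,\mathrm{diag}(e^t,1,1)$. A triple $(x,y,z)$ is an equilateral triangle if for some $t\in\mathbf R$ there is $g\in G$ with $g(x)=I$,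 $g(y)=e^{-t/3}\,\mathrm{diag}(e^t,1,1)$ and $g(z)=e^{-2t/3}\,\mathrm{diag}(e^t,e^t,1)$. A sequence $x_1\dots x_n$ is a $\delta$-path if $d(x_1,x_2)+\dots+d(x_{n-1},x_n)\le d(x_1,x_n)+\delta$. A triple $x,y,z$ is $\delta$-retractable if there is $u\in X_{\mathbf K}$ such that $xuy$, $yuz$ and $zux$ are $\delta$-paths. **Lemma.** For every $\delta_0>0$ there exists $\delta>0$ such that: (1) for all $x,y,z\in X_{\mathbf K}$ there is an equilateral triangle $(x',y',z')$ in $X_{\mathbf K}$ such that $xx'y'y$, $yy'z'z$ and $zz'x'x$ are $\delta$-paths; (2) for all $s,t\in\mathbf R$ of the same sign (that is, $st\ge 0$) and all $z,v,w,y\in X_{\mathbf K}$ such that $d(v,w)<\delta_0$, $(v,z)$ is of shape $(t,0)$ and $(w,y)$ is of shape $(s,0)$, the triple $z,v,y$ is $\delta$-retractable. -/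

import Mathlib

open scoped ComplexOrder

noncomputable section

/-! ## The octonions -/

/-- The Cayley octonions `a + b ℓ`, obtained from the quaternions by Cayley-Dickson doubling. -/
@[ext]
structure Octonion where
  fst : Quaternion ℝ
  snd : Quaternion ℝ

namespace Octonion

instance : Zero Octonion := ⟨⟨0, 0⟩⟩
instance : One Octonion := ⟨⟨1, 0⟩⟩
instance : Add Octonion := ⟨fun x y => ⟨x.fst + y.fst, x.snd + y.snd⟩⟩
instance : Neg Octonion := ⟨fun x => ⟨-x.fst, -x.snd⟩⟩
instance : Sub Octonion := ⟨fun x y => ⟨x.fst - y.fst, x.snd - y.snd⟩⟩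
instance : SMul ℕ Octonion := ⟨fun n x => ⟨n • x.fst, n • x.snd⟩⟩
instance : SMul ℤ Octonion := ⟨fun n x => ⟨n • x.fst, n • x.snd⟩⟩
instance : SMul ℝ Octonion := ⟨fun r x => ⟨r • x.fst, r • x.snd⟩⟩

/-- `(a + bℓ)(c + dℓ) = (ac - d̄b) + (da + bc̄)ℓ`. -/
instance : Mul Octonion :=
  ⟨fun x y => ⟨x.fst * y.fst - star y.snd * x.snd, y.snd * x.fst + x.snd * star y.fst⟩⟩

/-- Octonionic conjugation. -/
instance : Star Octonion := ⟨fun x => ⟨star x.fst, -x.snd⟩⟩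

@[simp] theorem zero_fst : (0 : Octonion).fst = 0 := rfl
@[simp] theorem zero_snd : (0 : Octonion).snd = 0 := rfl
@[simp] theorem one_fst : (1 : Octonion).fst = 1 := rfl
@[simp] theorem one_snd : (1 : Octonion).snd = 0 := rfl
@[simp] theorem add_fst (x y : Octonion) : (x + y).fst = x.fst + y.fst := rfl
@[simp] theorem add_snd (x y : Octonion) : (x + y).snd = x.snd + y.snd := rfl
@[simp] theorem neg_fst (x : Octonion) : (-x).fst = -x.fst := rfl
@[simp] theorem neg_snd (x : Octonion) : (-x).snd = -x.snd := rfl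
@[simp] theorem sub_fst (x y : Octonion) : (x - y).fst = x.fst - y.fst := rfl
@[simp] theorem sub_snd (x y : Octonion) : (x - y).snd = x.snd - y.snd := rfl
@[simp] theorem smul_fst (r : ℝ) (x : Octonion) : (r • x).fst = r • x.fst := rfl
@[simp] theorem smul_snd (r : ℝ) (x : Octonion) : (r • x).snd = r • x.snd := rfl
@[simp] theorem star_fst (x : Octonion) : (star x).fst = star x.fst := rfl
@[simp] theorem star_snd (x : Octonion) : (star x).snd = -x.snd := rfl
@[simp] theorem mul_fst (x y : Octonion) :
    (x * y).fst = x.fst * y.fst - star y.snd * x.snd := rfl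
@[simp] theorem mul_snd (x y : Octonion) :
    (x * y).snd = y.snd * x.fst + x.snd * star y.fst := rfl

theorem toProd_injective :
    Function.Injective (fun x : Octonion => (x.fst, x.snd)) := by
  intro x y h
  exact Octonion.ext (congrArg Prod.fst h) (congrArg Prod.snd h)

instance : AddCommGroup Octonion :=
  toProd_injective.addCommGroup _ rfl (fun _ _ => rfl) (fun _ => rfl) (fun _ _ => rfl)
    (fun _ _ => rfl) (fun _ _ => rfl)

instance : Module ℝ Octonion :=
  toProd_injective.module ℝ
    { toFun := fun x : Octonion => (x.fst, x.snd), map_zero' := rfl, map_add' := fun _ _ => rfl }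
    (fun _ _ => rfl)

instance : NonAssocRing Octonion :=
  { (inferInstance : AddCommGroup Octonion) with
    mul := (· * ·)
    one := 1
    left_distrib := fun x y z => by
      ext1 <;> simp [mul_add, add_mul] <;> abel
    right_distrib := fun x y z => by
      ext1 <;> simp [mul_add, add_mul] <;> abel
    zero_mul := fun x => by ext1 <;> simp
    mul_zero := fun x => by ext1 <;> simp
    one_mul := fun x => by ext1 <;> simp
    mul_one := fun x => by ext1 <;> simp }

instance : StarRing Octonion where
  star_involutive x := by ext1 <;> simp
  star_mul x y := by ext1 <;> simp
  star_add x y := by ext1 <;> simp; abel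

/-- The inclusion of the real numbers. -/
def ofReal (r : ℝ) : Octonion := ⟨(r : Quaternion ℝ), 0⟩

/-- The real part. -/
def re (x : Octonion) : ℝ := x.fst.re

/-- The squared norm `|x|² = x x̄`. -/
def normSq (x : Octonion) : ℝ := re (x * star x)

end Octonion

/-! ## The exceptional Jordan algebra and `X_O = E₆₍₋₂₆₎ / F₄₍₋₅₂₎` -/

/-- The exceptional Jordan algebra: Hermitian `3 × 3` octonionic matrices. -/
def Albert : Submodule ℝ (Matrix (Fin 3) (Fin 3) Octonion) where
  carrier := {M | M.conjTranspose = M}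
  add_mem' := by
    intro M N hM hN
    change Matrix.conjTranspose _ = _ at hM hN
    change Matrix.conjTranspose _ = _
    rw [Matrix.conjTranspose_add, hM, hN]
  zero_mem' := Matrix.conjTranspose_zero
  smul_mem' := by
    intro r M hM
    change Matrix.conjTranspose _ = _ at hM
    change Matrix.conjTranspose _ = _
    nth_rewrite 2 [← hM]
    refine Matrix.ext fun i j => ?_
    apply Octonion.ext <;> simp [Matrix.conjTranspose_apply]

namespace Albert

/-- The Jordan multiplication `M ⋆ N = (MN + NM) / 2`. -/
def jmul (M N : Albert) : Albert :=
  ⟨(1 / 2 : ℝ) • (M.1 * N.1 + N.1 * M.1), Albert.smul_mem _ (by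
    have hM : M.1.conjTranspose = M.1 := M.2
    have hN : N.1.conjTranspose = N.1 := N.2
    change (M.1 * N.1 + N.1 * M.1).conjTranspose = _
    rw [Matrix.conjTranspose_add, Matrix.conjTranspose_mul, Matrix.conjTranspose_mul, hM, hN,
      add_comm])⟩

/-- The real diagonal matrix with entries `a`. -/
def diag (a : Fin 3 → ℝ) : Albert :=
  ⟨Matrix.diagonal fun i => Octonion.ofReal (a i), by
    change Matrix.conjTranspose _ = _
    rw [Matrix.diagonal_conjTranspose]
    congr 1
    funext i
    apply Octonion.ext <;> simp [Octonion.ofReal]⟩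

/-- Freudenthal's determinant
`ξ₁ξ₂ξ₃ - ∑ᵢ ξᵢ|xᵢ|² + 2 Re(x₁x₂x₃)` of the matrix with rows
`(ξ₁, x₃, x̄₂)`, `(x̄₃, ξ₂, x₁)`, `(x₂, x̄₁, ξ₃)`. -/
def det (M : Albert) : ℝ :=
  let ξ₁ := (M.1 0 0).re
  let ξ₂ := (M.1 1 1).re
  let ξ₃ := (M.1 2 2).re
  let x₁ := M.1 1 2
  let x₂ := M.1 2 0
  let x₃ := M.1 0 1
  ξ₁ * ξ₂ * ξ₃ - (ξ₁ * x₁.normSq + ξ₂ * x₂.normSq + ξ₃ * x₃.normSq)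
    + 2 * (x₁ * x₂ * x₃).re

end Albert

/-- `E₆₍₋₂₆₎`: the linear automorphisms of the exceptional Jordan algebra that preserve the
determinant. -/
def E6 : Subgroup (Albert ≃ₗ[ℝ] Albert) where
  carrier := {g | ∀ M, Albert.det (g M) = Albert.det M}
  mul_mem' := by
    intro g h hg hh M
    exact (hg (h M)).trans (hh M)
  one_mem' := fun _ => rfl
  inv_mem' := by
    intro g hg M
    have h := hg (g⁻¹ M)
    have e : g (g⁻¹ M) = M := g.apply_symm_apply M
    rw [e] at h
    exact h.symm

/-- `F₄₍₋₅₂₎`: the elements of `E₆₍₋₂₆₎` that fix the identity matrix. -/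
def F4 : Set (Albert ≃ₗ[ℝ] Albert) :=
  {g | g ∈ E6 ∧ g (Albert.diag 1) = Albert.diag 1}

/-- Positivity: some element of `F₄₍₋₅₂₎` diagonalizes `M`, with positive diagonal entries. -/
def Albert.Positive (M : Albert) : Prop :=
  ∃ k ∈ F4, ∃ a : Fin 3 → ℝ, (∀ i, 0 < a i) ∧ k M = Albert.diag a

/-- The model of `E₆₍₋₂₆₎ / F₄₍₋₅₂₎`: positive matrices of determinant one. -/
def XO : Type := {M : Albert // Albert.det M = 1 ∧ Albert.Positive M}

/-- `ActsO g M N` says that `g ∘ M = N` for the action `g ∘ M = √(g(M²))`: here `√P` is the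
element `N` of `XO` with `N ⋆ N = P`. -/
def ActsO (g : E6) (M N : XO) : Prop :=
  Albert.jmul N.1 N.1 = g.1 (Albert.jmul M.1 M.1)

/-- `D` is the diagonal matrix with entries `a`. -/
def IsDiagO (D : XO) (a : Fin 3 → ℝ) : Prop := D.1 = Albert.diag a

/-- The distance on `XO`: if `M = g ∘ I` and `N = g ∘ D` with `D` diagonal, then
`d(M, N) = log ‖D‖ + log ‖D⁻¹‖`, where `‖·‖` is the largest diagonal entry. Such `g` and `D`
exist, and `D` is unique up to permutation of its entries, so the infimum below is that of a
one-point set. -/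
def distO (M N : XO) : ℝ :=
  sInf {r | ∃ (g : E6) (I D : XO) (a : Fin 3 → ℝ), IsDiagO I 1 ∧ IsDiagO D a ∧
    ActsO g I M ∧ ActsO g D N ∧ r = Real.log (⨆ i, a i) + Real.log (⨆ i, (a i)⁻¹)}

/-! ## `X_H = SL₃(H) / SU₃(H)` -/

/-- `SL₃(H)`: the complex `6 × 6` matrices `M` of determinant one with `J M J⁻¹ = M̄`, where
`J` has blocks `0, -I, I, 0`. (The condition `J M J⁻¹ = M̄` describes the image of the `3 × 3`
quaternionic matrices.) -/
def SL3H : Set (Matrix (Fin 3 ⊕ Fin 3) (Fin 3 ⊕ Fin 3) ℂ) :=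
  {M | Matrix.J (Fin 3) ℂ * M * (Matrix.J (Fin 3) ℂ)⁻¹ = M.map star ∧ M.det = 1}

/-- The model of `SL₃(H) / SU₃(H)`: positive Hermitian matrices in `SL₃(H)`. -/
def XH : Type := {M : Matrix (Fin 3 ⊕ Fin 3) (Fin 3 ⊕ Fin 3) ℂ // M ∈ SL3H ∧ M.PosDef}

/-- `ActsH g x y` says that `g(x) = y` for the action `g(x) = (g x² g*)^{1/2}`, where the root is
the positive one. -/
def ActsH (g : SL3H) (x y : XH) : Prop :=
  y.1 * y.1 = g.1 * (x.1 * x.1) * g.1.conjTranspose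

/-- `D` is the real diagonal `3 × 3` matrix with entries `a`. -/
def IsDiagH (D : XH) (a : Fin 3 → ℝ) : Prop :=
  D.1 = Matrix.fromBlocks (Matrix.diagonal fun i => (a i : ℂ)) 0 0
    (Matrix.diagonal fun i => (a i : ℂ))

/-- The operator norm for the Euclidean norm on `H³ = ℂ⁶`. -/
def opNorm (M : Matrix (Fin 3 ⊕ Fin 3) (Fin 3 ⊕ Fin 3) ℂ) : ℝ :=
  ‖Matrix.toEuclideanCLM (𝕜 := ℂ) M‖

/-- `d(x, y) = log ‖x⁻¹y‖ + log ‖y⁻¹x‖`. -/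
def distH (x y : XH) : ℝ :=
  Real.log (opNorm (x.1⁻¹ * y.1)) + Real.log (opNorm (y.1⁻¹ * x.1))

/-! ## Shapes, equilateral triangles and `δ`-paths -/

/-- The two division algebras: quaternions and octonions. -/
inductive DivAlg
  | H
  | O

/-- The group `SL₃(H)` or `E₆₍₋₂₆₎`. -/
def GroupK : DivAlg → Type
  | .H => SL3H
  | .O => E6

/-- The symmetric space `X_H` or `X_O`. -/
def SpaceK : DivAlg → Type
  | .H => XH
  | .O => XO

/-- `Acts g x y` says that `g(x) = y`. -/
def Acts : {K : DivAlg} → GroupK K → SpaceK K → SpaceK K → Prop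
  | .H => ActsH
  | .O => ActsO

/-- `D` is the diagonal matrix with entries `a`. -/
def IsDiag : {K : DivAlg} → SpaceK K → (Fin 3 → ℝ) → Prop
  | .H => IsDiagH
  | .O => IsDiagO

/-- The distance on `X_K`. -/
def distK : {K : DivAlg} → SpaceK K → SpaceK K → ℝ
  | .H => distH
  | .O => distO

/-- `(x, y)` is of shape `(t, 0)`. -/
def HasShape {K : DivAlg} (t : ℝ) (x y : SpaceK K) : Prop :=
  ∃ (g : GroupK K) (p q : SpaceK K), Acts g x p ∧ Acts g y q ∧ IsDiag p 1 ∧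
    IsDiag q (Real.exp (-t / 3) • ![Real.exp t, 1, 1])

/-- `(x, y, z)` is an equilateral triangle of oriented size `t`. -/
def IsEquilateral {K : DivAlg} (t : ℝ) (x y z : SpaceK K) : Prop :=
  ∃ (g : GroupK K) (p q r : SpaceK K), Acts g x p ∧ Acts g y q ∧ Acts g z r ∧ IsDiag p 1 ∧
    IsDiag q (Real.exp (-t / 3) • ![Real.exp t, 1, 1]) ∧
    IsDiag r (Real.exp (-2 * t / 3) • ![Real.exp t, Real.exp t, 1])

/-- The sequence `p 0, …, p n` is a `δ`-path. -/
def IsDeltaPath {K : DivAlg} (δ : ℝ) {n : ℕ} (p : Fin (n + 1) → SpaceK K) : Prop :=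
  ∑ i : Fin n, distK (p i.castSucc) (p i.succ) ≤ distK (p 0) (p (Fin.last n)) + δ

/-- The triple `x, y, z` is `δ`-retractable. -/
def IsRetractable {K : DivAlg} (δ : ℝ) (x y z : SpaceK K) : Prop :=
  ∃ u : SpaceK K, IsDeltaPath δ ![x, u, y] ∧ IsDeltaPath δ ![y, u, z] ∧ IsDeltaPath δ ![z, u, x]

end

open scoped ComplexOrder

noncomputable section

open scoped InnerProductSpace

set_option linter.unusedSectionVars false

/-! ## Symmetric composition algebras -/

/-! A point `x` is represented by its square `P`, on which the group acts linearly: by `P ↦ g P g*`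
over the quaternions, by `g` itself over the octonions. The group preserves the cone of positive
semidefinite elements. Both algebras are treated at once, because the arguments only need the
identities of `SymmetricComposition` for the product `conj (x * y)`.

Let `ratio P Q` be the least `c` with `Q ≤ c P`, and `mu` its logarithm on squares. Then `mu` is not
symmetric, but it satisfies the triangle inequality, and the distance is the mean of `mu x y` and
`mu y x` (`dist_eq_mu`). The lemma becomes a statement about the order.

Part (1): the path from `y` through `x` to `z` has excess `exc x y z = mu y x + mu x z - mu y z`, so
a triangle has two excesses at each vertex, one per orientation. Adding suitable multiples of `Q`
and `R` to `P` moves `x` almost geodesically towards both other vertices until one of its excesses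
is at most `log 3` (`exists_vertex_retraction`). After this is done at all three vertices, each has
a bounded excess. If the orientations disagree, the three points are close together. If they agree,
the triangle normalises to `1 ≤ Q ≤ R ≤ τ` with comparisons that are optimal up to a constant, and
eigenvalue estimates (`middle_eigenvalue_le`, `near_diag_of_offDiag_eq_zero`) force `Q ≈ diag (τ, 1,
1)` and `R ≈ diag (τ, τ, 1)` in a common frame.

Part (2): normalise `V = 1`. Up to scalars `Z = 1 + (τ - 1) f` and `Y = L (1 + (σ - 1) f)`, where
`L` is an order automorphism with `L 1` comparable to `1`, and `f` is the same projection in both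
because the signs agree. An inequality `Z ≤ n Y` bounds the angle between `f` and a projection above
`L f`, which gives back a bound of `Y` by a multiple of `Z` (`le_smul_of_le_smul`). Hence the two
excesses at `v` differ by a bounded amount, and the retraction at `v` makes both small.

The rest is a spectral theorem by plane rotations and the identification of the two concrete spaces
with `ConeModel`. -/

/-- A Euclidean symmetric composition algebra. The quaternions and the octonions carry this
structure for the product `conj (x * y)`. -/
class SymmetricComposition (A : Type) [NormedAddCommGroup A] [InnerProductSpace ℝ A] where
  mul : A →ₗ[ℝ] A →ₗ[ℝ] A
  inner_mul : ∀ x y z, ⟪mul x y, z⟫_ℝ = ⟪x, mul y z⟫_ℝ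
  mul_mul_cancel_left : ∀ x y, mul (mul x y) x = ‖x‖ ^ 2 • y
  mul_mul_cancel_right : ∀ x y, mul x (mul y x) = ‖x‖ ^ 2 • y

namespace SymmetricComposition

variable {A : Type} [NormedAddCommGroup A] [InnerProductSpace ℝ A] [SymmetricComposition A]

theorem inner_mul_cyc (x y z : A) : ⟪mul x y, z⟫_ℝ = ⟪mul y z, x⟫_ℝ := by
  rw [inner_mul, real_inner_comm]

theorem inner_mul_mul_left (u x y : A) : ⟪mul u x, mul u y⟫_ℝ = ‖u‖ ^ 2 * ⟪x, y⟫_ℝ := by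
  rw [inner_mul_cyc, inner_mul_cyc, mul_mul_cancel_left, real_inner_smul_left, real_inner_comm]

theorem inner_mul_mul_right (u x y : A) : ⟪mul x u, mul y u⟫_ℝ = ‖u‖ ^ 2 * ⟪x, y⟫_ℝ := by
  rw [inner_mul, mul_mul_cancel_right, real_inner_smul_right]

/-- Linearisation of `mul_mul_cancel_right` in `x`. -/
theorem mul_mul_add_mul_mul (x y z : A) :
    mul x (mul y z) + mul z (mul y x) = (2 * ⟪x, z⟫_ℝ) • y := by
  have h := mul_mul_cancel_right (x + z) y
  have h1 := mul_mul_cancel_right x y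
  have h2 := mul_mul_cancel_right z y
  simp only [map_add, LinearMap.add_apply, h1, h2, norm_add_sq_real, add_smul] at h
  rw [show mul x (mul y z) + mul z (mul y x) = (‖x‖ ^ 2 • y + mul z (mul y x) +
    (mul x (mul y z) + ‖z‖ ^ 2 • y)) - ‖x‖ ^ 2 • y - ‖z‖ ^ 2 • y by abel, h]
  abel

/-- The cross term in the invariance of the cubic norm under a rotation. -/
theorem inner_mul_mul_mul (x u y z : A) :
    ⟪mul x (mul z u), mul u y⟫_ℝ =
      2 * ⟪x, u⟫_ℝ * ⟪mul u y, z⟫_ℝ - ‖u‖ ^ 2 * ⟪mul x y, z⟫_ℝ := by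
  have h := mul_mul_add_mul_mul x z u
  rw [eq_sub_of_add_eq h, inner_sub_left, real_inner_smul_left, inner_mul_mul_left,
    real_inner_comm z, inner_mul_cyc z x y]

end SymmetricComposition

open SymmetricComposition

/-! ### Hermitian matrices in coordinates: trace form, cubic norm, adjoint -/

/-- Hermitian `3 × 3` matrices over `A`: the diagonal entries, and the entries
`(1, 2)`, `(2, 0)`, `(0, 1)`. -/
abbrev Herm3 (A : Type) : Type := (Fin 3 → ℝ) × (Fin 3 → A)

namespace Herm3

variable {A : Type} [NormedAddCommGroup A] [InnerProductSpace ℝ A]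

/-- Diagonal matrices. -/
def diag (b : Fin 3 → ℝ) : Herm3 A := (b, 0)

@[simp] theorem diag_fst (b : Fin 3 → ℝ) : (diag b : Herm3 A).1 = b := rfl
@[simp] theorem diag_snd (b : Fin 3 → ℝ) : (diag b : Herm3 A).2 = 0 := rfl

theorem diag_smul (c : ℝ) (b : Fin 3 → ℝ) : (diag (c • b) : Herm3 A) = c • diag b := by
  ext i <;> simp

theorem diag_add (b c : Fin 3 → ℝ) : (diag (b + c) : Herm3 A) = diag b + diag c := by
  ext i <;> simp

/-- The trace form. -/
def pair (X Y : Herm3 A) : ℝ :=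
  X.1 0 * Y.1 0 + X.1 1 * Y.1 1 + X.1 2 * Y.1 2 +
    2 * (⟪X.2 0, Y.2 0⟫_ℝ + ⟪X.2 1, Y.2 1⟫_ℝ + ⟪X.2 2, Y.2 2⟫_ℝ)

/-- The trace. -/
def tr (X : Herm3 A) : ℝ := X.1 0 + X.1 1 + X.1 2

theorem pair_add_left (X Y Z : Herm3 A) : pair (X + Y) Z = pair X Z + pair Y Z := by
  simp only [pair, Prod.fst_add, Prod.snd_add, Pi.add_apply, inner_add_left]; ring

theorem pair_smul_left (r : ℝ) (X Z : Herm3 A) : pair (r • X) Z = r * pair X Z := by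
  simp only [pair, Prod.smul_fst, Prod.smul_snd, Pi.smul_apply, real_inner_smul_left,
    smul_eq_mul]; ring

theorem pair_comm (X Y : Herm3 A) : pair X Y = pair Y X := by
  simp only [pair, real_inner_comm]; ring

theorem pair_add_right (X Y Z : Herm3 A) : pair X (Y + Z) = pair X Y + pair X Z := by
  rw [pair_comm, pair_add_left, pair_comm Y, pair_comm Z]

theorem pair_smul_right (r : ℝ) (X Z : Herm3 A) : pair X (r • Z) = r * pair X Z := by
  rw [pair_comm, pair_smul_left, pair_comm]

theorem pair_sub_left (X Y Z : Herm3 A) : pair (X - Y) Z = pair X Z - pair Y Z := by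
  rw [sub_eq_add_neg, ← neg_one_smul ℝ Y, pair_add_left, pair_smul_left]; ring

theorem pair_zero_left (X : Herm3 A) : pair 0 X = 0 := by simp [pair]

theorem pair_diag_left (b : Fin 3 → ℝ) (X : Herm3 A) :
    pair (diag b) X = b 0 * X.1 0 + b 1 * X.1 1 + b 2 * X.1 2 := by simp [pair]

theorem pair_diag_one_left (X : Herm3 A) : pair (diag 1) X = tr X := by
  simp [pair_diag_left, tr]

/-- The trace form is positive definite, so testing against `X` itself suffices. -/
theorem eq_zero_of_pair_eq_zero {X : Herm3 A} (h : ∀ Y, pair Y X = 0) : X = 0 := by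
  have h0 := h X
  simp only [pair, real_inner_self_eq_norm_sq] at h0
  have e0 : X.1 0 = 0 := by nlinarith [sq_nonneg ‖X.2 0‖, sq_nonneg ‖X.2 1‖, sq_nonneg ‖X.2 2‖]
  have e1 : X.1 1 = 0 := by nlinarith [sq_nonneg ‖X.2 0‖, sq_nonneg ‖X.2 1‖, sq_nonneg ‖X.2 2‖]
  have e2 : X.1 2 = 0 := by nlinarith [sq_nonneg ‖X.2 0‖, sq_nonneg ‖X.2 1‖, sq_nonneg ‖X.2 2‖]
  simp only [e0, e1, e2] at h0
  have f0 : ‖X.2 0‖ = 0 := by nlinarith [sq_nonneg ‖X.2 0‖, sq_nonneg ‖X.2 1‖, sq_nonneg ‖X.2 2‖]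
  have f1 : ‖X.2 1‖ = 0 := by nlinarith [sq_nonneg ‖X.2 0‖, sq_nonneg ‖X.2 1‖, sq_nonneg ‖X.2 2‖]
  have f2 : ‖X.2 2‖ = 0 := by nlinarith [sq_nonneg ‖X.2 0‖, sq_nonneg ‖X.2 1‖, sq_nonneg ‖X.2 2‖]
  rw [norm_eq_zero] at f0 f1 f2
  ext i <;> fin_cases i <;> simp [*]

variable [SymmetricComposition A]

/-- The cubic norm. -/
def det (X : Herm3 A) : ℝ :=
  X.1 0 * X.1 1 * X.1 2
    - (X.1 0 * ‖X.2 0‖ ^ 2 + X.1 1 * ‖X.2 1‖ ^ 2 + X.1 2 * ‖X.2 2‖ ^ 2)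
    + 2 * ⟪mul (X.2 0) (X.2 1), X.2 2⟫_ℝ

/-- The adjoint matrix. -/
def sharp (X : Herm3 A) : Herm3 A :=
  (![X.1 1 * X.1 2 - ‖X.2 0‖ ^ 2, X.1 2 * X.1 0 - ‖X.2 1‖ ^ 2, X.1 0 * X.1 1 - ‖X.2 2‖ ^ 2],
   ![mul (X.2 1) (X.2 2) - X.1 0 • X.2 0, mul (X.2 2) (X.2 0) - X.1 1 • X.2 1,
     mul (X.2 0) (X.2 1) - X.1 2 • X.2 2])

theorem det_diag (b : Fin 3 → ℝ) : det (diag b : Herm3 A) = b 0 * b 1 * b 2 := by simp [det]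

theorem det_smul (c : ℝ) (X : Herm3 A) : det (c • X) = c ^ 3 * det X := by
  simp only [det, Prod.smul_fst, Prod.smul_snd, Pi.smul_apply, map_smul, LinearMap.smul_apply,
    real_inner_smul_left, real_inner_smul_right, smul_eq_mul, norm_smul, mul_pow,
    Real.norm_eq_abs, sq_abs]
  ring

/-- Terms odd in `N` cancel, and the quadratic ones pair with the adjoint. Through this identity the
determinant controls rank, and together with `1` also the trace form and the adjoint. -/
theorem det_add_add_det_sub (Y N : Herm3 A) :
    det (Y + N) + det (Y - N) = 2 * det Y + 2 * pair Y (sharp N) := by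
  simp only [det, pair, sharp, Prod.fst_add, Prod.snd_add, Pi.add_apply, Prod.fst_sub,
    Prod.snd_sub, Pi.sub_apply, norm_add_sq_real, norm_sub_sq_real, map_add, map_sub,
    LinearMap.add_apply, LinearMap.sub_apply, inner_add_left, inner_add_right, inner_sub_left,
    inner_sub_right, Matrix.cons_val_zero, Matrix.cons_val_one, Matrix.cons_val,
    real_inner_smul_right]
  rw [real_inner_comm (mul (N.2 1) (N.2 2)), real_inner_comm (mul (N.2 2) (N.2 0)),
    real_inner_comm (mul (N.2 0) (N.2 1)), ← inner_mul_cyc (Y.2 0), inner_mul_cyc (N.2 2)]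
  ring

/-- The linear automorphism group of `det`. -/
def detGroup (A : Type) [NormedAddCommGroup A] [InnerProductSpace ℝ A] [SymmetricComposition A] :
    Subgroup (Herm3 A ≃ₗ[ℝ] Herm3 A) where
  carrier := {g | ∀ X, det (g X) = det X}
  mul_mem' := fun {g h} hg hh X => (hg (h X)).trans (hh X)
  one_mem' := fun _ => rfl
  inv_mem' := fun {g} hg X => by
    have h := hg (g⁻¹ X)
    rw [show g (g⁻¹ X) = X from g.apply_symm_apply X] at h
    exact h.symm

/-- Matrices of rank at most one with nonnegative diagonal. -/
def RankOne (N : Herm3 A) : Prop := sharp N = 0 ∧ 0 ≤ tr N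

/-- Expresses rank one through the determinant alone, so that linear maps scaling `det` by a nonzero
constant preserve it. -/
theorem sharp_eq_zero_iff (N : Herm3 A) :
    sharp N = 0 ↔ ∀ Y, det (Y + N) + det (Y - N) = 2 * det Y := by
  constructor
  · intro h Y
    rw [det_add_add_det_sub, h, pair_comm, pair_zero_left]; ring
  · intro h
    refine eq_zero_of_pair_eq_zero fun Y => ?_
    linarith [det_add_add_det_sub Y N, h Y]

/-- Products of two diagonal entries are squared norms, so no two entries have opposite signs; the
trace then fixes the sign. -/
theorem RankOne.entries {N : Herm3 A} (h : RankOne N) :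
    (∀ i, 0 ≤ N.1 i) ∧ N.1 1 * N.1 2 = ‖N.2 0‖ ^ 2 ∧ N.1 2 * N.1 0 = ‖N.2 1‖ ^ 2 ∧
      N.1 0 * N.1 1 = ‖N.2 2‖ ^ 2 := by
  obtain ⟨h1, h2⟩ := h
  have e0 := congrFun (congrArg Prod.fst h1) 0
  have e1 := congrFun (congrArg Prod.fst h1) 1
  have e2 := congrFun (congrArg Prod.fst h1) 2
  simp only [sharp, Matrix.cons_val_zero, Matrix.cons_val_one, Matrix.cons_val, Prod.fst_zero,
    Pi.zero_apply, sub_eq_zero] at e0 e1 e2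
  simp only [tr] at h2
  refine ⟨fun i => ?_, e0, e1, e2⟩
  have p0 := sq_nonneg ‖N.2 0‖
  have p1 := sq_nonneg ‖N.2 1‖
  have p2 := sq_nonneg ‖N.2 2‖
  fin_cases i
  · change 0 ≤ N.1 0
    by_contra hn
    push Not at hn
    nlinarith
  · change 0 ≤ N.1 1
    by_contra hn
    push Not at hn
    nlinarith
  · change 0 ≤ N.1 2
    by_contra hn
    push Not at hn
    nlinarith

theorem RankOne.nonneg {N : Herm3 A} (h : RankOne N) (i : Fin 3) : 0 ≤ N.1 i := h.entries.1 i

/-! ## Generators of the group -/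

/-- The matrix of the rotation in the last two coordinates with angle `(c, s)` and axis `u`,
acting by conjugation. -/
def rotFun (u : A) (c s : ℝ) (X : Herm3 A) : Herm3 A :=
  (![X.1 0, c ^ 2 * X.1 1 + 2 * c * s * ⟪u, X.2 0⟫_ℝ + s ^ 2 * X.1 2,
     s ^ 2 * X.1 1 - 2 * c * s * ⟪u, X.2 0⟫_ℝ + c ^ 2 * X.1 2],
   ![X.2 0 + (c * s * (X.1 2 - X.1 1) - 2 * s ^ 2 * ⟪u, X.2 0⟫_ℝ) • u,
     c • X.2 1 - s • mul (X.2 2) u, c • X.2 2 + s • mul u (X.2 1)])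

theorem rotFun_rotFun_neg {u : A} {c s : ℝ} (hu : ‖u‖ = 1) (h : c ^ 2 + s ^ 2 = 1) (X : Herm3 A) :
    rotFun u c s (rotFun u c (-s) X) = X := by
  have hs : c ^ 2 = 1 - s ^ 2 := by linarith
  have h3 : c ^ 3 = c * (1 - s ^ 2) := by rw [← hs]; ring
  have h4 : c ^ 4 = (1 - s ^ 2) ^ 2 := by rw [← hs]; ring
  ext i
  · fin_cases i <;>
      simp [rotFun, inner_add_right, real_inner_smul_right, hu] <;> ring_nf <;>
        simp only [hs, h3, h4] <;> ring
  · fin_cases i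
    · simp only [rotFun, inner_add_right, real_inner_smul_right, hu, real_inner_self_eq_norm_sq,
        Fin.zero_eta, Matrix.cons_val_zero, Matrix.cons_val_one, Matrix.cons_val]
      rw [add_assoc, ← add_smul]
      convert add_zero _
      convert zero_smul ℝ u
      ring_nf
      simp only [hs, h3]; ring
    · simp [rotFun, mul_mul_cancel_left, hu, smul_add, smul_smul]
      rw [mul_comm s c]
      have : X.2 1 = (c * c + s * s) • X.2 1 := by
        rw [show c * c + s * s = 1 by linarith, one_smul]
      conv_rhs => rw [this, add_smul]
      abel
    · simp [rotFun, mul_mul_cancel_right, hu, smul_add, smul_smul]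
      rw [mul_comm s c]
      have : X.2 2 = (c * c + s * s) • X.2 2 := by
        rw [show c * c + s * s = 1 by linarith, one_smul]
      conv_rhs => rw [this, add_smul]
      abel

/-- `rotFun` as a linear automorphism. -/
def rot (u : A) (c s : ℝ) (hu : ‖u‖ = 1) (h : c ^ 2 + s ^ 2 = 1) : Herm3 A ≃ₗ[ℝ] Herm3 A where
  toFun := rotFun u c s
  map_add' X Y := by
    ext i
    · fin_cases i <;> simp [rotFun, inner_add_right] <;> ring
    · fin_cases i
      · simp [rotFun, inner_add_right]; module
      · simp [rotFun]; abel
      · simp [rotFun]; abel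
  map_smul' r X := by
    ext i
    · fin_cases i <;> simp [rotFun, real_inner_smul_right] <;> ring
    · fin_cases i
      · simp [rotFun, real_inner_smul_right]; module
      · simp [rotFun]; module
      · simp [rotFun]; module
  invFun := rotFun u c (-s)
  left_inv X := by
    have := rotFun_rotFun_neg (c := c) (s := -s) hu (by linarith [h, neg_sq s]) X
    rwa [neg_neg] at this
  right_inv X := rotFun_rotFun_neg hu h X

theorem det_rot (u : A) (c s : ℝ) (hu : ‖u‖ = 1) (h : c ^ 2 + s ^ 2 = 1) (X : Herm3 A) :
    det (rot u c s hu h X) = det X := by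
  change det (rotFun u c s X) = _
  have e1 : ⟪X.2 1, mul (X.2 2) u⟫_ℝ = ⟪mul u (X.2 1), X.2 2⟫_ℝ := by
    rw [← inner_mul_cyc, real_inner_comm, inner_mul_cyc, inner_mul_cyc, real_inner_comm]
  have e1' : ⟪X.2 2, mul u (X.2 1)⟫_ℝ = ⟪mul u (X.2 1), X.2 2⟫_ℝ := real_inner_comm _ _
  have e2 : ‖mul (X.2 2) u‖ ^ 2 = ‖X.2 2‖ ^ 2 := by
    rw [← real_inner_self_eq_norm_sq, inner_mul_mul_right, hu, real_inner_self_eq_norm_sq]; ring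
  have e3 : ‖mul u (X.2 1)‖ ^ 2 = ‖X.2 1‖ ^ 2 := by
    rw [← real_inner_self_eq_norm_sq, inner_mul_mul_left, hu, real_inner_self_eq_norm_sq]; ring
  have e4 (x : A) : ⟪mul x (X.2 1), mul u (X.2 1)⟫_ℝ = ‖X.2 1‖ ^ 2 * ⟪x, u⟫_ℝ :=
    inner_mul_mul_right _ _ _
  have e5 (x : A) : ⟪mul x (mul (X.2 2) u), X.2 2⟫_ℝ = ‖X.2 2‖ ^ 2 * ⟪u, x⟫_ℝ := by
    rw [inner_mul_cyc, mul_mul_cancel_left, real_inner_smul_left]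
  have e6 : ⟪X.2 0, u⟫_ℝ = ⟪u, X.2 0⟫_ℝ := real_inner_comm _ _
  simp only [det, rotFun, Matrix.cons_val_zero, Matrix.cons_val_one, Matrix.cons_val,
    norm_add_sq_real, norm_sub_sq_real, map_add, map_sub, map_smul, LinearMap.add_apply,
    LinearMap.smul_apply, inner_add_left, inner_add_right, inner_sub_left, real_inner_smul_left,
    real_inner_smul_right, norm_smul, mul_pow, Real.norm_eq_abs, sq_abs, e1, e1', e2, e3, e4, e5,
    inner_mul_mul_mul, e6, hu, real_inner_self_eq_norm_sq]
  -- All inner products have been reduced to a few scalars; what remains is a polynomial identity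
  -- modulo `c² + s² = 1`.
  generalize ⟪u, X.2 0⟫_ℝ = p
  generalize ⟪mul u (X.2 1), X.2 2⟫_ℝ = t
  generalize ⟪mul (X.2 0) (X.2 1), X.2 2⟫_ℝ = T
  generalize ‖X.2 0‖ = n0
  generalize ‖X.2 1‖ = n1
  generalize ‖X.2 2‖ = n2
  generalize X.1 0 = a
  generalize X.1 1 = b
  generalize X.1 2 = d
  have hs : c ^ 2 = 1 - s ^ 2 := by linarith
  have h3 : c ^ 3 = c * (1 - s ^ 2) := by rw [← hs]; ring
  have h4 : c ^ 4 = (1 - s ^ 2) ^ 2 := by rw [← hs]; ring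
  ring_nf
  simp only [hs, h3, h4]
  ring

/-- The cyclic permutation of the coordinates. -/
def cyc : Herm3 A ≃ₗ[ℝ] Herm3 A where
  toFun X := (![X.1 1, X.1 2, X.1 0], ![X.2 1, X.2 2, X.2 0])
  map_add' X Y := by ext i <;> fin_cases i <;> simp
  map_smul' r X := by ext i <;> fin_cases i <;> simp
  invFun X := (![X.1 2, X.1 0, X.1 1], ![X.2 2, X.2 0, X.2 1])
  left_inv X := by ext i <;> fin_cases i <;> simp
  right_inv X := by ext i <;> fin_cases i <;> simp

theorem det_cyc (X : Herm3 A) : det (cyc X) = det X := by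
  simp only [det, cyc, LinearEquiv.coe_mk, LinearMap.coe_mk, AddHom.coe_mk, Matrix.cons_val_zero,
    Matrix.cons_val_one, Matrix.cons_val]
  rw [← inner_mul_cyc]
  ring

/-- Conjugation by the diagonal matrix `a`. -/
def dil (a : Fin 3 → ℝ) (ha : ∀ i, 0 < a i) : Herm3 A ≃ₗ[ℝ] Herm3 A where
  toFun X := (![a 0 ^ 2 * X.1 0, a 1 ^ 2 * X.1 1, a 2 ^ 2 * X.1 2],
    ![(a 1 * a 2) • X.2 0, (a 2 * a 0) • X.2 1, (a 0 * a 1) • X.2 2])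
  map_add' X Y := by ext i <;> fin_cases i <;> simp [mul_add]
  map_smul' r X := by
    ext i <;> fin_cases i <;> simp [smul_smul, mul_comm, mul_left_comm]
  invFun X := (![(a 0 ^ 2)⁻¹ * X.1 0, (a 1 ^ 2)⁻¹ * X.1 1, (a 2 ^ 2)⁻¹ * X.1 2],
    ![(a 1 * a 2)⁻¹ • X.2 0, (a 2 * a 0)⁻¹ • X.2 1, (a 0 * a 1)⁻¹ • X.2 2])
  left_inv X := by
    have h0 := (ha 0).ne'
    have h1 := (ha 1).ne'
    have h2 := (ha 2).ne'
    ext i <;> fin_cases i <;> simp [smul_smul] <;> field_simp <;> simp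
  right_inv X := by
    have h0 := (ha 0).ne'
    have h1 := (ha 1).ne'
    have h2 := (ha 2).ne'
    ext i <;> fin_cases i <;> simp [smul_smul] <;> field_simp <;> simp

theorem dil_apply (a : Fin 3 → ℝ) (ha : ∀ i, 0 < a i) (X : Herm3 A) :
    dil a ha X = (![a 0 ^ 2 * X.1 0, a 1 ^ 2 * X.1 1, a 2 ^ 2 * X.1 2],
    ![(a 1 * a 2) • X.2 0, (a 2 * a 0) • X.2 1, (a 0 * a 1) • X.2 2]) := rfl

theorem det_dil (a : Fin 3 → ℝ) (ha : ∀ i, 0 < a i) (X : Herm3 A) :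
    det (dil a ha X) = (a 0 * a 1 * a 2) ^ 2 * det X := by
  simp only [det, dil_apply, Matrix.cons_val_zero, Matrix.cons_val_one, Matrix.cons_val, norm_smul,
    map_smul, LinearMap.smul_apply, real_inner_smul_left, real_inner_smul_right, mul_pow,
    Real.norm_eq_abs, sq_abs]
  ring

theorem pair_dil (a : Fin 3 → ℝ) (ha : ∀ i, 0 < a i) (X Y : Herm3 A) :
    pair (dil a ha X) Y = pair X (dil a ha Y) := by
  simp only [pair, dil_apply, Matrix.cons_val_zero, Matrix.cons_val_one, Matrix.cons_val,
    real_inner_smul_left, real_inner_smul_right]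
  ring

theorem RankOne.dil {N : Herm3 A} (h : RankOne N) (a : Fin 3 → ℝ) (ha : ∀ i, 0 < a i) :
    RankOne (dil a ha N) := by
  constructor
  · have e : (∀ Y : Herm3 A, det (Y + N) + det (Y - N) = 2 * det Y) :=
      (sharp_eq_zero_iff N).1 h.1
    rw [sharp_eq_zero_iff]
    intro Y
    have := e ((Herm3.dil a ha).symm Y)
    have hp : (a 0 * a 1 * a 2) ^ 2 ≠ 0 := by
      have := ha 0; have := ha 1; have := ha 2; positivity
    apply_fun (fun r => (a 0 * a 1 * a 2) ^ 2 * r) at this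
    simp only [mul_add] at this
    rw [← det_dil a ha, ← det_dil a ha, mul_left_comm, ← det_dil a ha] at this
    simpa using this
  · have h0 := h.nonneg 0
    have h1 := h.nonneg 1
    have h2 := h.nonneg 2
    simp only [tr, dil_apply, Matrix.cons_val_zero, Matrix.cons_val_one, Matrix.cons_val]
    positivity

end Herm3

namespace Herm3

variable {A : Type} [NormedAddCommGroup A] [InnerProductSpace ℝ A] [SymmetricComposition A]

/-! ## The isotropy group of the identity -/

theorem sharp_diag_one : sharp (diag 1 : Herm3 A) = diag 1 := by
  ext i <;> fin_cases i <;> simp [sharp]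

theorem pair_self_eq (X : Herm3 A) : pair X X = tr X ^ 2 - 2 * tr (sharp X) := by
  simp only [pair, tr, sharp, real_inner_self_eq_norm_sq, Matrix.cons_val_zero,
    Matrix.cons_val_one, Matrix.cons_val]
  ring

/-- This and the next identity recover the trace and the trace of the adjoint from `det` and `1`.
Hence `unitGroup` preserves both, and by `pair_self_eq` the trace form. -/
theorem det_add_one_add_det_sub_one (X : Herm3 A) :
    det (X + diag 1) + det (X - diag 1) = 2 * det X + 2 * tr X := by
  rw [det_add_add_det_sub, sharp_diag_one, pair_comm, pair_diag_one_left]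

theorem det_one_add_add_det_one_sub (X : Herm3 A) :
    det (diag 1 + X) + det (diag 1 - X) = 2 + 2 * tr (sharp X) := by
  rw [det_add_add_det_sub, pair_diag_one_left, det_diag]; simp

/-- The linear maps that preserve the determinant and the identity matrix. -/
def unitGroup (A : Type) [NormedAddCommGroup A] [InnerProductSpace ℝ A] [SymmetricComposition A] :
    Subgroup (Herm3 A ≃ₗ[ℝ] Herm3 A) where
  carrier := {g | g ∈ detGroup A ∧ g (diag 1) = diag 1}
  mul_mem' := fun {g h} hg hh => ⟨mul_mem hg.1 hh.1, by
    change g (h _) = _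
    rw [hh.2, hg.2]⟩
  one_mem' := ⟨one_mem _, rfl⟩
  inv_mem' := fun {g} hg => ⟨inv_mem hg.1, by
    change g.symm _ = _
    rw [LinearEquiv.symm_apply_eq, hg.2]⟩

theorem tr_map {g : Herm3 A ≃ₗ[ℝ] Herm3 A} (hg : g ∈ unitGroup A) (X : Herm3 A) :
    tr (g X) = tr X := by
  have h := det_add_one_add_det_sub_one (g X)
  have h' := det_add_one_add_det_sub_one X
  rw [← hg.2, ← map_add, ← map_sub, hg.1, hg.1, hg.1] at h
  linarith

theorem tr_sharp_map {g : Herm3 A ≃ₗ[ℝ] Herm3 A} (hg : g ∈ unitGroup A) (X : Herm3 A) :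
    tr (sharp (g X)) = tr (sharp X) := by
  have h := det_one_add_add_det_one_sub (g X)
  have h' := det_one_add_add_det_one_sub X
  rw [← hg.2, ← map_add, ← map_sub, hg.1, hg.1] at h
  linarith

theorem pair_map_map {g : Herm3 A ≃ₗ[ℝ] Herm3 A} (hg : g ∈ unitGroup A) (X Y : Herm3 A) :
    pair (g X) (g Y) = pair X Y := by
  have key (Z : Herm3 A) : pair (g Z) (g Z) = pair Z Z := by
    rw [pair_self_eq, pair_self_eq, tr_map hg, tr_sharp_map hg]
  have h := key (X + Y)
  simp only [map_add, pair_add_left, pair_add_right, key] at h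
  linarith [pair_comm X Y, pair_comm (g X) (g Y)]

/-- The adjoint is determined by `det` and the nondegenerate trace form, both invariant. -/
theorem sharp_map {g : Herm3 A ≃ₗ[ℝ] Herm3 A} (hg : g ∈ unitGroup A) (X : Herm3 A) :
    sharp (g X) = g (sharp X) := by
  rw [← sub_eq_zero]
  refine eq_zero_of_pair_eq_zero fun Y => ?_
  obtain ⟨Y, rfl⟩ := g.surjective Y
  have h := det_add_add_det_sub (g Y) (g X)
  have h' := det_add_add_det_sub Y X
  rw [← map_add, ← map_sub, hg.1, hg.1, hg.1] at h
  rw [pair_comm, pair_sub_left, pair_comm, pair_comm _ (g Y), pair_map_map hg]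
  linarith

theorem RankOne.map {g : Herm3 A ≃ₗ[ℝ] Herm3 A} (hg : g ∈ unitGroup A) {N : Herm3 A}
    (h : RankOne N) : RankOne (g N) := by
  refine ⟨?_, ?_⟩
  · rw [sharp_map hg, h.1, map_zero]
  · rw [tr_map hg]; exact h.2

/-! ## The order -/

/-- The order of the cone dual to the rank one elements, which is the cone of positive
semidefinite matrices. -/
def Le (X Y : Herm3 A) : Prop := ∀ N, RankOne N → pair X N ≤ pair Y N

theorem Le.refl (X : Herm3 A) : Le X X := fun _ _ => le_rfl

theorem Le.trans {X Y Z : Herm3 A} (h : Le X Y) (h' : Le Y Z) : Le X Z :=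
  fun N hN => (h N hN).trans (h' N hN)

/-- The linear automorphisms of the order. -/
def orderGroup (A : Type) [NormedAddCommGroup A] [InnerProductSpace ℝ A] [SymmetricComposition A] :
    Subgroup (Herm3 A ≃ₗ[ℝ] Herm3 A) where
  carrier := {g | ∀ X Y, Le (g X) (g Y) ↔ Le X Y}
  mul_mem' := fun {g h} hg hh X Y => (hg (h X) (h Y)).trans (hh X Y)
  one_mem' := fun _ _ => Iff.rfl
  inv_mem' := fun {g} hg X Y => by
    have h := hg (g⁻¹ X) (g⁻¹ Y)
    rw [show g (g⁻¹ X) = X from g.apply_symm_apply X,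
      show g (g⁻¹ Y) = Y from g.apply_symm_apply Y] at h
    exact h.symm

theorem unitGroup_le_orderGroup : unitGroup A ≤ orderGroup A := by
  have key : ∀ g ∈ unitGroup A, ∀ X Y : Herm3 A, Le X Y → Le (g X) (g Y) := by
    intro g hg X Y h N hN
    have := h _ (hN.map (inv_mem hg))
    rw [← pair_map_map hg, ← pair_map_map hg Y] at this
    rwa [show g (g⁻¹ N) = N from g.apply_symm_apply N] at this
  intro g hg X Y
  refine ⟨fun h => ?_, key g hg X Y⟩
  have := key _ (inv_mem hg) _ _ h
  rwa [show g⁻¹ (g X) = X from g.symm_apply_apply X,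
    show g⁻¹ (g Y) = Y from g.symm_apply_apply Y] at this

/-- Dilations are self-adjoint for the trace form and preserve rank one. The product of the `a i` is
arbitrary; the pinching inequalities depend on this. -/
theorem dil_mem_orderGroup (a : Fin 3 → ℝ) (ha : ∀ i, 0 < a i) : dil a ha ∈ orderGroup A := by
  intro X Y
  constructor
  · intro h N hN
    have hb : ∀ i, 0 < (a i)⁻¹ := fun i => inv_pos.2 (ha i)
    have e : dil a ha (dil (fun i => (a i)⁻¹) hb N) = N := by
      have h0 := (ha 0).ne'
      have h1 := (ha 1).ne'
      have h2 := (ha 2).ne'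
      ext i <;> fin_cases i <;> simp [dil_apply, smul_smul] <;> field_simp <;> simp
    have := h _ (hN.dil (fun i => (a i)⁻¹) hb)
    rwa [pair_dil, pair_dil, e] at this
  · intro h N hN
    rw [pair_dil, pair_dil]
    exact h _ (hN.dil a ha)

theorem rankOne_diag {i : Fin 3} {r : ℝ} (hr : 0 ≤ r) :
    RankOne (diag (Pi.single i r) : Herm3 A) := by
  constructor
  · ext j
    · fin_cases i <;> fin_cases j <;> simp [sharp]
    · fin_cases i <;> fin_cases j <;> simp [sharp]
  · fin_cases i <;> simp [tr, hr]

theorem pair_diag_single (X : Herm3 A) (i : Fin 3) (r : ℝ) :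
    pair X (diag (Pi.single i r)) = r * X.1 i := by
  fin_cases i <;> simp [pair, mul_comm]

theorem Le.apply_le {X Y : Herm3 A} (h : Le X Y) (i : Fin 3) : X.1 i ≤ Y.1 i := by
  have := h _ (rankOne_diag (i := i) zero_le_one)
  simpa [pair_diag_single] using this

theorem le_diag_iff {b c : Fin 3 → ℝ} : Le (diag b : Herm3 A) (diag c) ↔ ∀ i, b i ≤ c i := by
  refine ⟨fun h i => h.apply_le i, fun h N hN => ?_⟩
  rw [pair_diag_left, pair_diag_left]
  have := mul_le_mul_of_nonneg_right (h 0) (hN.nonneg 0)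
  have := mul_le_mul_of_nonneg_right (h 1) (hN.nonneg 1)
  have := mul_le_mul_of_nonneg_right (h 2) (hN.nonneg 2)
  linarith

/-! ## The spectral theorem -/

/-- The group generated by rotations and the cyclic permutation. -/
def rotGroup (A : Type) [NormedAddCommGroup A] [InnerProductSpace ℝ A] [SymmetricComposition A] :
    Subgroup (Herm3 A ≃ₗ[ℝ] Herm3 A) :=
  Subgroup.closure ({cyc} ∪ {g | ∃ u c s hu h, g = rot u c s hu h})

theorem cyc_mem_rotGroup : (cyc : Herm3 A ≃ₗ[ℝ] Herm3 A) ∈ rotGroup A :=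
  Subgroup.subset_closure (Or.inl rfl)

theorem rot_mem_rotGroup (u : A) (c s : ℝ) (hu : ‖u‖ = 1) (h : c ^ 2 + s ^ 2 = 1) :
    rot u c s hu h ∈ rotGroup A :=
  Subgroup.subset_closure (Or.inr ⟨u, c, s, hu, h, rfl⟩)

theorem cyc_apply (X : Herm3 A) :
    cyc X = (![X.1 1, X.1 2, X.1 0], ![X.2 1, X.2 2, X.2 0]) := rfl

theorem cyc_diag (a b c : ℝ) : cyc (diag ![a, b, c] : Herm3 A) = diag ![b, c, a] := by
  ext i <;> fin_cases i <;> simp [cyc_apply]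

theorem rot_apply (u : A) (c s : ℝ) (hu : ‖u‖ = 1) (h : c ^ 2 + s ^ 2 = 1) (X : Herm3 A) :
    rot u c s hu h X = rotFun u c s X := rfl

theorem rotGroup_le_unitGroup : rotGroup A ≤ unitGroup A := by
  rw [rotGroup, Subgroup.closure_le]
  rintro g (rfl | ⟨u, c, s, hu, h, rfl⟩)
  · refine ⟨det_cyc, ?_⟩
    ext i <;> fin_cases i <;> simp [cyc_apply]
  · refine ⟨det_rot u c s hu h, ?_⟩
    have h' : s ^ 2 + c ^ 2 = 1 := by linarith
    ext i <;> fin_cases i <;> simp [rot_apply, rotFun, h, h']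

theorem exists_unit [Nontrivial A] (x : A) : ∃ u : A, ‖u‖ = 1 ∧ x = ‖x‖ • u := by
  by_cases hx : x = 0
  · obtain ⟨u, hu⟩ := exists_norm_eq A zero_le_one
    exact ⟨u, hu, by simp [hx]⟩
  · have : ‖x‖ ≠ 0 := norm_ne_zero_iff.2 hx
    exact ⟨‖x‖⁻¹ • x, by simp [norm_smul, this], by simp [smul_smul, this]⟩

/-- The angle is half the polar angle of `-d + i r`. The equation will cancel an off-diagonal entry,
and the inequality will order two diagonal entries. -/
theorem exists_rotation_angle (r d : ℝ) :
    ∃ c s : ℝ, c ^ 2 + s ^ 2 = 1 ∧ r * (1 - 2 * s ^ 2) + 2 * c * s * d = 0 ∧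
      0 ≤ 2 * c * s * r - (1 - 2 * s ^ 2) * d := by
  obtain ⟨R, φ, hR, h1, h2⟩ : ∃ R φ : ℝ, 0 ≤ R ∧ R * Real.cos φ = -d ∧ R * Real.sin φ = r :=
    ⟨‖(⟨-d, r⟩ : ℂ)‖, Complex.arg ⟨-d, r⟩, norm_nonneg _, Complex.norm_mul_cos_arg _,
      Complex.norm_mul_sin_arg _⟩
  have e1 : 1 - 2 * Real.sin (φ / 2) ^ 2 = Real.cos φ := by
    have := Real.cos_two_mul (φ / 2)
    rw [show 2 * (φ / 2) = φ by ring] at this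
    linarith [Real.sin_sq_add_cos_sq (φ / 2)]
  have e2 : 2 * Real.cos (φ / 2) * Real.sin (φ / 2) = Real.sin φ := by
    have := Real.sin_two_mul (φ / 2)
    rw [show 2 * (φ / 2) = φ by ring] at this
    linarith
  refine ⟨Real.cos (φ / 2), Real.sin (φ / 2), Real.cos_sq_add_sin_sq _, ?_, ?_⟩
  · rw [e1, e2, ← h2, show d = -(R * Real.cos φ) by linarith]; ring
  · rw [e1, e2, ← h2, show d = -(R * Real.cos φ) by linarith]
    have : Real.sin φ * (R * Real.sin φ) - Real.cos φ * -(R * Real.cos φ) =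
      R * (Real.sin φ ^ 2 + Real.cos φ ^ 2) := by ring
    rw [this, Real.sin_sq_add_cos_sq]; simpa using hR

variable [Nontrivial A]

/-- Diagonalises the lower right block of `X`. The middle clauses record what the rotation leaves
intact, so that it can be applied after other entries have been arranged. -/
theorem exists_rotation_offDiag_eq_zero (X : Herm3 A) :
    ∃ k ∈ rotGroup A, (∀ Y, (k Y).1 0 = Y.1 0) ∧
      (∀ a b, k (diag ![a, b, b]) = diag ![a, b, b]) ∧
      (∀ Y : Herm3 A, Y.2 1 = 0 → Y.2 2 = 0 → (k Y).2 1 = 0 ∧ (k Y).2 2 = 0) ∧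
      (k X).2 0 = 0 ∧ (k X).1 2 ≤ (k X).1 1 := by
  obtain ⟨u, hu, hx⟩ := exists_unit (X.2 0)
  obtain ⟨c, s, h, h1, h2⟩ := exists_rotation_angle ‖X.2 0‖ ((X.1 2 - X.1 1) / 2)
  have hp : ⟪u, X.2 0⟫_ℝ = ‖X.2 0‖ := by
    conv_lhs => rw [hx, real_inner_smul_right, real_inner_self_eq_norm_sq, hu]
    ring
  refine ⟨rot u c s hu h, rot_mem_rotGroup u c s hu h, fun Y => rfl, fun a b => ?_, fun Y h1 h2 => ?_,
    ?_, ?_⟩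
  · have h' : s ^ 2 + c ^ 2 = 1 := by linarith
    ext i <;> fin_cases i <;> simp [rot_apply, rotFun, ← add_mul, h, h']
  · simp [rot_apply, rotFun, h1, h2]
  · simp only [rot_apply, rotFun, hp, Matrix.cons_val_zero]
    nth_rewrite 1 [hx]
    rw [← add_smul]
    convert zero_smul ℝ u
    linarith
  · simp only [rot_apply, rotFun, hp, Matrix.cons_val_one, Matrix.cons_val]
    have : c ^ 2 = 1 - s ^ 2 := by linarith
    rw [this]; nlinarith

/-- Two plane rotations suffice. Once the block is diagonal, rank one forces its smaller entry, and
with it the last row, to vanish; `cyc` applied twice moves the remaining two coordinates into the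
block. -/
theorem RankOne.exists_map_eq {N : Herm3 A} (hN : RankOne N) (h1 : tr N = 1) :
    ∃ k ∈ rotGroup A, k N = diag ![1, 0, 0] := by
  obtain ⟨k, hk, -, -, -, hx, hle⟩ := exists_rotation_offDiag_eq_zero N
  have hN' := hN.map (rotGroup_le_unitGroup hk)
  obtain ⟨hn, e0, e1, e2⟩ := hN'.entries
  have z2 : (k N).1 2 = 0 := by
    rw [hx] at e0
    simp only [norm_zero] at e0
    have := hn 2
    nlinarith
  have y1 : (k N).2 1 = 0 := by
    rw [z2, zero_mul] at e1
    simpa using e1.symm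
  obtain ⟨k', hk', hk0, -, hk2, hx', hle'⟩ := exists_rotation_offDiag_eq_zero (cyc (cyc (k N)))
  have hc := cyc_mem_rotGroup (A := A)
  have hN'' : RankOne (k' (cyc (cyc (k N)))) :=
    ((hN'.map (rotGroup_le_unitGroup hc)).map (rotGroup_le_unitGroup hc)).map
      (rotGroup_le_unitGroup hk')
  obtain ⟨hn', e0', -, -⟩ := hN''.entries
  have w0 : (k' (cyc (cyc (k N)))).1 0 = 0 := by
    rw [hk0]; simp [cyc_apply, z2]
  have w2 : (k' (cyc (cyc (k N)))).1 2 = 0 := by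
    rw [hx'] at e0'
    simp only [norm_zero] at e0'
    have := hn' 2
    nlinarith
  have ht : tr (k' (cyc (cyc (k N)))) = 1 := by
    rw [tr_map (rotGroup_le_unitGroup hk'), tr_map (rotGroup_le_unitGroup hc),
      tr_map (rotGroup_le_unitGroup hc), tr_map (rotGroup_le_unitGroup hk), h1]
  have w1 : (k' (cyc (cyc (k N)))).1 1 = 1 := by
    rw [tr, w0, w2] at ht; linarith
  obtain ⟨v1, v2⟩ := hk2 (cyc (cyc (k N))) (by simp [cyc_apply, hx]) (by simp [cyc_apply, y1])
  refine ⟨cyc * k' * cyc * cyc * k, mul_mem (mul_mem (mul_mem (mul_mem hc hk') hc) hc) hk, ?_⟩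
  change cyc (k' (cyc (cyc (k N)))) = _
  generalize k' (cyc (cyc (k N))) = Z at *
  ext i <;> fin_cases i <;> simp [cyc_apply, *]

theorem continuous_tr : Continuous (tr : Herm3 A → ℝ) := by unfold tr; fun_prop

theorem continuous_pair (X : Herm3 A) : Continuous (pair X) := by unfold pair; fun_prop

variable [FiniteDimensional ℝ A]

theorem continuous_sharp : Continuous (sharp : Herm3 A → Herm3 A) := by
  have hm : Continuous fun p : A × A => mul p.1 p.2 := by
    have := (LinearMap.toContinuousLinearMap
      ((LinearMap.toContinuousLinearMap (𝕜 := ℝ) (E := A) (F' := A)).toLinearMap ∘ₗ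
        (mul (A := A)))).isBoundedBilinearMap
    exact this.continuous
  have hm' (i j : Fin 3) : Continuous fun X : Herm3 A => mul (X.2 i) (X.2 j) :=
    hm.comp (f := fun X : Herm3 A => (X.2 i, X.2 j)) (by fun_prop)
  have h01 := hm' 0 1
  have h12 := hm' 1 2
  have h20 := hm' 2 0
  unfold sharp
  refine Continuous.prodMk (continuous_pi fun i => ?_) (continuous_pi fun i => ?_)
  · fin_cases i <;> simp <;> fun_prop
  · fin_cases i <;> simp <;> fun_prop

/-- Diagonal entries lie in `[0, 1]`, and their products are the squared norms of the off-diagonal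
entries. -/
theorem isCompact_rankOne : IsCompact {N : Herm3 A | RankOne N ∧ tr N = 1} := by
  refine Metric.isCompact_of_isClosed_isBounded ?_ ?_
  · simp only [RankOne, Set.ofPred_and]
    exact ((isClosed_eq continuous_sharp continuous_const).inter
      (isClosed_le continuous_const continuous_tr)).inter (isClosed_eq continuous_tr
        continuous_const)
  · refine (Metric.isBounded_closedBall (x := (0 : Herm3 A)) (r := 1)).subset ?_
    rintro N ⟨hN, h1⟩
    obtain ⟨hn, e0, e1, e2⟩ := hN.entries
    have n0 := hn 0
    have n1 := hn 1
    have n2 := hn 2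
    rw [tr] at h1
    rw [mem_closedBall_zero_iff, Prod.norm_def, max_le_iff, pi_norm_le_iff_of_nonneg zero_le_one,
      pi_norm_le_iff_of_nonneg zero_le_one]
    refine ⟨fun i => ?_, fun i => ?_⟩
    · rw [Real.norm_eq_abs, abs_le]
      fin_cases i <;> constructor <;> simp <;> linarith
    · have : ‖N.2 i‖ ^ 2 ≤ 1 := by
        fin_cases i <;> simp only [Fin.zero_eta, Fin.mk_one, Fin.reduceFinMk] <;> nlinarith
      nlinarith [norm_nonneg (N.2 i)]

/-- Spectral theorem, by maximising the pairing with `M` over rank-one elements of trace one. When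
the maximiser is moved to the first coordinate, a first-order variation kills the off-diagonal
entries of the first row; a rotation of the other two coordinates finishes. -/
theorem exists_map_eq_diag (M : Herm3 A) :
    ∃ k ∈ rotGroup A, ∃ b : Fin 3 → ℝ, b 1 ≤ b 0 ∧ b 2 ≤ b 1 ∧ k M = diag b := by
  obtain ⟨N, ⟨hN, h1⟩, hmax⟩ := isCompact_rankOne.exists_isMaxOn
    (s := {N : Herm3 A | RankOne N ∧ tr N = 1})
    ⟨diag (Pi.single 0 1), rankOne_diag zero_le_one, by simp [tr]⟩ (continuous_pair M).continuousOn
  obtain ⟨k, hk, hkN⟩ := hN.exists_map_eq h1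
  have hku := rotGroup_le_unitGroup hk
  have max1 (N' : Herm3 A) (hN' : RankOne N') (h1' : tr N' = 1) : pair (k M) N' ≤ (k M).1 0 := by
    have e : pair M N = (k M).1 0 := by
      rw [← pair_map_map hku, hkN]; simp [pair]
    rw [← e]
    have hm := hmax (show k⁻¹ N' ∈ {N : Herm3 A | RankOne N ∧ tr N = 1} from
      ⟨hN'.map (inv_mem hku), by rw [tr_map (inv_mem hku), h1']⟩)
    simp only [Set.mem_ofPred_eq] at hm
    rw [← pair_map_map hku] at hm
    rwa [show k (k⁻¹ N') = N' from k.apply_symm_apply N'] at hm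
  have max2 (N' : Herm3 A) (hN' : RankOne N') (h1' : 0 < tr N') :
      pair (k M) N' ≤ (k M).1 0 * tr N' := by
    have hs : RankOne ((tr N')⁻¹ • N') := by
      refine ⟨?_, by simp only [tr, Prod.smul_fst, Pi.smul_apply, smul_eq_mul, ← mul_add]
                     rw [← tr, inv_mul_cancel₀ h1'.ne']; exact zero_le_one⟩
      rw [show sharp ((tr N')⁻¹ • N') = ((tr N')⁻¹) ^ 2 • sharp N' by
        ext i
        · fin_cases i <;> simp [sharp, norm_smul, mul_pow] <;> ring
        · fin_cases i <;> simp [sharp, smul_sub, smul_smul, sq] <;> module, hN'.1, smul_zero]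
    have := max1 _ hs (by simp only [tr, Prod.smul_fst, Pi.smul_apply, smul_eq_mul, ← mul_add]
                          rw [← tr, inv_mul_cancel₀ h1'.ne'])
    rw [pair_smul_right, inv_mul_le_iff₀ h1'] at this
    linarith
  have small {r d : ℝ} (hr : 0 ≤ r) (h : ∀ ε > 0, 2 * r * ε ≤ ε ^ 2 * r * d) : r = 0 := by
    by_contra hne
    have hr : 0 < r := lt_of_le_of_ne hr (Ne.symm hne)
    have h1 := h (1 / (1 + |d|)) (by positivity)
    have : 0 < 1 / (1 + |d|) := by positivity
    have h2 : 2 ≤ 1 / (1 + |d|) * d := by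
      have h3 : 0 < r * (1 / (1 + |d|)) := by positivity
      by_contra hlt
      push Not at hlt
      nlinarith [mul_lt_mul_of_pos_left hlt h3]
    rw [one_div, inv_mul_eq_div, le_div_iff₀ (by positivity)] at h2
    linarith [le_abs_self d, abs_nonneg d]
  have x2 : (k M).2 2 = 0 := by
    have : ‖(k M).2 2‖ ^ 2 = 0 := by
      -- Tilting the maximiser in the direction of the entry gains linearly in `ε` and costs only
      -- quadratically.
      refine small (d := (k M).1 0 - (k M).1 1) (sq_nonneg _) fun ε hε => ?_
      have := max2 (![1, ε ^ 2 * ‖(k M).2 2‖ ^ 2, 0], ![0, 0, ε • (k M).2 2]) ⟨by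
        ext i <;> fin_cases i <;> simp [sharp, norm_smul, mul_pow], by simp [tr]; positivity⟩
        (by simp [tr]; positivity)
      simp [pair, tr, real_inner_smul_right] at this
      linarith
    simpa using this
  have x1 : (k M).2 1 = 0 := by
    have : ‖(k M).2 1‖ ^ 2 = 0 := by
      refine small (d := (k M).1 0 - (k M).1 2) (sq_nonneg _) fun ε hε => ?_
      have := max2 (![1, 0, ε ^ 2 * ‖(k M).2 1‖ ^ 2], ![0, ε • (k M).2 1, 0]) ⟨by
        ext i <;> fin_cases i <;> simp [sharp, norm_smul, mul_pow], by simp [tr]; positivity⟩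
        (by simp [tr]; positivity)
      simp [pair, tr, real_inner_smul_right] at this
      linarith
    simpa using this
  obtain ⟨k', hk', hk0, -, hk2, hx', hle⟩ := exists_rotation_offDiag_eq_zero (k M)
  obtain ⟨v1, v2⟩ := hk2 _ x1 x2
  refine ⟨k' * k, mul_mem hk' hk, (k' (k M)).1, ?_, hle, ?_⟩
  · have hr := (rankOne_diag (A := A) (i := 1) zero_le_one).map
      (inv_mem (rotGroup_le_unitGroup hk'))
    have := max1 _ hr (by rw [tr_map (inv_mem (rotGroup_le_unitGroup hk'))]; simp [tr])
    rw [hk0]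
    rw [← pair_map_map (rotGroup_le_unitGroup hk'),
      show k' (k'⁻¹ (diag (Pi.single 1 1))) = diag (Pi.single 1 1) from k'.apply_symm_apply _,
      pair_diag_single, one_mul] at this
    exact this
  · change k' (k M) = _
    generalize k' (k M) = Z at *
    ext i <;> fin_cases i <;> simp [*]

end Herm3

namespace Herm3

variable {A : Type} [NormedAddCommGroup A] [InnerProductSpace ℝ A] [SymmetricComposition A]

theorem Le.smul {X Y : Herm3 A} (h : Le X Y) {c : ℝ} (hc : 0 ≤ c) : Le (c • X) (c • Y) := by
  intro N hN
  rw [pair_smul_left, pair_smul_left]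
  exact mul_le_mul_of_nonneg_left (h N hN) hc

theorem Le.add {X Y Z W : Herm3 A} (h : Le X Y) (h' : Le Z W) : Le (X + Z) (Y + W) := by
  intro N hN
  rw [pair_add_left, pair_add_left]
  exact add_le_add (h N hN) (h' N hN)

theorem le_iff_zero_le_sub {X Y : Herm3 A} : Le X Y ↔ Le 0 (Y - X) := by
  refine forall₂_congr fun N _ => ?_
  rw [pair_sub_left, pair_zero_left, sub_nonneg]

theorem zero_le_map_iff {g : Herm3 A ≃ₗ[ℝ] Herm3 A} (hg : g ∈ orderGroup A) {X : Herm3 A} :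
    Le 0 (g X) ↔ Le 0 X := by
  have := hg 0 X
  rwa [map_zero] at this

theorem zero_le_diag_iff {b : Fin 3 → ℝ} : Le (0 : Herm3 A) (diag b) ↔ ∀ i, 0 ≤ b i := by
  rw [show (0 : Herm3 A) = diag 0 from rfl, le_diag_iff]; rfl

theorem smul_diag_one (c : ℝ) : c • (diag 1 : Herm3 A) = diag fun _ => c := by
  ext i <;> simp

/-! ## Pinching -/

/-- The lower right `2 × 2` block. -/
def block (X : Herm3 A) : Herm3 A := (![0, X.1 1, X.1 2], ![X.2 0, 0, 0])

theorem RankOne.block {N : Herm3 A} (h : RankOne N) : RankOne (block N) := by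
  obtain ⟨h0, e0, -, -⟩ := h.entries
  constructor
  · ext i <;> fin_cases i <;> simp [sharp, Herm3.block, e0]
  · have := h0 1; have := h0 2
    simp [tr, Herm3.block]; positivity

theorem pair_block (X Y : Herm3 A) : pair (block X) Y = pair X (block Y) := by
  simp [pair, block]

theorem Le.block {X Y : Herm3 A} (h : Le X Y) : Le (block X) (block Y) := by
  intro N hN
  rw [pair_block, pair_block]
  exact h _ hN.block

/-- The difference of the two sides is `X` conjugated by `diag (2, 1, 1)`; `corner_le` uses `diag
(1, 2, 2)` in the same way. -/
theorem block_le {X : Herm3 A} (h : Le 0 X) :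
    Le (block X) ((2 : ℝ) • (X + diag ![X.1 0, 0, 0])) := by
  rw [le_iff_zero_le_sub]
  have := (zero_le_map_iff (dil_mem_orderGroup ![2, 1, 1] (by
    intro i; fin_cases i <;> simp))).2 h
  convert this using 1
  ext i
  · fin_cases i <;> simp [dil_apply, Herm3.block, Matrix.vecHead, Matrix.vecTail] <;> ring
  · fin_cases i <;> simp [dil_apply, Herm3.block] <;> module

theorem corner_le {X : Herm3 A} (h : Le 0 X) :
    Le (diag ![X.1 0, 0, 0]) ((2 : ℝ) • (X + block X)) := by
  rw [le_iff_zero_le_sub]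
  have := (zero_le_map_iff (dil_mem_orderGroup ![1, 2, 2] (by
    intro i; fin_cases i <;> simp))).2 h
  convert this using 1
  ext i
  · fin_cases i <;> simp [dil_apply, Herm3.block, Matrix.vecHead, Matrix.vecTail] <;> ring
  · fin_cases i <;> simp [dil_apply, Herm3.block, Matrix.vecHead, Matrix.vecTail] <;> module

/-- With `β = √(1 - C⁻¹)`, conjugating `X - diag (X₀ / C, 0, 0)` by `diag (β⁻¹, β, β)` restores the
corner, keeps the cross terms and shrinks the block by `1 - C⁻¹`. -/
theorem inv_smul_block_le {X : Herm3 A} {C : ℝ} (hC : 1 < C)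
    (h : Le (diag ![X.1 0 / C, 0, 0]) X) : Le (C⁻¹ • block X) X := by
  have hC0 : 0 < C := by linarith
  have hb : 0 < 1 - C⁻¹ := by
    have := inv_lt_one_of_one_lt₀ hC
    linarith
  have hs : 0 < √(1 - C⁻¹) := Real.sqrt_pos.2 hb
  have hs2 : √(1 - C⁻¹) ^ 2 = 1 - C⁻¹ := Real.sq_sqrt hb.le
  rw [le_iff_zero_le_sub] at h ⊢
  have := (zero_le_map_iff (dil_mem_orderGroup ![(√(1 - C⁻¹))⁻¹, √(1 - C⁻¹), √(1 - C⁻¹)] (by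
    intro i; fin_cases i <;> simp <;> linarith [inv_lt_one_of_one_lt₀ hC]))).2 h
  convert this using 1
  ext i
  · fin_cases i
    · have hC1 : C - 1 ≠ 0 := by linarith
      simp [dil_apply, Herm3.block, hs2]
      field_simp
    · simp [dil_apply, Herm3.block, hs2]; ring
    · simp [dil_apply, Herm3.block, hs2]; ring
  · fin_cases i
    · simp [dil_apply, Herm3.block, ← sq, hs2]; module
    · simp [dil_apply, Herm3.block, hs.ne']
    · simp [dil_apply, Herm3.block, hs.ne']

/-- The difference of the two sides is `X` with the signs of its cross terms changed, that is, `X`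
conjugated by `diag (1, -1, -1)`. -/
theorem le_pinch [Nontrivial A] {X : Herm3 A} (h : Le 0 X) :
    Le X ((2 : ℝ) • (diag ![X.1 0, 0, 0] + block X)) := by
  obtain ⟨u, hu, -⟩ := exists_unit (0 : A)
  rw [le_iff_zero_le_sub]
  have := (zero_le_map_iff (unitGroup_le_orderGroup (rotGroup_le_unitGroup
    (rot_mem_rotGroup u (-1) 0 hu (by norm_num))))).2 h
  convert this using 1
  ext i
  · fin_cases i <;> simp [rot_apply, rotFun, Herm3.block] <;> ring
  · fin_cases i <;> simp [rot_apply, rotFun, Herm3.block]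
    module

/-! ## Positive definite elements -/

variable [Nontrivial A] [FiniteDimensional ℝ A]

theorem zero_le_of_rankOne {N : Herm3 A} (h : RankOne N) : Le 0 N := by
  obtain ⟨k, hk, b, -, -, hb⟩ := exists_map_eq_diag N
  rw [← zero_le_map_iff (unitGroup_le_orderGroup (rotGroup_le_unitGroup hk)), hb, zero_le_diag_iff]
  have := h.map (rotGroup_le_unitGroup hk)
  rw [hb] at this
  exact this.nonneg

/-- Self-duality of the cone: diagonalising `Z` writes it as a nonnegative combination of rank-one
elements. -/
theorem Le.pair_le {X Y Z : Herm3 A} (h : Le X Y) (hZ : Le 0 Z) : pair X Z ≤ pair Y Z := by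
  obtain ⟨k, hk, b, -, -, hb⟩ := exists_map_eq_diag Z
  have hku := rotGroup_le_unitGroup hk
  have hko := unitGroup_le_orderGroup hku
  have hb0 : ∀ i, 0 ≤ b i := by
    rwa [← zero_le_map_iff hko, hb, zero_le_diag_iff] at hZ
  rw [← pair_map_map hku, ← pair_map_map hku Y, hb, pair_comm, pair_comm _ (diag b),
    pair_diag_left, pair_diag_left]
  have h' := (hko X Y).2 h
  have := mul_le_mul_of_nonneg_left (h'.apply_le 0) (hb0 0)
  have := mul_le_mul_of_nonneg_left (h'.apply_le 1) (hb0 1)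
  have := mul_le_mul_of_nonneg_left (h'.apply_le 2) (hb0 2)
  linarith

theorem le_tr_smul_one {X : Herm3 A} (h : Le 0 X) : Le X (tr X • diag 1) := by
  obtain ⟨k, hk, b, -, -, hb⟩ := exists_map_eq_diag X
  have hku := rotGroup_le_unitGroup hk
  have hko := unitGroup_le_orderGroup hku
  rw [← zero_le_map_iff hko, hb, zero_le_diag_iff] at h
  rw [← hko, map_smul, hku.2, ← tr_map hku, hb, smul_diag_one, le_diag_iff]
  have := h 0; have := h 1; have := h 2
  intro i
  fin_cases i <;> simp [tr] <;> linarith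

/-- Positive definite elements. -/
def PosDef (X : Herm3 A) : Prop := ∃ ε : ℝ, 0 < ε ∧ Le (ε • diag 1) X

theorem PosDef.zero_le {X : Herm3 A} (h : PosDef X) : Le 0 X := by
  obtain ⟨ε, hε, h⟩ := h
  refine Le.trans ?_ h
  rw [smul_diag_one, zero_le_diag_iff]
  exact fun _ => hε.le

theorem posDef_diag {b : Fin 3 → ℝ} (hb : ∀ i, 0 < b i) : PosDef (diag b : Herm3 A) := by
  refine ⟨min (b 0) (min (b 1) (b 2)), by simp [hb], ?_⟩
  rw [smul_diag_one, le_diag_iff]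
  intro i
  fin_cases i <;> simp

theorem PosDef.pos {b : Fin 3 → ℝ} (h : PosDef (diag b : Herm3 A)) (i : Fin 3) : 0 < b i := by
  obtain ⟨ε, hε, h⟩ := h
  rw [smul_diag_one, le_diag_iff] at h
  exact hε.trans_le (h i)

theorem PosDef.mono {X Y : Herm3 A} (h : PosDef X) (h' : Le X Y) : PosDef Y := by
  obtain ⟨ε, hε, h⟩ := h
  exact ⟨ε, hε, h.trans h'⟩

theorem PosDef.smul {X : Herm3 A} (h : PosDef X) {c : ℝ} (hc : 0 < c) : PosDef (c • X) := by
  obtain ⟨ε, hε, h⟩ := h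
  refine ⟨c * ε, by positivity, ?_⟩
  rw [mul_smul]
  exact h.smul hc.le

theorem PosDef.map_unit {X : Herm3 A} (h : PosDef X) {k : Herm3 A ≃ₗ[ℝ] Herm3 A}
    (hk : k ∈ unitGroup A) : PosDef (k X) := by
  obtain ⟨ε, hε, h⟩ := h
  refine ⟨ε, hε, ?_⟩
  rw [← hk.2, ← map_smul]
  exact (unitGroup_le_orderGroup hk _ _).2 h

/-! ### Transitivity on positive elements of determinant one, and the ratio of two elements -/

/-- The group generated by rotations and dilations. -/
def genGroup (A : Type) [NormedAddCommGroup A] [InnerProductSpace ℝ A] [SymmetricComposition A] :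
    Subgroup (Herm3 A ≃ₗ[ℝ] Herm3 A) :=
  Subgroup.closure (({cyc} ∪ {g | ∃ u c s hu h, g = rot u c s hu h}) ∪
    {g | ∃ a ha, a 0 * a 1 * a 2 = 1 ∧ g = dil a ha})

theorem rotGroup_le_genGroup : rotGroup A ≤ genGroup A :=
  Subgroup.closure_mono Set.subset_union_left

theorem genGroup_le_orderGroup : genGroup A ≤ orderGroup A := by
  rw [genGroup, Subgroup.closure_le]
  rintro g (h | ⟨a, ha, -, rfl⟩)
  · exact unitGroup_le_orderGroup (rotGroup_le_unitGroup (Subgroup.subset_closure h))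
  · exact dil_mem_orderGroup a ha

theorem genGroup_le_detGroup : genGroup A ≤ detGroup A := by
  rw [genGroup, Subgroup.closure_le]
  rintro g (h | ⟨a, ha, h1, rfl⟩)
  · exact (rotGroup_le_unitGroup (Subgroup.subset_closure h)).1
  · intro X
    rw [det_dil, h1]; ring

theorem PosDef.det_pos {P : Herm3 A} (h : PosDef P) : 0 < det P := by
  obtain ⟨k, hk, b, -, -, hb⟩ := exists_map_eq_diag P
  have hku := rotGroup_le_unitGroup hk
  have hb' : PosDef (diag b : Herm3 A) := hb ▸ h.map_unit hku
  have h0 := hb'.pos 0; have h1 := hb'.pos 1; have h2 := hb'.pos 2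
  rw [← hku.1, hb, det_diag]; positivity

theorem exists_map_eq_one {P : Herm3 A} (h : PosDef P) (h1 : det P = 1) :
    ∃ g ∈ genGroup A, g P = diag 1 := by
  obtain ⟨k, hk, b, -, -, hb⟩ := exists_map_eq_diag P
  have hku := rotGroup_le_unitGroup hk
  have hb' : PosDef (diag b : Herm3 A) := hb ▸ h.map_unit hku
  rw [← hku.1, hb, det_diag] at h1
  have ha : ∀ i, 0 < (√(b i))⁻¹ := fun i => inv_pos.2 (Real.sqrt_pos.2 (hb'.pos i))
  refine ⟨dil _ ha * k, mul_mem (Subgroup.subset_closure (Or.inr ⟨_, ha, ?_, rfl⟩))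
    (rotGroup_le_genGroup hk), ?_⟩
  · rw [← mul_inv, ← mul_inv, ← Real.sqrt_mul (hb'.pos 0).le,
      ← Real.sqrt_mul (mul_pos (hb'.pos 0) (hb'.pos 1)).le, h1]; simp
  · change dil _ ha (k P) = _
    rw [hb]
    have key (i : Fin 3) : (√(b i))⁻¹ ^ 2 * b i = 1 := by
      rw [inv_pow, Real.sq_sqrt (hb'.pos i).le, inv_mul_cancel₀ (hb'.pos i).ne']
    ext i
    · fin_cases i
      · simpa [dil_apply] using key 0
      · simpa [dil_apply] using key 1
      · simpa [dil_apply] using key 2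
    · fin_cases i <;> simp [dil_apply]

theorem exists_map_eq_one_diag {P : Herm3 A} (h : PosDef P) (h1 : det P = 1) (Q : Herm3 A) :
    ∃ g ∈ genGroup A, ∃ b : Fin 3 → ℝ, b 1 ≤ b 0 ∧ b 2 ≤ b 1 ∧ g P = diag 1 ∧ g Q = diag b := by
  obtain ⟨g, hg, hP⟩ := exists_map_eq_one h h1
  obtain ⟨k, hk, b, hb1, hb2, hb⟩ := exists_map_eq_diag (g Q)
  refine ⟨k * g, mul_mem (rotGroup_le_genGroup hk) hg, b, hb1, hb2, ?_, hb⟩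
  change k (g P) = _
  rw [hP, (rotGroup_le_unitGroup hk).2]

theorem PosDef.exists_smul_det {P : Herm3 A} (h : PosDef P) :
    ∃ c : ℝ, 0 < c ∧ det (c • P) = 1 := by
  have hd := h.det_pos
  refine ⟨(det P) ^ (-(1 / 3) : ℝ), by positivity, ?_⟩
  rw [det_smul, ← Real.rpow_natCast, ← Real.rpow_mul hd.le]
  norm_num
  rw [Real.rpow_neg_one, inv_mul_cancel₀ hd.ne']

/-- The least `c` with `Q ≤ c P`. -/
def ratio (P Q : Herm3 A) : ℝ := sInf {c | Le Q (c • P)}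

/-- The infimum is attained: with `c₀ P` moved to `1` and `Q` diagonalised with largest entry `b 0`,
the condition on `c` reads `c₀ b 0 ≤ c`. -/
theorem le_smul_ratio {P : Herm3 A} (hP : PosDef P) (Q : Herm3 A) :
    IsLeast {c | Le Q (c • P)} (ratio P Q) := by
  obtain ⟨c₀, hc₀, h1⟩ := hP.exists_smul_det
  obtain ⟨g, hg, b, hb1, hb2, hgP, hgQ⟩ := exists_map_eq_one_diag (hP.smul hc₀) h1 Q
  have key (c : ℝ) : Le Q (c • P) ↔ c₀ * b 0 ≤ c := by
    have e : c • P = (c / c₀) • (c₀ • P) := by rw [smul_smul, div_mul_cancel₀ _ hc₀.ne']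
    rw [e, ← genGroup_le_orderGroup hg, map_smul, hgP, hgQ, smul_diag_one, le_diag_iff]
    constructor
    · intro h
      have := h 0
      rwa [le_div_iff₀ hc₀, mul_comm] at this
    · intro h i
      rw [le_div_iff₀ hc₀]
      fin_cases i <;> simp <;> nlinarith
  have : IsLeast {c | Le Q (c • P)} (c₀ * b 0) := by
    simp only [key]
    exact isLeast_Ici
  rw [ratio, this.csInf_eq]
  exact this

theorem PosDef.le_ratio {P : Herm3 A} (hP : PosDef P) (Q : Herm3 A) : Le Q (ratio P Q • P) :=
  (le_smul_ratio hP Q).1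

theorem PosDef.ratio_le {P Q : Herm3 A} (hP : PosDef P) {c : ℝ} (h : Le Q (c • P)) :
    ratio P Q ≤ c := (le_smul_ratio hP Q).2 h

theorem PosDef.apply_pos {P : Herm3 A} (hP : PosDef P) (i : Fin 3) : 0 < P.1 i := by
  obtain ⟨ε, hε, h⟩ := hP
  have := h.apply_le i
  simp at this
  linarith

theorem ratio_pos {P Q : Herm3 A} (hP : PosDef P) (hQ : PosDef Q) : 0 < ratio P Q := by
  have := (hP.le_ratio Q).apply_le 0
  simp only [Prod.smul_fst, Pi.smul_apply, smul_eq_mul] at this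
  have h1 := hP.apply_pos 0
  have h2 := hQ.apply_pos 0
  by_contra h
  nlinarith

theorem ratio_triangle {P Q R : Herm3 A} (hP : PosDef P) (hQ : PosDef Q) (hR : PosDef R) :
    ratio P R ≤ ratio P Q * ratio Q R := by
  refine hP.ratio_le ?_
  rw [mul_comm, mul_smul]
  exact (hQ.le_ratio R).trans ((hP.le_ratio Q).smul (ratio_pos hQ hR).le)

theorem ratio_self {P : Herm3 A} (hP : PosDef P) : ratio P P = 1 := by
  refine le_antisymm (hP.ratio_le (by rw [one_smul]; exact Le.refl _)) ?_
  have := (hP.le_ratio P).apply_le 0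
  simp only [Prod.smul_fst, Pi.smul_apply, smul_eq_mul] at this
  have h1 := hP.apply_pos 0
  by_contra h
  nlinarith

theorem ratio_smul_right {P : Herm3 A} (hP : PosDef P) (Q : Herm3 A) {c : ℝ} (hc : 0 < c) :
    ratio P (c • Q) = c * ratio P Q := by
  refine le_antisymm (hP.ratio_le ?_) ?_
  · rw [mul_smul]; exact (hP.le_ratio Q).smul hc.le
  · rw [← le_div_iff₀' hc]
    refine hP.ratio_le ?_
    have := (hP.le_ratio (c • Q)).smul (inv_pos.2 hc).le
    rwa [smul_smul, smul_smul, inv_mul_cancel₀ hc.ne', one_smul, inv_mul_eq_div] at this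

theorem ratio_smul_left {P : Herm3 A} (hP : PosDef P) (Q : Herm3 A) {c : ℝ} (hc : 0 < c) :
    ratio (c • P) Q = c⁻¹ * ratio P Q := by
  refine le_antisymm ((hP.smul hc).ratio_le ?_) ?_
  · rw [smul_smul, mul_assoc, mul_comm _ c, ← mul_assoc, inv_mul_cancel₀ hc.ne', one_mul]
    exact hP.le_ratio Q
  · rw [inv_mul_le_iff₀ hc]
    refine hP.ratio_le ?_
    rw [mul_comm, mul_smul]
    exact (hP.smul hc).le_ratio Q

theorem ratio_map {g : Herm3 A ≃ₗ[ℝ] Herm3 A} (hg : g ∈ orderGroup A) (P Q : Herm3 A) :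
    ratio (g P) (g Q) = ratio P Q := by
  rw [ratio, ratio]
  congr 1
  ext c
  change Le (g Q) (c • g P) ↔ Le Q (c • P)
  rw [← map_smul, hg]

/-- A point on almost geodesics from `P` to `Q` and from `P` to `R`, as far away from `P` as
possible. -/
theorem exists_retraction {P Q R : Herm3 A} (hP : PosDef P) (hQ : PosDef Q) (hR : PosDef R)
    {l : ℝ} (hl : 1 ≤ l) (h1 : l * ratio Q R ≤ ratio Q P * ratio P R)
    (h2 : l * ratio R Q ≤ ratio R P * ratio P Q) :
    ∃ P₁, PosDef P₁ ∧ ratio P₁ P ≤ 1 ∧ ratio P P₁ ≤ 3 * l ∧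
      ratio P₁ Q ≤ ratio P Q / l ∧ ratio Q P₁ ≤ 3 * ratio Q P ∧
      ratio P₁ R ≤ ratio P R / l ∧ ratio R P₁ ≤ 3 * ratio R P := by
  have pq := ratio_pos hP hQ
  have pr := ratio_pos hP hR
  have qp := ratio_pos hQ hP
  have rp := ratio_pos hR hP
  have qr := ratio_pos hQ hR
  have rq := ratio_pos hR hQ
  have l0 : 0 < l := by linarith
  have q0 := hQ.zero_le
  have r0 := hR.zero_le
  have p0 := hP.zero_le
  -- `s` and `r` are the largest coefficients with `s Q ≤ l P` and `r R ≤ l P`. The new point is `P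
  -- + s Q + r R`.
  set s := l / ratio P Q with hs
  set r := l / ratio P R with hr
  have hs0 : 0 < s := by positivity
  have hr0 : 0 < r := by positivity
  have hsq : s * ratio P Q = l := div_mul_cancel₀ _ pq.ne'
  have hrr : r * ratio P R = l := div_mul_cancel₀ _ pr.ne'
  have hle : Le P (P + s • Q + r • R) := fun N hN => by
    have := q0 N hN; have := r0 N hN
    simp only [pair_add_left, pair_smul_left, pair_zero_left] at *
    nlinarith
  have hP₁ : PosDef (P + s • Q + r • R) := hP.mono hle
  have t1 := ratio_triangle hP hQ hR
  have t2 := ratio_triangle hP hR hQ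
  -- From `h1` and the triangle inequality through `Q`. With `s2` it bounds each of the three
  -- summands of the new point by `ratio Q P • Q`, whence the factor 3.
  have s1 : s ≤ ratio Q P := by
    rw [hs, div_le_iff₀ pq]
    refine le_of_mul_le_mul_right (h1.trans ?_) qr
    nlinarith
  have r1 : r ≤ ratio R P := by
    rw [hr, div_le_iff₀ pr]
    refine le_of_mul_le_mul_right (h2.trans ?_) rq
    nlinarith
  have s2 : r * ratio Q R ≤ ratio Q P := by
    rw [hr, div_mul_eq_mul_div, div_le_iff₀ pr]; exact h1
  have r2 : s * ratio R Q ≤ ratio R P := by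
    rw [hs, div_mul_eq_mul_div, div_le_iff₀ pq]; exact h2
  refine ⟨P + s • Q + r • R, hP₁, hP₁.ratio_le (by rwa [one_smul]), hP.ratio_le ?_,
    hP₁.ratio_le ?_, hQ.ratio_le ?_, hP₁.ratio_le ?_, hR.ratio_le ?_⟩ <;> intro N hN
  · have e1 := hP.le_ratio Q N hN
    have e2 := hP.le_ratio R N hN
    have e3 := p0 N hN
    simp only [pair_add_left, pair_smul_left, pair_zero_left] at *
    have e4 := mul_le_mul_of_nonneg_left e1 hs0.le
    have e5 := mul_le_mul_of_nonneg_left e2 hr0.le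
    rw [← mul_assoc, hsq] at e4
    rw [← mul_assoc, hrr] at e5
    nlinarith
  · have e2 := r0 N hN
    have e3 := p0 N hN
    simp only [pair_add_left, pair_smul_left, pair_zero_left] at *
    have : ratio P Q / l * s = 1 := by rw [hs]; field_simp
    have : ratio P Q / l * (pair P N + s * pair Q N + r * pair R N) =
      ratio P Q / l * pair P N + pair Q N + ratio P Q / l * r * pair R N := by
      linear_combination pair Q N * this
    rw [this]
    have : 0 ≤ ratio P Q / l * pair P N := by positivity
    have : 0 ≤ ratio P Q / l * r * pair R N := by positivity
    linarith
  · have e1 := hQ.le_ratio P N hN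
    have e2 := hQ.le_ratio R N hN
    have e3 := q0 N hN
    simp only [pair_add_left, pair_smul_left, pair_zero_left] at *
    have e4 := mul_le_mul_of_nonneg_left e2 hr0.le
    have e5 := mul_le_mul_of_nonneg_right s1 e3
    have e6 := mul_le_mul_of_nonneg_right s2 e3
    linarith
  · have e2 := q0 N hN
    have e3 := p0 N hN
    simp only [pair_add_left, pair_smul_left, pair_zero_left] at *
    have : ratio P R / l * r = 1 := by rw [hr]; field_simp
    have : ratio P R / l * (pair P N + s * pair Q N + r * pair R N) =
      ratio P R / l * pair P N + pair R N + ratio P R / l * s * pair Q N := by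
      linear_combination pair R N * this
    rw [this]
    have : 0 ≤ ratio P R / l * pair P N := by positivity
    have : 0 ≤ ratio P R / l * s * pair Q N := by positivity
    linarith
  · have e1 := hR.le_ratio P N hN
    have e2 := hR.le_ratio Q N hN
    have e3 := r0 N hN
    simp only [pair_add_left, pair_smul_left, pair_zero_left] at *
    have e4 := mul_le_mul_of_nonneg_left e2 hs0.le
    have e5 := mul_le_mul_of_nonneg_right r1 e3
    have e6 := mul_le_mul_of_nonneg_right r2 e3
    linarith

end Herm3

namespace Herm3

variable {A : Type} [NormedAddCommGroup A] [InnerProductSpace ℝ A] [SymmetricComposition A]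
  [Nontrivial A] [FiniteDimensional ℝ A]

/-! ## Triangles that cannot be retracted further -/

/-- In the application `a` is the least and `c` the middle eigenvalue of `Q`. If `c` were large, `Q
≤ R` would push the small direction `N` of `R` towards the first coordinate. Then `R` would be at
most `O(τ / c)` times `Q`, against the near-optimality `h`. -/
theorem middle_eigenvalue_le {C τ a b c : ℝ} {R N : Herm3 A} (hC : 1 ≤ C) (ha : 1 ≤ a)
    (hc : 1 ≤ c) (hcb : c ≤ b) (hbτ : b ≤ τ) (hQR : Le (diag ![a, b, c]) R)
    (hRτ : Le R (τ • diag 1)) (hN : RankOne N) (hN1 : tr N = 1) (hRN : pair R N ≤ C)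
    (h : ∀ t, Le R (t • diag ![a, b, c]) → τ ≤ C * t) : c ≤ 16 * C ^ 2 := by
  by_cases hc2 : c ≤ 2 * C
  · nlinarith
  push Not at hc2
  have hc0 : 0 < c := by linarith
  have n0 := hN.nonneg 0
  have n1 := hN.nonneg 1
  have n2 := hN.nonneg 2
  have hQN := (hQR N hN).trans hRN
  rw [pair_diag_left] at hQN
  simp only [Matrix.cons_val_zero, Matrix.cons_val_one, Matrix.cons_val] at hQN
  rw [tr] at hN1
  have hsum : c * (N.1 1 + N.1 2) ≤ C := by nlinarith
  have hsum2 : N.1 1 + N.1 2 ≤ C / c := by rw [le_div_iff₀ hc0]; linarith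
  have hN0 : 1 / 2 ≤ N.1 0 := by
    have : C / c ≤ 1 / 2 := by rw [div_le_iff₀ hc0]; linarith
    linarith
  have h0R : Le 0 R := by
    refine Le.trans ?_ hQR
    rw [zero_le_diag_iff]
    intro i; fin_cases i <;> simp <;> linarith
  have hτc : 1 ≤ τ / c := by rw [le_div_iff₀ hc0]; linarith
  -- `corner_le` for `N`, paired with `R`: the corner of `N` is at least `1 / 2`, and its block has
  -- trace at most `C / c`.
  have hR0 : R.1 0 ≤ 8 * C * (τ / c) := by
    have e1 := (corner_le (zero_le_of_rankOne hN)).pair_le h0R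
    rw [pair_diag_left, pair_smul_left, pair_add_left, pair_comm N, pair_comm _ R] at e1
    have e2 := hRτ _ hN.block
    rw [pair_smul_left, pair_diag_one_left] at e2
    simp only [tr, block, Matrix.cons_val_zero, Matrix.cons_val_one, Matrix.cons_val] at e1 e2
    have hR0' := h0R.apply_le 0
    simp only [Prod.fst_zero, Pi.zero_apply] at hR0'
    have e3 : τ * (0 + N.1 1 + N.1 2) ≤ C * (τ / c) := by
      calc τ * (0 + N.1 1 + N.1 2) ≤ τ * (C / c) := by
            refine mul_le_mul_of_nonneg_left (by linarith) (by linarith)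
        _ = C * (τ / c) := by ring
    nlinarith
  -- Pinch `R` into its corner, just bounded, and its block, which is at most `τ`.
  have key : Le R ((16 * C * (τ / c)) • diag ![a, b, c]) := by
    intro M hM
    have e1 := le_pinch h0R M hM
    have e2 := hRτ.block M hM
    have e3 : block (τ • diag 1 : Herm3 A) = diag ![0, τ, τ] := by
      ext i <;> fin_cases i <;> simp [block]
    rw [e3] at e2
    rw [pair_smul_left, pair_add_left] at e1
    rw [pair_smul_left]
    rw [pair_diag_left] at *
    simp only [Matrix.cons_val_zero, Matrix.cons_val_one, Matrix.cons_val] at *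
    have m0 := hM.nonneg 0
    have m1 := hM.nonneg 1
    have m2 := hM.nonneg 2
    have f1 : 16 * C * (τ / c) * c = 16 * C * τ := by field_simp
    have hp : 0 ≤ 16 * C * (τ / c) := by positivity
    have f2 : 16 * C * (τ / c) * c ≤ 16 * C * (τ / c) * b := mul_le_mul_of_nonneg_left hcb hp
    have f3 : 16 * C * (τ / c) ≤ 16 * C * (τ / c) * a := le_mul_of_one_le_right hp ha
    have f4 : 2 * τ ≤ 16 * C * τ := by nlinarith
    have g0 : 2 * R.1 0 * M.1 0 ≤ 16 * C * (τ / c) * a * M.1 0 :=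
      mul_le_mul_of_nonneg_right (by linarith) m0
    have g1 : 2 * τ * M.1 1 ≤ 16 * C * (τ / c) * b * M.1 1 :=
      mul_le_mul_of_nonneg_right (by linarith) m1
    have g2 : 2 * τ * M.1 2 ≤ 16 * C * (τ / c) * c * M.1 2 :=
      mul_le_mul_of_nonneg_right (by linarith) m2
    linarith
  have := h _ key
  have hτ0 : 0 < τ := by linarith
  have e : C * (16 * C * (τ / c)) = 16 * C ^ 2 * τ / c := by ring
  rw [e, le_div_iff₀ hc0] at this
  nlinarith

/-- Since `R` is at least `τ / C` on the first coordinate, the small direction `N` has at least half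
its trace in the block, which bounds the smaller block entry. The larger one must be of order `τ`:
otherwise `R` would be at most a small multiple of `diag (τ, 1, 1)`, against `h2`. -/
theorem near_diag_of_offDiag_eq_zero {C τ : ℝ} {R N : Herm3 A} (hC : 1 < C)
    (hτ : 2 * C ^ 2 < τ) (hlow : Le (C⁻¹ • diag ![τ, 1, 1]) R) (h1R : Le (diag 1) R)
    (hRτ : Le R (τ • diag 1)) (hx : R.2 0 = 0) (hle : R.1 2 ≤ R.1 1) (hN : RankOne N)
    (hN1 : tr N = 1) (hRN : pair R N ≤ C)
    (h2 : ∀ t, 0 ≤ t → Le R (t • diag ![τ, 1, 1]) → τ ≤ C ^ 2 * t) :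
    Le ((16 * C ^ 3)⁻¹ • diag ![τ, τ, 1]) R ∧ Le R ((16 * C ^ 3) • diag ![τ, τ, 1]) := by
  have hC0 : 0 < C := by linarith
  have hC2 : 1 ≤ C ^ 2 := one_le_pow₀ hC.le
  have hC3 : C ^ 2 ≤ C ^ 3 := by nlinarith
  have hK : 0 < 16 * C ^ 3 := by positivity
  have hR0 : Le 0 R := by
    refine Le.trans ?_ h1R
    rw [zero_le_diag_iff]; intro i; simp
  have hblock : block R = diag ![0, R.1 1, R.1 2] := by
    ext i <;> fin_cases i <;> simp [block, hx]
  have r0 := hRτ.apply_le 0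
  have r1 := hRτ.apply_le 1
  have s0 := h1R.apply_le 0
  have s1 := h1R.apply_le 1
  have s2 := h1R.apply_le 2
  simp only [Prod.smul_fst, diag_fst, Pi.smul_apply, Pi.one_apply, smul_eq_mul, mul_one]
    at r0 r1 s0 s1 s2
  have n0 := hN.nonneg 0
  have n1 := hN.nonneg 1
  have n2 := hN.nonneg 2
  have hN0 : τ * N.1 0 ≤ C ^ 2 := by
    have := (hlow N hN).trans hRN
    rw [pair_smul_left, inv_mul_le_iff₀ hC0, pair_diag_left] at this
    simp only [Matrix.cons_val_zero, Matrix.cons_val_one, Matrix.cons_val] at this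
    nlinarith
  have hξ2 : R.1 2 ≤ 8 * C ^ 2 := by
    have e1 := (block_le (zero_le_of_rankOne hN)).pair_le hR0
    rw [pair_block, pair_comm, hblock, pair_diag_left, pair_smul_left, pair_add_left, pair_comm N,
      pair_diag_left] at e1
    simp only [Matrix.cons_val_zero, Matrix.cons_val_one, Matrix.cons_val] at e1
    rw [tr] at hN1
    have hN0' : N.1 0 ≤ 1 / 2 := by
      by_contra hlt
      push Not at hlt
      nlinarith
    have e2 : N.1 0 * R.1 0 ≤ C ^ 2 := by
      calc N.1 0 * R.1 0 ≤ N.1 0 * τ := mul_le_mul_of_nonneg_left r0 n0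
        _ = τ * N.1 0 := mul_comm _ _
        _ ≤ _ := hN0
    have e3 : R.1 2 * N.1 1 ≤ R.1 1 * N.1 1 := mul_le_mul_of_nonneg_right hle n1
    have e4 : R.1 2 * (N.1 1 + N.1 2) ≤ 2 * (C + C ^ 2) := by linarith
    have e5 : R.1 2 * (1 / 2) ≤ R.1 2 * (N.1 1 + N.1 2) :=
      mul_le_mul_of_nonneg_left (by linarith) (by linarith)
    have e6 : C ≤ C ^ 2 := by nlinarith
    linarith
  have hRup : Le R ((2 : ℝ) • diag ![τ, R.1 1, R.1 2]) := by
    refine (le_pinch hR0).trans ?_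
    rw [hblock, ← diag_add, ← diag_smul, ← diag_smul, le_diag_iff]
    intro i; fin_cases i <;> simp
    linarith
  have hξ1 : τ ≤ 2 * C ^ 2 * R.1 1 := by
    have := h2 (2 * R.1 1) (by linarith) (hRup.trans ?_)
    · linarith
    · rw [← diag_smul, ← diag_smul, le_diag_iff]
      intro i; fin_cases i <;> simp
      · nlinarith
      · linarith
  have hlow1 : Le (diag ![R.1 0 / C, 0, 0]) R := by
    refine Le.trans ?_ hlow
    rw [← diag_smul, le_diag_iff]
    intro i
    fin_cases i <;> simp
    · rw [div_eq_inv_mul]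
      exact mul_le_mul_of_nonneg_left r0 (by positivity)
    · positivity
    · positivity
  have hlow2 := inv_smul_block_le hC hlow1
  refine ⟨?_, ?_⟩
  · intro M hM
    have m0 := hM.nonneg 0
    have m1 := hM.nonneg 1
    have m2 := hM.nonneg 2
    have e1 := hlow2 M hM
    have e2 := hlow M hM
    have hp : 0 ≤ pair R M := by simpa [pair_zero_left] using hR0 M hM
    rw [hblock] at e1
    rw [pair_smul_left, inv_mul_le_iff₀ hC0, pair_diag_left] at e1 e2
    rw [pair_smul_left, inv_mul_le_iff₀ hK, pair_diag_left]
    simp only [Matrix.cons_val_zero, Matrix.cons_val_one, Matrix.cons_val] at e1 e2 ⊢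
    have e0 : 0 ≤ R.1 2 * M.1 2 := mul_nonneg (by linarith) m2
    have e3 : τ * M.1 1 ≤ 2 * C ^ 2 * (C * pair R M) := by
      calc τ * M.1 1 ≤ 2 * C ^ 2 * R.1 1 * M.1 1 := mul_le_mul_of_nonneg_right hξ1 m1
        _ = 2 * C ^ 2 * (R.1 1 * M.1 1) := by ring
        _ ≤ _ := mul_le_mul_of_nonneg_left (by linarith) (by positivity)
    have e4 : C * pair R M ≤ C ^ 3 * pair R M := mul_le_mul_of_nonneg_right (by nlinarith) hp
    have e5 : 2 * C ^ 2 * (C * pair R M) = 2 * (C ^ 3 * pair R M) := by ring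
    have e6 : 0 ≤ C ^ 3 * pair R M := by positivity
    linarith
  · refine hRup.trans ?_
    rw [← diag_smul, ← diag_smul, le_diag_iff]
    intro i; fin_cases i <;> simp
    · nlinarith
    · nlinarith
    · linarith

/-- By `h1` the largest eigenvalue of `Q` is at least `τ / C`; by `h3` the least one of `R` is at
most `C`. The common frame comes from diagonalising `Q` and then rotating the last two coordinates
to suit `R`, which is harmless because `Q` is bounded there. -/
theorem exists_near_equilateral {C τ : ℝ} {Q R : Herm3 A} (hC : 1 < C)
    (h1Q : Le (diag 1) Q) (hQR : Le Q R) (hRτ : Le R (τ • diag 1))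
    (h1 : ∀ t, Le Q (t • diag 1) → τ ≤ C * t) (h2 : ∀ t, Le R (t • Q) → τ ≤ C * t)
    (h3 : ∀ t, Le (diag 1) (t • R) → 1 ≤ C * t) :
    ∃ k ∈ rotGroup A,
      Le ((16 * C ^ 3)⁻¹ • diag ![τ, 1, 1]) (k Q) ∧
      Le (k Q) ((16 * C ^ 3) • diag ![τ, 1, 1]) ∧
      Le ((16 * C ^ 3)⁻¹ • diag ![τ, τ, 1]) (k R) ∧
      Le (k R) ((16 * C ^ 3) • diag ![τ, τ, 1]) := by
  have hτ1 : 1 ≤ τ := by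
    have := ((h1Q.trans hQR).trans hRτ).apply_le 0
    simpa using this
  have hC2 : 1 ≤ C ^ 2 := one_le_pow₀ hC.le
  have hC3 : C ^ 2 ≤ C ^ 3 := by nlinarith
  have hK : 0 < 16 * C ^ 3 := by positivity
  have ineq {a b : ℝ} (h : a ≤ 16 * C ^ 3 * b) : (16 * C ^ 3)⁻¹ * a ≤ b := by
    rwa [inv_mul_le_iff₀ hK]
  rcases le_or_gt τ (2 * C ^ 2) with hτ | hτ
  -- For bounded `τ` everything is comparable to `1`.
  · refine ⟨1, one_mem _, ?_, ?_, ?_, ?_⟩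
    · refine Le.trans ?_ h1Q
      rw [← diag_smul, le_diag_iff]
      intro i; fin_cases i <;> simp only [Pi.smul_apply, smul_eq_mul, Pi.one_apply] <;>
        apply ineq <;> simp <;> linarith
    · refine (hQR.trans hRτ).trans ?_
      rw [smul_diag_one, ← diag_smul, le_diag_iff]
      intro i; fin_cases i <;> simp <;> nlinarith
    · refine Le.trans ?_ (h1Q.trans hQR)
      rw [← diag_smul, le_diag_iff]
      intro i; fin_cases i <;> simp only [Pi.smul_apply, smul_eq_mul, Pi.one_apply] <;>
        apply ineq <;> simp <;> linarith
    · refine hRτ.trans ?_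
      rw [smul_diag_one, ← diag_smul, le_diag_iff]
      intro i; fin_cases i <;> simp <;> nlinarith
  obtain ⟨k₀, hk₀, q, hq1, hq2, hq⟩ := exists_map_eq_diag Q
  have hk₀u := rotGroup_le_unitGroup hk₀
  have hk₀o := unitGroup_le_orderGroup hk₀u
  obtain ⟨kR, hkR, r, hr1, hr2, hr⟩ := exists_map_eq_diag R
  have hkRu := rotGroup_le_unitGroup hkR
  have hkRo := unitGroup_le_orderGroup hkRu
  have hr0 : ∀ i, 1 ≤ r i := by
    have := (hkRo _ _).2 (h1Q.trans hQR)
    rw [hkRu.2, hr, le_diag_iff] at this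
    exact this
  have hrC : r 2 ≤ C := by
    have hrp : 0 < r 2 := by linarith [hr0 2]
    have := h3 (r 2)⁻¹ (by
      rw [← hkRo, hkRu.2, map_smul, hr, ← diag_smul, le_diag_iff]
      intro i
      simp only [Pi.one_apply, Pi.smul_apply, smul_eq_mul, inv_mul_eq_div]
      rw [le_div_iff₀ hrp]
      fin_cases i <;> simp <;> linarith)
    rwa [← div_eq_mul_inv, le_div_iff₀ hrp, one_mul] at this
  obtain ⟨N, hN, hN1, hRN⟩ : ∃ N : Herm3 A, RankOne N ∧ tr N = 1 ∧ pair R N ≤ C := by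
    refine ⟨kR⁻¹ (diag (Pi.single 2 1)), (rankOne_diag zero_le_one).map (inv_mem hkRu), ?_, ?_⟩
    · rw [tr_map (inv_mem hkRu)]; simp [tr]
    · rw [← pair_map_map hkRu, show kR (kR⁻¹ (diag (Pi.single 2 1))) = diag (Pi.single 2 1) from
        kR.apply_symm_apply _, hr, pair_diag_single]
      simpa using hrC
  -- the eigenvalues of `Q`
  have hqone : ∀ i, 1 ≤ q i := by
    have := (hk₀o _ _).2 h1Q
    rw [hk₀u.2, hq, le_diag_iff] at this
    exact this
  have hqτ : q 0 ≤ τ := by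
    have := ((hk₀o _ _).2 (hQR.trans hRτ)).apply_le 0
    rw [hq, map_smul, hk₀u.2] at this
    simpa using this
  have hq0 : τ ≤ C * q 0 := by
    refine h1 _ ?_
    rw [← hk₀o, map_smul, hk₀u.2, hq, smul_diag_one, le_diag_iff]
    intro i; fin_cases i <;> simp <;> linarith
  have hq16 : q 1 ≤ 16 * C ^ 2 := by
    have hcu := rotGroup_le_unitGroup (cyc_mem_rotGroup (A := A))
    have hk2u : cyc * cyc * k₀ ∈ unitGroup A := mul_mem (mul_mem hcu hcu) hk₀u
    have hk2o := unitGroup_le_orderGroup hk2u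
    have e : (cyc * cyc * k₀ : Herm3 A ≃ₗ[ℝ] Herm3 A) Q = diag ![q 2, q 0, q 1] := by
      change cyc (cyc (k₀ Q)) = _
      rw [hq, show q = ![q 0, q 1, q 2] by ext i; fin_cases i <;> rfl, cyc_diag, cyc_diag]
      rfl
    -- Two cyclic shifts put the least eigenvalue first.
    refine middle_eigenvalue_le (R := (cyc * cyc * k₀ : Herm3 A ≃ₗ[ℝ] Herm3 A) R)
      (N := (cyc * cyc * k₀ : Herm3 A ≃ₗ[ℝ] Herm3 A) N) (τ := τ)
      hC.le (hqone 2) (hqone 1) hq1 hqτ ?_ ?_ (hN.map hk2u) ?_ ?_ ?_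
    · rw [← e, hk2o]; exact hQR
    · rw [← hk2u.2, ← map_smul, hk2o]; exact hRτ
    · rw [tr_map hk2u, hN1]
    · rw [pair_map_map hk2u]; exact hRN
    · intro t ht
      rw [← e, ← map_smul, hk2o] at ht
      exact h2 t ht
  -- the eigenvalues of `R`
  obtain ⟨k₁, hk₁, hk₁0, hk₁d, -, hx, hle⟩ := exists_rotation_offDiag_eq_zero (k₀ R)
  have hku : k₁ * k₀ ∈ unitGroup A := rotGroup_le_unitGroup (mul_mem hk₁ hk₀)
  have hko := unitGroup_le_orderGroup hku
  have hk₁o := unitGroup_le_orderGroup (rotGroup_le_unitGroup hk₁)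
  set k := k₁ * k₀ with hk
  -- `k₁` fixes `diag (τ, 1, 1)`, so bounds on `k₀ Q` in terms of it survive the second rotation.
  have hQlow : Le (C⁻¹ • diag ![τ, 1, 1]) (k Q) := by
    rw [← hk₁d τ 1, ← map_smul]
    change Le _ (k₁ (k₀ Q))
    rw [hk₁o, hq, ← diag_smul, le_diag_iff]
    intro i
    simp only [Pi.smul_apply, smul_eq_mul]
    rw [inv_mul_le_iff₀ (by linarith)]
    fin_cases i <;> simp
    · linarith
    · nlinarith [hqone 1]
    · nlinarith [hqone 2]
  have hQup : Le (k Q) ((16 * C ^ 2) • diag ![τ, 1, 1]) := by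
    rw [← hk₁d τ 1, ← map_smul]
    change Le (k₁ (k₀ Q)) _
    rw [hk₁o, hq, ← diag_smul, le_diag_iff]
    intro i
    fin_cases i <;> simp <;> nlinarith
  have hQR' : Le (k Q) (k R) := (hko _ _).2 hQR
  have hRτ' : Le (k R) (τ • diag 1) := by
    have := (hko _ _).2 hRτ
    rwa [map_smul, hku.2] at this
  have hR1 : Le (diag 1) (k R) := by
    have := (hko _ _).2 (h1Q.trans hQR)
    rwa [hku.2] at this
  have hC0 : 0 < C := by linarith
  obtain ⟨hlow, hup⟩ := near_diag_of_offDiag_eq_zero hC hτ (hQlow.trans hQR') hR1 hRτ' hx hle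
    (hN.map hku) (by rw [tr_map hku, hN1]) (by rwa [pair_map_map hku]) (fun t ht h => by
      have h' := (hQlow.smul (c := C * t) (by positivity))
      rw [smul_smul, mul_right_comm, mul_inv_cancel₀ hC0.ne', one_mul] at h'
      have := h.trans h'
      rw [← map_smul, hko] at this
      have := h2 _ this
      linarith)
  refine ⟨k, by rw [hk]; exact mul_mem hk₁ hk₀, ?_, ?_, hlow, hup⟩
  · refine Le.trans ?_ hQlow
    rw [← diag_smul, ← diag_smul, le_diag_iff]
    have : (16 * C ^ 3)⁻¹ ≤ C⁻¹ := inv_anti₀ hC0 (by nlinarith)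
    intro i
    simp only [Pi.smul_apply, smul_eq_mul]
    refine mul_le_mul_of_nonneg_right this ?_
    fin_cases i <;> simp <;> linarith
  · refine hQup.trans ?_
    rw [← diag_smul, ← diag_smul, le_diag_iff]
    intro i
    simp only [Pi.smul_apply, smul_eq_mul]
    refine mul_le_mul_of_nonneg_right (by linarith) ?_
    fin_cases i <;> simp <;> linarith

/-! ## Pairs of singular directions -/

/-- A nonzero entry in the row of a vanishing diagonal entry would make `X` negative on a rank-one
element tilted against it. -/
theorem eq_zero_of_apply_eq_zero {X : Herm3 A} (h : Le 0 X) (h1 : X.1 1 = 0) (h2 : X.1 2 = 0) :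
    X = diag ![X.1 0, 0, 0] := by
  have small {a r : ℝ} (ha : 0 ≤ a) (h : ∀ ε > 0, 2 * ε * r ^ 2 ≤ ε ^ 2 * a) : r = 0 := by
    by_contra hr
    have hr2 : 0 < r ^ 2 := by positivity
    have := h (r ^ 2 / (a + 1)) (by positivity)
    rw [div_pow, mul_div_assoc', div_mul_eq_mul_div, div_mul_eq_mul_div,
      div_le_div_iff₀ (by positivity) (by positivity)] at this
    nlinarith [mul_pos (mul_pos hr2 hr2) (show 0 < a + 1 by linarith)]
  have h0 := h.apply_le 0
  simp only [Prod.fst_zero, Pi.zero_apply] at h0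
  have x2 : X.2 2 = 0 := by
    rw [← norm_eq_zero]
    refine small h0 fun ε hε => ?_
    have := h (![ε ^ 2, ‖X.2 2‖ ^ 2, 0], ![0, 0, (-ε) • X.2 2]) ⟨by
      ext i <;> fin_cases i <;> simp [sharp, norm_smul, mul_pow], by simp [tr]; positivity⟩
    simp [pair, real_inner_smul_right, h1] at this
    linarith
  have x1 : X.2 1 = 0 := by
    rw [← norm_eq_zero]
    refine small h0 fun ε hε => ?_
    have := h (![ε ^ 2, 0, ‖X.2 1‖ ^ 2], ![0, (-ε) • X.2 1, 0]) ⟨by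
      ext i <;> fin_cases i <;> simp [sharp, norm_smul, mul_pow, mul_comm], by simp [tr]; positivity⟩
    simp [pair, real_inner_smul_right, h2] at this
    linarith
  have x0 : X.2 0 = 0 := by
    rw [← norm_eq_zero]
    refine small (a := 0) le_rfl fun ε hε => ?_
    have := h (![0, ε ^ 2, ‖X.2 0‖ ^ 2], ![(-ε) • X.2 0, 0, 0]) ⟨by
      ext i <;> fin_cases i <;> simp [sharp, norm_smul, mul_pow], by simp [tr]; positivity⟩
    simp [pair, real_inner_smul_right, h1, h2] at this
    linarith
  ext i <;> fin_cases i <;> simp [*]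

/-- `L` need not preserve the determinant, so the rank of `L (diag φ)` is controlled through the
order alone. -/
theorem exists_map_le_projection {φ : Fin 3 → ℝ} (hφ : φ = ![1, 0, 0] ∨ φ = ![0, 1, 1])
    {L : Herm3 A ≃ₗ[ℝ] Herm3 A} (hL : L ∈ orderGroup A) (hW : Le (L (diag 1)) (diag 1)) :
    ∃ k ∈ rotGroup A, Le (k (L (diag φ))) (diag φ) := by
  have hG0 : Le 0 (L (diag φ)) := by
    rw [zero_le_map_iff hL, zero_le_diag_iff]
    rcases hφ with rfl | rfl <;> intro i <;> fin_cases i <;> simp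
  have hG1 : Le (L (diag φ)) (diag 1) := by
    refine Le.trans ?_ hW
    rw [hL, le_diag_iff]
    rcases hφ with rfl | rfl <;> intro i <;> fin_cases i <;> simp
  obtain ⟨k, hk, g, hg1, hg2, hg⟩ := exists_map_eq_diag (L (diag φ))
  have hku := rotGroup_le_unitGroup hk
  have hko := unitGroup_le_orderGroup hku
  rw [← zero_le_map_iff hko, hg, zero_le_diag_iff] at hG0
  rw [← hko, hku.2, hg, le_diag_iff] at hG1
  rcases hφ with rfl | rfl
  · refine ⟨k, hk, ?_⟩
    have hkL : k * L ∈ orderGroup A := mul_mem hko hL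
    -- Otherwise `g 1` times the second coordinate projection pulls back below a rank-one
    -- projection, hence to a multiple of it, although `diag g` has the further nonzero entry `g 0`.
    have hz : g 1 = 0 := by
      by_contra hne
      have hpos : 0 < g 1 := lt_of_le_of_ne (hG0 1) (Ne.symm hne)
      set E : Herm3 A := (k * L).symm (diag (Pi.single 1 (g 1))) with hE
      have hE' : (k * L) E = diag (Pi.single 1 (g 1)) := (k * L).apply_symm_apply _
      have hE0 : Le 0 E := by
        rw [← zero_le_map_iff hkL, hE', zero_le_diag_iff]
        intro i; fin_cases i <;> simp [hpos.le]
      have hE1 : Le E (diag ![1, 0, 0]) := by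
        rw [← hkL, hE', show (k * L) (diag ![1, 0, 0]) = diag g from hg, le_diag_iff]
        intro i; fin_cases i <;> simp [hG0 0, hG0 2]
      have a1 := hE0.apply_le 1
      have a2 := hE0.apply_le 2
      have b1 := hE1.apply_le 1
      have b2 := hE1.apply_le 2
      simp at a1 a2 b1 b2
      have e := eq_zero_of_apply_eq_zero hE0 (le_antisymm b1 a1) (le_antisymm b2 a2)
      rw [show (![E.1 0, 0, 0] : Fin 3 → ℝ) = E.1 0 • ![1, 0, 0] by
        ext i; fin_cases i <;> simp, diag_smul] at e
      rw [e, map_smul, show (k * L) (diag ![1, 0, 0]) = diag g from hg, ← diag_smul] at hE'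
      have c0 := congrFun (congrArg Prod.fst hE') 0
      have c1 := congrFun (congrArg Prod.fst hE') 1
      simp at c0 c1
      rcases c0 with c0 | c0
      · rw [c0] at c1; simp at c1; exact hne c1.symm
      · linarith
    rw [hg, le_diag_iff]
    have hz2 : g 2 = 0 := le_antisymm (hz ▸ hg2) (hG0 2)
    intro i; fin_cases i
    · simpa using hG1 0
    · simp [hz]
    · simp [hz2]
  -- `g 2 • L 1 ≤ g 2 • 1`, and the latter is at most `L (diag φ)` up to rotation; hence `g 2 • 1 ≤
  -- diag φ`, whose first entry is zero.
  · have hz : g 2 ≤ 0 := by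
      have : Le (g 2 • diag 1) (diag ![0, 1, 1] : Herm3 A) := by
        rw [← hL, map_smul]
        refine (hW.smul (hG0 2)).trans ?_
        rw [← hko, map_smul, hku.2, hg, smul_diag_one, le_diag_iff]
        intro i; fin_cases i <;> simp <;> linarith
      simpa using this.apply_le 0
    have hc := cyc_mem_rotGroup (A := A)
    refine ⟨cyc * cyc * k, mul_mem (mul_mem hc hc) hk, ?_⟩
    change Le (cyc (cyc (k _))) _
    rw [hg, show g = ![g 0, g 1, g 2] by ext i; fin_cases i <;> rfl, cyc_diag, cyc_diag,
      le_diag_iff]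
    have := hG1 0
    have := hG1 1
    intro i; fin_cases i <;> simp <;> assumption

/-- The arithmetic of `le_smul_of_le_smul` at one rank-one element: `w`, `g`, `I`, `F` are its
pairings with `L 1`, `L (diag φ)`, `1`, `diag φ`. -/
theorem le_of_angle_bound {σ τ n κ w g I F : ℝ} (hσ : 1 ≤ σ) (hτ : 1 ≤ τ) (hn : 1 ≤ n)
    (hκτ : τ * κ ≤ 4 * n) (hθ : τ ≤ σ * n) (hg : g ≤ 2 * (F + κ * I)) (hw : w ≤ I) (hF : 0 ≤ F)
    (hFI : F ≤ I) : w + (σ - 1) * g ≤ 18 * (σ * n / τ) * (I + (τ - 1) * F) := by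
  have hτ0 : 0 < τ := by linarith
  have hIF : 0 ≤ I := hF.trans hFI
  have c3 : 0 ≤ τ * F := by positivity
  rw [show 18 * (σ * n / τ) * (I + (τ - 1) * F) = 18 * (σ * n) * (I + (τ - 1) * F) / τ by ring,
    le_div_iff₀ hτ0]
  have b1 : w + (σ - 1) * g ≤ I + (σ - 1) * (2 * (F + κ * I)) :=
    add_le_add hw (mul_le_mul_of_nonneg_left hg (by linarith))
  have b2 : (I + (σ - 1) * (2 * (F + κ * I))) * τ ≤ τ * I + 2 * σ * τ * F + 8 * (σ * n) * I := by
    have c1 : (σ - 1) * (τ * κ) ≤ σ * (4 * n) := by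
      calc (σ - 1) * (τ * κ) ≤ (σ - 1) * (4 * n) :=
            mul_le_mul_of_nonneg_left hκτ (by linarith)
        _ ≤ σ * (4 * n) := by nlinarith
    have c2 := mul_le_mul_of_nonneg_right c1 hIF
    nlinarith
  have b3 : 2 * σ * τ * F ≤ 2 * (σ * n) * (τ * F) := by
    have : σ ≤ σ * n := by nlinarith
    have := mul_le_mul_of_nonneg_right this c3
    linarith
  have b4 : τ * I ≤ σ * n * I := mul_le_mul_of_nonneg_right hθ hIF
  have b5 : I + τ * F ≤ 2 * (I + (τ - 1) * F) := by nlinarith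
  have b6 : 9 * (σ * n) * (I + τ * F) ≤ 9 * (σ * n) * (2 * (I + (τ - 1) * F)) :=
    mul_le_mul_of_nonneg_left b5 (by positivity)
  have b7 := mul_le_mul_of_nonneg_right b1 hτ0.le
  have b8 : 0 ≤ σ * n * (τ * F) := by positivity
  linarith

/-- Let `e` be a projection above `L (diag φ)`, and `κ` the pairing of `diag φ` with `1 - e`, a
measure of the angle between the projections. Pairing `Z ≤ n Y` with `1 - e`, which annihilates `L
(diag φ)`, gives `κ ≤ 4 n / τ`. So `e` is at most `2 (diag φ + κ)`, which bounds `Y`. -/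
theorem le_smul_of_le_smul {φ : Fin 3 → ℝ} (hφ : φ = ![1, 0, 0] ∨ φ = ![0, 1, 1])
    {L : Herm3 A ≃ₗ[ℝ] Herm3 A} (hL : L ∈ orderGroup A) (hW : Le (L (diag 1)) (diag 1))
    {σ τ n : ℝ} (hσ : 1 ≤ σ) (hτ : 1 ≤ τ) {Y Z : Herm3 A}
    (hZ : Z = diag 1 + (τ - 1) • diag φ) (hY : Y = L (diag 1 + (σ - 1) • diag φ))
    (h : Le Z (n • Y)) : Le Y ((18 * (σ * n / τ)) • Z) := by
  obtain ⟨k, hk, hkG⟩ := exists_map_le_projection hφ hL hW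
  have hku := rotGroup_le_unitGroup hk
  have hko := unitGroup_le_orderGroup hku
  have hφ0 : ∀ i, 0 ≤ φ i := by
    rcases hφ with rfl | rfl <;> intro i <;> fin_cases i <;> simp
  have hφ1 : ∀ i, φ i ≤ 1 := by
    rcases hφ with rfl | rfl <;> intro i <;> fin_cases i <;> simp
  set G := L (diag φ) with hG
  set W := L (diag 1) with hWdef
  rw [map_add, map_smul] at hY
  have hG0 : Le 0 G := by rw [hG, zero_le_map_iff hL, zero_le_diag_iff]; exact hφ0
  have hGW : Le G W := by rw [hG, hL, le_diag_iff]; exact hφ1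
  set e : Herm3 A := k.symm (diag φ) with he
  have hke : k e = diag φ := k.apply_symm_apply _
  have hGe : Le G e := by rw [← hko, hke]; exact hkG
  have he0 : Le 0 e := by rw [← zero_le_map_iff hko, hke, zero_le_diag_iff]; exact hφ0
  have he1 : Le e (diag 1) := by rw [← hko, hke, hku.2, le_diag_iff]; exact hφ1
  have hψ0 : Le 0 (diag 1 - e) := le_iff_zero_le_sub.1 he1
  have hf0 : Le (0 : Herm3 A) (diag φ) := zero_le_diag_iff.2 hφ0
  have hf1 : Le (diag φ : Herm3 A) (diag 1) := le_diag_iff.2 hφ1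
  have htr : tr e = φ 0 + φ 1 + φ 2 := by rw [← tr_map hku, hke]; rfl
  have hfe : pair (diag φ) (diag 1 - e) = φ 0 + φ 1 + φ 2 - pair (diag φ) e := by
    rw [pair_comm, pair_sub_left, pair_diag_one_left, pair_comm e]; rfl
  set κ := φ 0 + φ 1 + φ 2 - pair (diag φ) e with hκ
  have hκ0 : 0 ≤ κ := by
    rw [← hfe]
    have := hf0.pair_le hψ0
    rwa [pair_zero_left] at this
  have hone : pair (diag 1) (diag 1 - e) = 3 - (φ 0 + φ 1 + φ 2) := by
    rw [pair_comm, pair_sub_left, pair_comm e, pair_diag_one_left, pair_diag_one_left, htr]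
    simp [tr]; norm_num
  have hsum : 1 ≤ φ 0 + φ 1 + φ 2 ∧ φ 0 + φ 1 + φ 2 ≤ 2 := by
    rcases hφ with rfl | rfl <;> simp <;> norm_num
  have hGψ : pair G (diag 1 - e) = 0 := by
    refine le_antisymm ?_ ?_
    · refine (hGe.pair_le hψ0).trans ?_
      rw [← pair_map_map hku, map_sub, hku.2, hke, pair_diag_left]
      rcases hφ with rfl | rfl <;> simp
    · have := hG0.pair_le hψ0
      rwa [pair_zero_left] at this
  have hWψ := hW.pair_le hψ0
  have hW0 : Le 0 W := hG0.trans hGW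
  have hWψ0 := hW0.pair_le hψ0
  rw [pair_zero_left] at hWψ0
  have hn1 : 3 - (φ 0 + φ 1 + φ 2) + (τ - 1) * κ ≤ n * pair W (diag 1 - e) := by
    have := h.pair_le hψ0
    rw [hZ, hY, pair_add_left, pair_smul_left, pair_smul_left, pair_add_left, pair_smul_left, hGψ,
      hone, hfe] at this
    linarith
  have hτκ : 0 ≤ (τ - 1) * κ := mul_nonneg (by linarith) hκ0
  have hn0 : 0 < n := by
    by_contra hneg
    push Not at hneg
    nlinarith
  have hn2 : 3 - (φ 0 + φ 1 + φ 2) + (τ - 1) * κ ≤ n * (3 - (φ 0 + φ 1 + φ 2)) := by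
    refine hn1.trans (mul_le_mul_of_nonneg_left ?_ hn0.le)
    rw [← hone]; exact hWψ
  have hn : 1 ≤ n := by
    by_contra hneg
    push Not at hneg
    nlinarith
  have hκ2 : κ ≤ 2 := by
    have := hf0.pair_le he0
    rw [pair_zero_left] at this
    linarith
  have hκτ : τ * κ ≤ 4 * n := by nlinarith
  -- Of the two pinched pieces of `e`, one lies below `diag φ` and the other is at most `κ`.
  have hp : Le e ((2 : ℝ) • (diag φ + κ • diag 1)) := by
    refine (le_pinch he0).trans (Le.smul ?_ zero_le_two)
    have e0 := he1.apply_le 0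
    have e0' := he0.apply_le 0
    simp at e0 e0'
    rcases hφ with rfl | rfl
    · refine Le.add (le_diag_iff.2 ?_) ?_
      · intro i; fin_cases i <;> simp [e0]
      · have b0 : Le 0 (block e) := by
          have := he0.block
          rwa [show block (0 : Herm3 A) = 0 by ext i <;> fin_cases i <;> simp [block]] at this
        have := le_tr_smul_one b0
        rwa [show tr (block e) = κ by
          rw [hκ, pair_diag_left]
          simp [tr] at htr
          simp [tr, block]; linarith] at this
    · rw [add_comm]
      have b1 := he1.block
      rw [show block (diag 1 : Herm3 A) = diag ![0, 1, 1] by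
        ext i <;> fin_cases i <;> simp [block]] at b1
      refine Le.add b1 ?_
      rw [smul_diag_one, le_diag_iff]
      have : κ = e.1 0 := by
        rw [hκ, pair_diag_left]
        simp [tr] at htr
        simp; linarith
      intro i; fin_cases i <;> simp [this, e0']
  -- `Y ≤ σ • 1`, so `Z ≤ n σ • 1`; compare an entry where `φ` is one.
  have hθ : τ ≤ σ * n := by
    have h1 : Le Z ((n * σ) • diag 1) := by
      refine h.trans ?_
      intro M hM
      have a1 := hGW M hM
      have a2 := hW M hM
      simp only [hY, pair_smul_left, pair_add_left] at *
      have : pair W M + (σ - 1) * pair G M ≤ σ * pair (diag 1) M := by nlinarith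
      calc n * (pair W M + (σ - 1) * pair G M) ≤ n * (σ * pair (diag 1) M) :=
            mul_le_mul_of_nonneg_left this hn0.le
        _ = _ := by ring
    rcases hφ with rfl | rfl
    · have := h1.apply_le 0
      simp [hZ] at this
      linarith
    · have := h1.apply_le 1
      simp [hZ] at this
      linarith
  intro M hM
  have a1 := (hGe.trans hp) M hM
  have a2 := hW M hM
  have a4 := hf0 M hM
  have a5 := hf1 M hM
  rw [hY, hZ]
  simp only [pair_smul_left, pair_add_left, pair_zero_left] at a1 a2 a4 a5 ⊢
  exact le_of_angle_bound hσ hτ hn hκτ hθ a1 a2 a4 a5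

end Herm3

/-! ### Cyclic products of ratios, and normalisation of triangles -/

namespace Herm3

variable {A : Type} [NormedAddCommGroup A] [InnerProductSpace ℝ A] [SymmetricComposition A]
  [Nontrivial A] [FiniteDimensional ℝ A]

theorem exists_smul_mem_orderGroup {c : ℝ} (hc : 0 < c) :
    ∃ S ∈ orderGroup A, ∀ X, S X = c • X := by
  have hs : √c * √c = c := Real.mul_self_sqrt hc.le
  refine ⟨dil (fun _ => √c) (fun _ => Real.sqrt_pos.2 hc), dil_mem_orderGroup _ _, fun X => ?_⟩
  ext i <;> fin_cases i <;> simp [dil_apply, hs, Real.sq_sqrt hc.le]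

theorem posDef_of_det_ne_zero {X : Herm3 A} (h : Le 0 X) (hd : det X ≠ 0) : PosDef X := by
  obtain ⟨k, hk, b, -, -, hb⟩ := exists_map_eq_diag X
  have hku := rotGroup_le_unitGroup hk
  rw [← zero_le_map_iff (unitGroup_le_orderGroup hku), hb, zero_le_diag_iff] at h
  rw [← hku.1, hb, det_diag] at hd
  have hpos : ∀ i, 0 < b i := by
    intro i
    refine lt_of_le_of_ne (h i) fun h0 => hd ?_
    fin_cases i <;> simp at h0 <;> simp [← h0]
  have := (posDef_diag (A := A) hpos).map_unit (inv_mem hku)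
  rwa [← hb, show k⁻¹ (k X) = X from k.symm_apply_apply X] at this

/-- Compares the two orientations of the triangle `Z, Y, V`. With `V = 1`, the ratios involving `V`
are bounded explicitly in terms of the scalars and `m`, `m'`; the two between `Z` and `Y` are tied
by `le_smul_of_le_smul`. -/
theorem ratio_cycle_le {φ : Fin 3 → ℝ} (hφ : φ = ![1, 0, 0] ∨ φ = ![0, 1, 1])
    {L₁ L₂ : Herm3 A ≃ₗ[ℝ] Herm3 A} (hL₁ : L₁ ∈ orderGroup A) (hL₂ : L₂ ∈ orderGroup A)
    {V Z W Y : Herm3 A} (pV : PosDef V) (pZ : PosDef Z) (pW : PosDef W) (pY : PosDef Y)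
    {c c' σ τ : ℝ} (hc : 0 < c) (hc' : 0 < c') (hσ : 1 ≤ σ) (hτ : 1 ≤ τ)
    (hV : L₁ V = diag 1) (hZ : L₁ Z = c • (diag 1 + (τ - 1) • diag φ))
    (hW : L₂ W = diag 1) (hY : L₂ Y = c' • (diag 1 + (σ - 1) • diag φ)) :
    ratio Z Y * ratio Y V * ratio V Z ≤
      18 * (ratio V W * ratio W V) ^ 2 * (ratio Z V * ratio V Y * ratio Y Z) := by
  have hm := ratio_pos pV pW
  have hm' := ratio_pos pW pV
  have hn := ratio_pos pY pZ
  set m := ratio V W with hmdef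
  set m' := ratio W V with hm'def
  set n := ratio Y Z with hndef
  obtain ⟨S, hS, hSX⟩ := exists_smul_mem_orderGroup (A := A) (inv_pos.2 hm)
  -- `W ≤ m V`, so the scaling `S` by `m⁻¹` makes `L 1 ≤ 1`.
  set L := S * L₁ * L₂⁻¹ with hLdef
  have hL : L ∈ orderGroup A := mul_mem (mul_mem hS hL₁) (inv_mem hL₂)
  have hL1 : L (diag 1) = m⁻¹ • L₁ W := by
    change S (L₁ (L₂.symm (diag 1))) = _
    rw [hSX, ← hW, L₂.symm_apply_apply]
  have hLY : L₁ Y = (c' * m) • L (diag 1 + (σ - 1) • diag φ) := by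
    have : L₂.symm (L₂ Y) = L₂.symm (c' • (diag 1 + (σ - 1) • diag φ)) := by rw [hY]
    rw [L₂.symm_apply_apply, map_smul] at this
    change _ = (c' * m) • S (L₁ (L₂.symm _))
    rw [hSX, this, map_smul, smul_smul, mul_assoc, mul_inv_cancel₀ hm.ne', mul_one]
  have hWle : Le (L (diag 1)) (diag 1) := by
    have := ((hL₁ _ _).2 (pV.le_ratio W)).smul (inv_pos.2 hm).le
    rwa [map_smul, hV, smul_smul, inv_mul_cancel₀ hm.ne', one_smul, ← hL1] at this
  have hleW : Le (diag 1) ((m * m') • L (diag 1)) := by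
    have := (hL₁ _ _).2 (pW.le_ratio V)
    rwa [map_smul, hV, show L₁ W = m • L (diag 1) by
      rw [hL1, smul_smul, mul_inv_cancel₀ hm.ne', one_smul], smul_smul, mul_comm] at this
  set Z₀ : Herm3 A := diag 1 + (τ - 1) • diag φ with hZ₀
  set Y₀ := L (diag 1 + (σ - 1) • diag φ) with hY₀
  have hφ0 : ∀ i, 0 ≤ φ i := by
    rcases hφ with rfl | rfl <;> intro i <;> fin_cases i <;> simp
  have hφ1 : ∀ i, φ i ≤ 1 := by
    rcases hφ with rfl | rfl <;> intro i <;> fin_cases i <;> simp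
  have dd (r : ℝ) : (diag 1 + (r - 1) • diag φ : Herm3 A) = diag (1 + (r - 1) • φ) := by
    rw [diag_add, diag_smul]
  have hp : 0 < c' * m := by positivity
  have i1 : Le Z₀ ((n * (c' * m) / c) • Y₀) := by
    have := ((hL₁ _ _).2 (pY.le_ratio Z)).smul (inv_pos.2 hc).le
    rw [hZ, smul_smul, inv_mul_cancel₀ hc.ne', one_smul, map_smul, hLY, smul_smul, smul_smul]
      at this
    convert this using 2
    rw [← hndef]; ring
  have i2 := le_smul_of_le_smul hφ hL hWle hσ hτ hZ₀ hY₀ i1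
  have hZY : ratio Z Y ≤ 18 * σ * n * (c' * m / c) ^ 2 / τ := by
    refine pZ.ratio_le ?_
    rw [← hL₁, map_smul, hZ, hLY]
    have := i2.smul hp.le
    rw [smul_smul] at this
    rw [smul_smul]
    convert this using 2
    field_simp
  have hYV : ratio Y V ≤ m * m' / (c' * m) := by
    refine pY.ratio_le ?_
    rw [← hL₁, map_smul, hV, hLY, smul_smul, div_mul_cancel₀ _ hp.ne']
    refine hleW.trans (Le.smul ?_ (by positivity))
    rw [hY₀, hL, dd, le_diag_iff]
    intro i
    have := mul_nonneg (show 0 ≤ σ - 1 by linarith) (hφ0 i)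
    simp; linarith
  have hVZ : ratio V Z ≤ c * τ := by
    refine pV.ratio_le ?_
    rw [← hL₁, map_smul, hV, hZ, mul_smul]
    refine Le.smul ?_ hc.le
    rw [hZ₀, dd, smul_diag_one, le_diag_iff]
    intro i
    have := mul_le_mul_of_nonneg_left (hφ1 i) (show 0 ≤ τ - 1 by linarith)
    simp; linarith
  have hZV : 1 / c ≤ ratio Z V := by
    have := (hL₁ _ _).2 (pZ.le_ratio V)
    rw [map_smul, hV, hZ, smul_smul, hZ₀, dd, ← diag_smul, le_diag_iff] at this
    rw [div_le_iff₀ hc]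
    rcases hφ with rfl | rfl
    · simpa [Matrix.vecHead, Matrix.vecTail] using this 1
    · simpa [Matrix.vecHead] using this 0
  have hVY : c' * m * σ / (m * m') ≤ ratio V Y := by
    have h1 := (hL₁ _ _).2 (pV.le_ratio Y)
    rw [map_smul, hV, hLY] at h1
    have h2 := h1.trans (hleW.smul (ratio_pos pV pY).le)
    rw [hY₀, ← map_smul, ← map_smul, ← map_smul, hL, dd, smul_smul, smul_diag_one, ← diag_smul,
      le_diag_iff] at h2
    rw [div_le_iff₀ (by positivity)]
    rcases hφ with rfl | rfl
    · simpa [Matrix.vecHead] using h2 0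
    · simpa [Matrix.vecHead, Matrix.vecTail] using h2 1
  have hZYp := ratio_pos pZ pY
  have hZVp := ratio_pos pZ pV
  have hYVp := ratio_pos pY pV
  have hVZp := ratio_pos pV pZ
  calc ratio Z Y * ratio Y V * ratio V Z
      ≤ (18 * σ * n * (c' * m / c) ^ 2 / τ) * (m * m' / (c' * m)) * (c * τ) := by gcongr
    _ = 18 * (m * m') ^ 2 * ((1 / c) * (c' * m * σ / (m * m')) * n) := by
      have : 0 < τ := by linarith
      field_simp
    _ ≤ _ := by gcongr

theorem exists_near_equilateral_of_ratio_le {P Q R : Herm3 A} (hP : PosDef P) (hQ : PosDef Q)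
    (hR : PosDef R) (h1 : det P = 1) {C : ℝ} (hC : 1 < C)
    (ax : ratio Q P * ratio P R ≤ C * ratio Q R) (ay : ratio R Q * ratio Q P ≤ C * ratio R P)
    (az : ratio P R * ratio R Q ≤ C * ratio P Q) :
    ∃ g ∈ genGroup A, ∃ τ q r : ℝ, 1 ≤ τ ∧ 0 < q ∧ 0 < r ∧ g P = diag 1 ∧
      Le ((16 * C ^ 3)⁻¹ • diag ![τ, 1, 1]) (q • g Q) ∧
      Le (q • g Q) ((16 * C ^ 3) • diag ![τ, 1, 1]) ∧
      Le ((16 * C ^ 3)⁻¹ • diag ![τ, τ, 1]) (r • g R) ∧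
      Le (r • g R) ((16 * C ^ 3) • diag ![τ, τ, 1]) := by
  obtain ⟨g, hg, hgP⟩ := exists_map_eq_one hP h1
  have hgo := genGroup_le_orderGroup hg
  have pq := ratio_pos hP hQ
  have pr := ratio_pos hP hR
  have qp := ratio_pos hQ hP
  have rp := ratio_pos hR hP
  have qr := ratio_pos hQ hR
  have rq := ratio_pos hR hQ
  -- `q`, `r`, `τ` go once around the triangle with optimal constants: `1 ≤ q Q ≤ r R ≤ τ`. The
  -- three hypotheses become the near-optimality conditions `h1`, `h2`, `h3` of
  -- `exists_near_equilateral`.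
  set q := ratio Q P with hq
  set r := q * ratio R Q with hr
  have hr0 : 0 < r := by positivity
  set τ := r * ratio P R with hτ
  have l1 : Le (diag 1) (q • g Q) := by
    rw [← hgP, ← map_smul, hgo]; exact hQ.le_ratio P
  have l2 : Le (q • g Q) (r • g R) := by
    rw [← map_smul, ← map_smul, hgo, hr, mul_smul]; exact (hR.le_ratio Q).smul qp.le
  have l3 : Le (r • g R) (τ • diag 1) := by
    rw [← hgP, ← map_smul, ← map_smul, hgo, hτ, mul_smul r]
    exact (hP.le_ratio R).smul hr0.le
  have hτ1 : 1 ≤ τ := by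
    have := ((l1.trans l2).trans l3).apply_le 0
    simpa using this
  obtain ⟨k, hk, a1, a2, a3, a4⟩ := exists_near_equilateral hC l1 l2 l3
    (fun t ht => by
      rw [← hgP, ← map_smul, ← map_smul, hgo] at ht
      have := hP.ratio_le ht
      rw [ratio_smul_right hP _ qp] at this
      calc τ = q * (ratio P R * ratio R Q) := by rw [hτ, hr]; ring
        _ ≤ q * (C * ratio P Q) := by gcongr
        _ = C * (q * ratio P Q) := by ring
        _ ≤ C * t := by gcongr)
    (fun t ht => by
      rw [← map_smul, ← map_smul, ← map_smul, hgo] at ht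
      have := (hQ.smul qp).ratio_le ht
      rw [ratio_smul_right (hQ.smul qp) _ hr0, ratio_smul_left hQ _ qp] at this
      calc τ = ratio R Q * (q * ratio P R) := by rw [hτ, hr]; ring
        _ ≤ ratio R Q * (C * ratio Q R) := by gcongr
        _ = C * (r * (q⁻¹ * ratio Q R)) := by rw [hr]; field_simp
        _ ≤ C * t := by gcongr)
    (fun t ht => by
      rw [← hgP, ← map_smul, ← map_smul, hgo] at ht
      have := (hR.smul hr0).ratio_le ht
      rw [ratio_smul_left hR _ hr0] at this
      calc 1 = r⁻¹ * (ratio R Q * q) := by rw [hr]; field_simp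
        _ ≤ r⁻¹ * (C * ratio R P) := by gcongr
        _ = C * (r⁻¹ * ratio R P) := by ring
        _ ≤ C * t := by gcongr)
  refine ⟨k * g, mul_mem (rotGroup_le_genGroup hk) hg, τ, q, r, hτ1, qp, hr0, ?_, ?_, ?_, ?_, ?_⟩
  · change k (g P) = _
    rw [hgP, (rotGroup_le_unitGroup hk).2]
  · rw [map_smul] at a1; exact a1
  · rw [map_smul] at a2; exact a2
  · rw [map_smul] at a3; exact a3
  · rw [map_smul] at a4; exact a4

/-- Reversing the coordinates turns an equilateral triangle of size `t` into one of size `-t` with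
its last two vertices exchanged. -/
theorem exists_swap : ∃ k ∈ rotGroup A, ∀ a b c : ℝ, k (diag ![a, b, c]) = diag ![c, b, a] := by
  obtain ⟨u, hu, -⟩ := exists_unit (0 : A)
  refine ⟨cyc * rot u 0 1 hu (by norm_num),
    mul_mem cyc_mem_rotGroup (rot_mem_rotGroup u 0 1 hu _), fun a b c => ?_⟩
  change cyc (rot u 0 1 _ _ _) = _
  ext i <;> fin_cases i <;> simp [cyc_apply, rot_apply, rotFun]

end Herm3

/-! ## Symmetric spaces modelled on the cone -/

open Herm3

/-- A metric space of points `x` represented by the positive definite matrices `sq x` of determinant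
one, with the distance and the shapes of the symmetric space. -/
structure ConeModel (A : Type) [NormedAddCommGroup A] [InnerProductSpace ℝ A]
    [SymmetricComposition A] (X : Type) where
  sq : X → Herm3 A
  dist : X → X → ℝ
  Shape : ℝ → X → X → Prop
  Equilateral : ℝ → X → X → X → Prop
  posDef_sq : ∀ x, (sq x).PosDef
  det_sq : ∀ x, (sq x).det = 1
  exists_sq : ∀ P : Herm3 A, P.PosDef → P.det = 1 → ∃ x, sq x = P
  -- Only `genGroup` is used here and for equilateral triangles, since its generators match explicit
  -- group elements; for a shape an order automorphism is enough.
  dist_eq : ∀ x y, ∀ g ∈ genGroup A, ∀ b : Fin 3 → ℝ, (∀ i, 0 < b i) → b 1 ≤ b 0 → b 2 ≤ b 1 →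
    g (sq x) = diag 1 → g (sq y) = diag b → dist x y = (Real.log (b 0) - Real.log (b 2)) / 2
  shape_spec : ∀ t x y, Shape t x y → ∃ L ∈ orderGroup A, L (sq x) = diag 1 ∧
    L (sq y) = diag ((Real.exp (-t / 3) • ![Real.exp t, 1, 1]) ^ 2)
  equilateral_spec : ∀ t x y z, ∀ g ∈ genGroup A, g (sq x) = diag 1 →
    g (sq y) = diag ((Real.exp (-t / 3) • ![Real.exp t, 1, 1]) ^ 2) →
    g (sq z) = diag ((Real.exp (-2 * t / 3) • ![Real.exp t, Real.exp t, 1]) ^ 2) →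
    Equilateral t x y z

namespace ConeModel

variable {A : Type} [NormedAddCommGroup A] [InnerProductSpace ℝ A] [SymmetricComposition A]
  [Nontrivial A] [FiniteDimensional ℝ A] {X : Type} (M : ConeModel A X)

theorem exp_sq (s : ℝ) : Real.exp s ^ 2 = Real.exp (2 * s) := by
  rw [pow_two, ← Real.exp_add, two_mul]

/-- The logarithm of the least `c` with `sq y ≤ c • sq x`. -/
def mu (x y : X) : ℝ := Real.log (ratio (M.sq x) (M.sq y))

theorem exp_mu (x y : X) : Real.exp (M.mu x y) = ratio (M.sq x) (M.sq y) :=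
  Real.exp_log (ratio_pos (M.posDef_sq x) (M.posDef_sq y))

theorem mu_le_iff {x y : X} {r : ℝ} : M.mu x y ≤ r ↔ ratio (M.sq x) (M.sq y) ≤ Real.exp r :=
  Real.log_le_iff_le_exp (ratio_pos (M.posDef_sq x) (M.posDef_sq y))

theorem mu_triangle (x y z : X) : M.mu x z ≤ M.mu x y + M.mu y z := by
  rw [mu_le_iff, Real.exp_add, exp_mu, exp_mu]
  exact ratio_triangle (M.posDef_sq x) (M.posDef_sq y) (M.posDef_sq z)

theorem mu_self (x : X) : M.mu x x = 0 := by
  rw [mu, ratio_self (M.posDef_sq x), Real.log_one]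

/-- In a frame where `sq x` is `1` and `sq y` is diagonal, the two ratios are the largest entry and
the inverse of the least. -/
theorem dist_eq_mu (x y : X) : M.dist x y = (M.mu x y + M.mu y x) / 2 := by
  obtain ⟨g, hg, b, hb1, hb2, hx, hy⟩ :=
    exists_map_eq_one_diag (M.posDef_sq x) (M.det_sq x) (M.sq y)
  have hgo := genGroup_le_orderGroup hg
  have hd1 : PosDef (diag 1 : Herm3 A) := posDef_diag fun _ => one_pos
  have hb0 : PosDef (diag b : Herm3 A) := by
    refine posDef_of_det_ne_zero ?_ ?_
    · rw [← hy, zero_le_map_iff hgo]; exact (M.posDef_sq y).zero_le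
    · rw [← hy, genGroup_le_detGroup hg, M.det_sq]; exact one_ne_zero
  have p2 := hb0.pos 2
  rw [M.dist_eq x y g hg b hb0.pos hb1 hb2 hx hy, mu, mu, ← ratio_map hgo,
    ← ratio_map hgo (M.sq y), hx, hy]
  have e1 : ratio (diag 1 : Herm3 A) (diag b) = b 0 := by
    refine le_antisymm (hd1.ratio_le ?_) ?_
    · rw [smul_diag_one, le_diag_iff]
      intro i; fin_cases i <;> simp <;> linarith
    · have := hd1.le_ratio (diag b : Herm3 A)
      rw [smul_diag_one, le_diag_iff] at this
      exact this 0
  have e2 : ratio (diag b : Herm3 A) (diag 1) = (b 2)⁻¹ := by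
    refine le_antisymm (hb0.ratio_le ?_) ?_
    · rw [← diag_smul, le_diag_iff]
      intro i
      simp only [Pi.one_apply, Pi.smul_apply, smul_eq_mul, inv_mul_eq_div]
      rw [le_div_iff₀ p2]
      fin_cases i <;> simp <;> linarith
    · have := hb0.le_ratio (diag 1 : Herm3 A)
      rw [← diag_smul, le_diag_iff] at this
      have := this 2
      rw [inv_le_iff_one_le_mul₀ p2]
      simpa using this
  rw [e1, e2, Real.log_inv]
  ring

theorem dist_comm (x y : X) : M.dist x y = M.dist y x := by
  rw [dist_eq_mu, dist_eq_mu, add_comm]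

theorem dist_self (x : X) : M.dist x x = 0 := by rw [dist_eq_mu, mu_self]; simp

theorem dist_triangle (x y z : X) : M.dist x z ≤ M.dist x y + M.dist y z := by
  simp only [dist_eq_mu]
  linarith [M.mu_triangle x y z, M.mu_triangle z y x]

/-- `s` is the logarithm of the factor that normalises the determinant of the retracted element; it
cancels in distances and excesses. -/
theorem exists_retraction (x y z : X) {l : ℝ} (hl : 0 ≤ l)
    (h1 : l ≤ M.mu y x + M.mu x z - M.mu y z) (h2 : l ≤ M.mu z x + M.mu x y - M.mu z y) :
    ∃ x₁ s, M.mu x₁ x ≤ -s ∧ M.mu x x₁ ≤ l + Real.log 3 + s ∧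
      M.mu x₁ y ≤ M.mu x y - l - s ∧ M.mu y x₁ ≤ M.mu y x + Real.log 3 + s ∧
      M.mu x₁ z ≤ M.mu x z - l - s ∧ M.mu z x₁ ≤ M.mu z x + Real.log 3 + s := by
  have h1' : Real.exp l * ratio (M.sq y) (M.sq z) ≤
      ratio (M.sq y) (M.sq x) * ratio (M.sq x) (M.sq z) := by
    simp only [← exp_mu, ← Real.exp_add, Real.exp_le_exp]; linarith
  have h2' : Real.exp l * ratio (M.sq z) (M.sq y) ≤
      ratio (M.sq z) (M.sq x) * ratio (M.sq x) (M.sq y) := by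
    simp only [← exp_mu, ← Real.exp_add, Real.exp_le_exp]; linarith
  obtain ⟨P, hP, a1, a2, a3, a4, a5, a6⟩ := Herm3.exists_retraction (M.posDef_sq x) (M.posDef_sq y)
    (M.posDef_sq z) (Real.one_le_exp hl) h1' h2'
  obtain ⟨c, hc, hcd⟩ := hP.exists_smul_det
  obtain ⟨x₁, hx₁⟩ := M.exists_sq _ (hP.smul hc) hcd
  have left (w : X) (r : ℝ) (h : ratio P (M.sq w) ≤ Real.exp r) : M.mu x₁ w ≤ r - Real.log c := by
    rw [mu_le_iff, hx₁, ratio_smul_left hP _ hc, Real.exp_sub, Real.exp_log hc, div_eq_inv_mul]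
    gcongr
  have right (w : X) (r : ℝ) (h : ratio (M.sq w) P ≤ Real.exp r) : M.mu w x₁ ≤ r + Real.log c := by
    rw [mu_le_iff, hx₁, ratio_smul_right (M.posDef_sq w) _ hc, Real.exp_add, Real.exp_log hc,
      mul_comm]
    gcongr
  have h3 : Real.exp (Real.log 3) = 3 := Real.exp_log (by norm_num)
  refine ⟨x₁, Real.log c, ?_, right x _ ?_, left y _ ?_, right y _ ?_, left z _ ?_, right z _ ?_⟩
  · have := left x 0 (by rwa [Real.exp_zero])
    linarith
  · rw [Real.exp_add, h3]; linarith
  · rwa [Real.exp_sub, exp_mu]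
  · rw [Real.exp_add, h3, exp_mu]; linarith
  · rwa [Real.exp_sub, exp_mu]
  · rw [Real.exp_add, h3, exp_mu]; linarith

/-! ### Excesses and the retraction of triangles to equilateral ones -/

/-- The excess of the path from `y` to `z` through `x`. -/
def exc (x y z : X) : ℝ := M.mu y x + M.mu x z - M.mu y z

theorem exc_nonneg (x y z : X) : 0 ≤ M.exc x y z := by
  unfold exc; linarith [M.mu_triangle y x z]

/-- Both excesses at `x` drop by their minimum, up to `log 3`, so one of them ends at most `log 3`.
The excesses at the other vertices grow by at most `log 3`, so the step can be repeated there. -/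
theorem exists_vertex_retraction (x y z : X) :
    ∃ x₁, M.dist x x₁ + M.dist x₁ y ≤ M.dist x y + Real.log 3 ∧
      M.dist x x₁ + M.dist x₁ z ≤ M.dist x z + Real.log 3 ∧
      M.exc x₁ y z ≤ M.exc x y z - min (M.exc x y z) (M.exc x z y) + Real.log 3 ∧
      M.exc x₁ z y ≤ M.exc x z y - min (M.exc x y z) (M.exc x z y) + Real.log 3 ∧
      M.exc y z x₁ ≤ M.exc y z x + Real.log 3 ∧ M.exc y x₁ z ≤ M.exc y x z + Real.log 3 ∧
      M.exc z x₁ y ≤ M.exc z x y + Real.log 3 ∧ M.exc z y x₁ ≤ M.exc z y x + Real.log 3 := by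
  set l := min (M.exc x y z) (M.exc x z y) with hl
  have hl0 : 0 ≤ l := le_min (M.exc_nonneg _ _ _) (M.exc_nonneg _ _ _)
  obtain ⟨x₁, s, a1, a2, a3, a4, a5, a6⟩ := M.exists_retraction x y z hl0 (min_le_left _ _)
    (min_le_right _ _)
  have t1 := M.mu_triangle y x₁ x
  have t2 := M.mu_triangle z x₁ x
  have t3 := M.mu_triangle x x₁ y
  have t4 := M.mu_triangle x x₁ z
  clear_value l
  refine ⟨x₁, ?_, ?_, ?_, ?_, ?_, ?_, ?_, ?_⟩ <;> simp only [dist_eq_mu, exc] <;> linarith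

/-- One retraction at each vertex. The first vertex suffers two later ones, hence `3 log 3`; each
side is affected at both ends, hence `2 log 3`. -/
theorem exists_reduced_triangle (x y z : X) :
    ∃ x' y' z', M.dist x x' + M.dist x' y' + M.dist y' y ≤ M.dist x y + 2 * Real.log 3 ∧
      M.dist y y' + M.dist y' z' + M.dist z' z ≤ M.dist y z + 2 * Real.log 3 ∧
      M.dist z z' + M.dist z' x' + M.dist x' x ≤ M.dist z x + 2 * Real.log 3 ∧
      (M.exc x' y' z' ≤ 3 * Real.log 3 ∨ M.exc x' z' y' ≤ 3 * Real.log 3) ∧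
      (M.exc y' z' x' ≤ 3 * Real.log 3 ∨ M.exc y' x' z' ≤ 3 * Real.log 3) ∧
      (M.exc z' x' y' ≤ 3 * Real.log 3 ∨ M.exc z' y' x' ≤ 3 * Real.log 3) := by
  have h3 : 0 < Real.log 3 := Real.log_pos (by norm_num)
  obtain ⟨x', a1, a2, a3, a4, -, -, -, -⟩ := M.exists_vertex_retraction x y z
  obtain ⟨y', b1, b2, b3, b4, b5, b6, b7, b8⟩ := M.exists_vertex_retraction y z x'
  obtain ⟨z', c1, c2, c3, c4, c5, c6, c7, c8⟩ := M.exists_vertex_retraction z x' y'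
  refine ⟨x', y', z', ?_, ?_, ?_, ?_, ?_, ?_⟩
  · linarith [M.dist_comm y' y, M.dist_comm x' y', M.dist_comm x' y]
  · linarith [M.dist_comm z' z, M.dist_comm z y', M.dist_comm z' y']
  · linarith [M.dist_comm x' x, M.dist_comm x z, M.dist_comm x' z]
  · rcases min_choice (M.exc x y z) (M.exc x z y) with h | h
    · left; linarith
    · right; linarith
  · rcases min_choice (M.exc y z x') (M.exc y x' z) with h | h
    · left; linarith
    · right; linarith
  · rcases min_choice (M.exc z x' y') (M.exc z y' x') with h | h
    · left; linarith
    · right; linarith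

/-- The scalars `c` and `c'` cancel, since the distance averages two opposite comparisons. -/
theorem dist_le_log {L : Herm3 A ≃ₗ[ℝ] Herm3 A} (hL : L ∈ orderGroup A) {y y' : X} {D : Herm3 A}
    {K c c' : ℝ} (hK : 0 < K) (hc : 0 < c) (hc' : 0 < c') (h1 : Le (K⁻¹ • D) (c • L (M.sq y)))
    (h2 : Le (c • L (M.sq y)) (K • D)) (h : L (M.sq y') = c' • D) :
    M.dist y y' ≤ Real.log K := by
  have e1 : M.mu y y' ≤ Real.log (c' * K * c) := by
    rw [mu_le_iff, Real.exp_log (by positivity)]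
    refine (M.posDef_sq y).ratio_le ?_
    rw [← hL, map_smul, h]
    have := h1.smul (c := c' * K) (by positivity)
    rwa [smul_smul, mul_assoc, mul_inv_cancel₀ hK.ne', mul_one, smul_smul] at this
  have e2 : M.mu y' y ≤ Real.log (c⁻¹ * K * c'⁻¹) := by
    rw [mu_le_iff, Real.exp_log (by positivity)]
    refine (M.posDef_sq y').ratio_le ?_
    rw [← hL, map_smul, h, smul_smul, mul_assoc, inv_mul_cancel₀ hc'.ne', mul_one]
    have := h2.smul (c := c⁻¹) (by positivity)
    rwa [smul_smul, inv_mul_cancel₀ hc.ne', one_smul, smul_smul] at this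
  rw [dist_eq_mu]
  rw [Real.log_mul (by positivity) hc.ne', Real.log_mul hc'.ne' hK.ne'] at e1
  rw [Real.log_mul (by positivity) (by positivity), Real.log_mul (by positivity) hK.ne',
    Real.log_inv, Real.log_inv] at e2
  linarith

theorem exists_sq_map {g : Herm3 A ≃ₗ[ℝ] Herm3 A} (hg : g ∈ genGroup A) {b : Fin 3 → ℝ}
    (hb : ∀ i, 0 < b i) (h1 : b 0 * b 1 * b 2 = 1) : ∃ x, g (M.sq x) = diag b := by
  have hd : det (g.symm (diag b)) = 1 := by
    rw [← genGroup_le_detGroup hg, g.apply_symm_apply, det_diag, h1]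
  obtain ⟨x, hx⟩ := M.exists_sq (g.symm (diag b)) (posDef_of_det_ne_zero (by
    rw [← zero_le_map_iff (genGroup_le_orderGroup hg), g.apply_symm_apply, zero_le_diag_iff]
    exact fun i => (hb i).le) (by rw [hd]; exact one_ne_zero)) hd
  exact ⟨x, by rw [hx, g.apply_symm_apply]⟩

theorem exists_near_of_exc_le {C : ℝ} (hC : 0 < C) (x y z : X) (ax : M.exc x y z ≤ C)
    (ay : M.exc y z x ≤ C) (az : M.exc z x y ≤ C) :
    ∃ t, ∃ g ∈ genGroup A, ∃ y' z', g (M.sq x) = diag 1 ∧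
      g (M.sq y') = diag ((Real.exp (-t / 3) • ![Real.exp t, 1, 1]) ^ 2) ∧
      g (M.sq z') = diag ((Real.exp (-2 * t / 3) • ![Real.exp t, Real.exp t, 1]) ^ 2) ∧
      M.dist y y' ≤ Real.log (16 * Real.exp C ^ 3) ∧
      M.dist z z' ≤ Real.log (16 * Real.exp C ^ 3) := by
  unfold exc at ax ay az
  obtain ⟨g, hg, τ, q, r, hτ, hq, hr, hx, a1, a2, a3, a4⟩ := exists_near_equilateral_of_ratio_le
    (M.posDef_sq x) (M.posDef_sq y) (M.posDef_sq z) (M.det_sq x) (Real.one_lt_exp_iff.2 hC)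
    (by simp only [← exp_mu, ← Real.exp_add, Real.exp_le_exp]; linarith)
    (by simp only [← exp_mu, ← Real.exp_add, Real.exp_le_exp]; linarith)
    (by simp only [← exp_mu, ← Real.exp_add, Real.exp_le_exp]; linarith)
  have hgo := genGroup_le_orderGroup hg
  -- Points are represented by their squares, hence the factor 2.
  obtain ⟨t, rfl⟩ : ∃ t, τ = Real.exp (2 * t) :=
    ⟨Real.log τ / 2, by rw [mul_div_cancel₀ _ two_ne_zero, Real.exp_log (by linarith)]⟩
  obtain ⟨y', hy'⟩ := M.exists_sq_map hg
    (b := (Real.exp (-t / 3) • ![Real.exp t, 1, 1]) ^ 2) (by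
      intro i; fin_cases i <;> simp <;> positivity) (by
      simp only [Pi.pow_apply, Pi.smul_apply, smul_eq_mul, Matrix.cons_val_zero,
        Matrix.cons_val_one, Matrix.cons_val, mul_one, ← Real.exp_add, exp_sq]
      rw [Real.exp_eq_one_iff]; ring)
  obtain ⟨z', hz'⟩ := M.exists_sq_map hg
    (b := (Real.exp (-2 * t / 3) • ![Real.exp t, Real.exp t, 1]) ^ 2) (by
      intro i; fin_cases i <;> simp <;> positivity) (by
      simp only [Pi.pow_apply, Pi.smul_apply, smul_eq_mul, Matrix.cons_val_zero,
        Matrix.cons_val_one, Matrix.cons_val, mul_one, ← Real.exp_add, exp_sq]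
      rw [Real.exp_eq_one_iff]; ring)
  refine ⟨t, g, hg, y', z', hx, hy', hz', M.dist_le_log hgo (by positivity) hq
    (c' := Real.exp (2 * (-t / 3))) (by positivity) a1 a2 ?_, M.dist_le_log hgo (by positivity) hr
    (c' := Real.exp (2 * (-2 * t / 3))) (by positivity) a3 a4 ?_⟩
  · rw [hy', ← diag_smul]
    congr 1
    ext i; fin_cases i <;> simp [mul_pow, exp_sq]
  · rw [hz', ← diag_smul]
    congr 1
    ext i; fin_cases i <;> simp [mul_pow, exp_sq]

theorem equilateral_zero (x : X) : M.Equilateral 0 x x x := by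
  obtain ⟨g, hg, hx⟩ := exists_map_eq_one (M.posDef_sq x) (M.det_sq x)
  have e : (![1, 1, 1] : Fin 3 → ℝ) = 1 := by ext i; fin_cases i <;> rfl
  refine M.equilateral_spec 0 x x x g hg hx ?_ ?_ <;> simp [hx, e]

theorem exists_equilateral_near (x y z : X) {C : ℝ} (hC : 0 < C)
    (hx : M.exc x y z ≤ C ∨ M.exc x z y ≤ C) (hy : M.exc y z x ≤ C ∨ M.exc y x z ≤ C)
    (hz : M.exc z x y ≤ C ∨ M.exc z y x ≤ C) :
    ∃ x' y' z', (∃ t, M.Equilateral t x' y' z') ∧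
      M.dist x x' ≤ Real.log (16 * Real.exp C ^ 3) ∧
      M.dist y y' ≤ Real.log (16 * Real.exp C ^ 3) ∧
      M.dist z z' ≤ Real.log (16 * Real.exp C ^ 3) := by
  have e16 : 3 * C ≤ Real.log (16 * Real.exp C ^ 3) := by
    rw [Real.log_mul (by norm_num) (by positivity), Real.log_pow, Real.log_exp]
    have : 0 ≤ Real.log 16 := Real.log_nonneg (by norm_num)
    push_cast; linarith
  -- Adding small excesses of opposite orientation at two vertices bounds their distance by `C`.
  -- When both orientations occur, all vertices are therefore close, and a degenerate triangle
  -- serves.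
  have mixed (h : M.dist y x ≤ 3 * C ∧ M.dist z x ≤ 3 * C) : ∃ x' y' z',
      (∃ t, M.Equilateral t x' y' z') ∧ M.dist x x' ≤ Real.log (16 * Real.exp C ^ 3) ∧
      M.dist y y' ≤ Real.log (16 * Real.exp C ^ 3) ∧
      M.dist z z' ≤ Real.log (16 * Real.exp C ^ 3) :=
    ⟨x, x, x, ⟨0, M.equilateral_zero x⟩, by rw [dist_self]; linarith, h.1.trans e16,
      h.2.trans e16⟩
  have t1 := M.mu_triangle x y z
  have t2 := M.mu_triangle x z y
  have t3 := M.mu_triangle y x z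
  have t4 := M.mu_triangle y z x
  have t5 := M.mu_triangle z x y
  have t6 := M.mu_triangle z y x
  rcases hx with ax | ax <;> rcases hy with ay | ay <;> rcases hz with az | az
  · obtain ⟨t, g, hg, y', z', hx, hy, hz, dy, dz⟩ := M.exists_near_of_exc_le hC x y z ax ay az
    exact ⟨x, y', z', ⟨t, M.equilateral_spec t _ _ _ g hg hx hy hz⟩,
      by rw [dist_self]; linarith, dy, dz⟩
  case inr.inr.inr =>
    obtain ⟨t, g, hg, z', y', hx, hz, hy, dz, dy⟩ := M.exists_near_of_exc_le hC x z y ax az ay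
    obtain ⟨k, hk, hkd⟩ := exists_swap (A := A)
    have swap (b : Fin 3 → ℝ) : k (diag b) = diag ![b 2, b 1, b 0] := by
      rw [← hkd]; congr 2; ext i; fin_cases i <;> rfl
    refine ⟨x, y', z', ⟨-t, M.equilateral_spec (-t) _ _ _ (k * g)
      (mul_mem (rotGroup_le_genGroup hk) hg) ?_ ?_ ?_⟩, by rw [dist_self]; linarith, dy, dz⟩
    · change k (g _) = _
      rw [hx, (rotGroup_le_unitGroup hk).2]
    · change k (g _) = _
      rw [hy, swap]
      congr 1
      ext i; fin_cases i <;> simp [exp_sq, ← Real.exp_add] <;> ring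
    · change k (g _) = _
      rw [hz, swap]
      congr 1
      ext i; fin_cases i <;> simp [exp_sq, ← Real.exp_add] <;> ring
  all_goals
    refine mixed ?_
    unfold exc at ax ay az
    rw [dist_eq_mu, dist_eq_mu]
    constructor <;> linarith

theorem exists_equilateral_retraction :
    ∃ δ : ℝ, 0 < δ ∧ ∀ x y z, ∃ x' y' z', (∃ t, M.Equilateral t x' y' z') ∧
      M.dist x x' + M.dist x' y' + M.dist y' y ≤ M.dist x y + δ ∧
      M.dist y y' + M.dist y' z' + M.dist z' z ≤ M.dist y z + δ ∧
      M.dist z z' + M.dist z' x' + M.dist x' x ≤ M.dist z x + δ := by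
  have h3 : 0 < Real.log 3 := Real.log_pos (by norm_num)
  set K := Real.log (16 * Real.exp (3 * Real.log 3) ^ 3) with hK
  have hK0 : 0 ≤ K := by
    refine Real.log_nonneg ?_
    have : 1 ≤ Real.exp (3 * Real.log 3) ^ 3 := one_le_pow₀ (Real.one_le_exp (by positivity))
    linarith
  -- Each endpoint of a side moves by at most `K`, and each move enters the path twice.
  refine ⟨2 * Real.log 3 + 4 * K, by positivity, fun x y z => ?_⟩
  obtain ⟨x₁, y₁, z₁, p1, p2, p3, hx, hy, hz⟩ := M.exists_reduced_triangle x y z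
  obtain ⟨x', y', z', ht, dx, dy, dz⟩ :=
    M.exists_equilateral_near x₁ y₁ z₁ (by positivity) hx hy hz
  have key (u u₁ u' v v₁ v' : X) (du : M.dist u₁ u' ≤ K) (dv : M.dist v₁ v' ≤ K)
      (h : M.dist u u₁ + M.dist u₁ v₁ + M.dist v₁ v ≤ M.dist u v + 2 * Real.log 3) :
      M.dist u u' + M.dist u' v' + M.dist v' v ≤ M.dist u v + (2 * Real.log 3 + 4 * K) := by
    have a1 := M.dist_triangle u u₁ u'
    have a2 := M.dist_triangle u' u₁ v'
    have a3 := M.dist_triangle u₁ v₁ v'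
    have a4 := M.dist_triangle v' v₁ v
    linarith [M.dist_comm u' u₁, M.dist_comm v' v₁]
  exact ⟨x', y', z', ht, key _ _ _ _ _ _ dx dy p1, key _ _ _ _ _ _ dy dz p2,
    key _ _ _ _ _ _ dz dx p3⟩

/-! ### Pairs of shape `(t, 0)`: the dominant projection has rank one for `t ≥ 0`, rank two for `t ≤
0` -/

theorem shape_nonneg {t : ℝ} : (diag ((Real.exp (-t / 3) • ![Real.exp t, 1, 1]) ^ 2) : Herm3 A) =
    Real.exp (-2 * t / 3) • (diag 1 + (Real.exp (2 * t) - 1) • diag ![1, 0, 0]) := by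
  rw [← diag_smul, ← diag_add, ← diag_smul]
  congr 1
  ext i; fin_cases i <;>
    simp [exp_sq, ← Real.exp_add, Matrix.vecHead, Matrix.vecTail] <;> ring_nf

theorem shape_nonpos {t : ℝ} : (diag ((Real.exp (-t / 3) • ![Real.exp t, 1, 1]) ^ 2) : Herm3 A) =
    Real.exp (4 * t / 3) • (diag 1 + (Real.exp (-2 * t) - 1) • diag ![0, 1, 1]) := by
  rw [← diag_smul, ← diag_add, ← diag_smul]
  congr 1
  ext i; fin_cases i <;>
    simp [exp_sq, ← Real.exp_add, Matrix.vecHead, Matrix.vecTail] <;> ring_nf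

/-- The excesses differ by the difference of the two cyclic sums of `mu`, which `ratio_cycle_le`
bounds. Equal signs let both pairs use the same `φ`. -/
theorem exc_le_exc_of_shape {s t : ℝ} (hst : 0 ≤ s * t) {z v w y : X} (hz : M.Shape t v z)
    (hy : M.Shape s w y) :
    M.exc v y z ≤ M.exc v z y + Real.log 18 + 4 * M.dist v w := by
  obtain ⟨L₁, hL₁, hV, hZ⟩ := M.shape_spec t v z hz
  obtain ⟨L₂, hL₂, hW, hY⟩ := M.shape_spec s w y hy
  have key : ratio (M.sq z) (M.sq y) * ratio (M.sq y) (M.sq v) * ratio (M.sq v) (M.sq z) ≤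
      18 * (ratio (M.sq v) (M.sq w) * ratio (M.sq w) (M.sq v)) ^ 2 *
        (ratio (M.sq z) (M.sq v) * ratio (M.sq v) (M.sq y) * ratio (M.sq y) (M.sq z)) := by
    have hcase : (0 ≤ s ∧ 0 ≤ t) ∨ (s ≤ 0 ∧ t ≤ 0) := by
      rcases mul_nonneg_iff.1 hst with h | h
      · exact Or.inl h
      · exact Or.inr h
    rcases hcase with ⟨h1, h2⟩ | ⟨h1, h2⟩
    · rw [shape_nonneg] at hZ hY
      exact ratio_cycle_le (Or.inl rfl) hL₁ hL₂ (M.posDef_sq v) (M.posDef_sq z) (M.posDef_sq w)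
        (M.posDef_sq y) (Real.exp_pos _) (Real.exp_pos _) (Real.one_le_exp (by linarith))
        (Real.one_le_exp (by linarith)) hV hZ hW hY
    · rw [shape_nonpos] at hZ hY
      exact ratio_cycle_le (Or.inr rfl) hL₁ hL₂ (M.posDef_sq v) (M.posDef_sq z) (M.posDef_sq w)
        (M.posDef_sq y) (Real.exp_pos _) (Real.exp_pos _) (Real.one_le_exp (by linarith))
        (Real.one_le_exp (by linarith)) hV hZ hW hY
  have h18 : (18 : ℝ) = Real.exp (Real.log 18) := (Real.exp_log (by norm_num)).symm
  rw [h18] at key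
  simp only [← exp_mu, ← Real.exp_add, exp_sq, Real.exp_le_exp] at key
  rw [dist_eq_mu]
  unfold exc
  linarith

theorem exists_retraction_of_shape {s t δ₀ : ℝ} (hst : 0 ≤ s * t) {z v w y : X}
    (hvw : M.dist v w < δ₀) (hz : M.Shape t v z) (hy : M.Shape s w y) :
    ∃ u, M.dist z u + M.dist u v ≤ M.dist z v + (Real.log 3 + Real.log 18 + 4 * δ₀) ∧
      M.dist v u + M.dist u y ≤ M.dist v y + (Real.log 3 + Real.log 18 + 4 * δ₀) ∧
      M.dist y u + M.dist u z ≤ M.dist y z + (Real.log 3 + Real.log 18 + 4 * δ₀) := by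
  have h18 : 0 < Real.log 18 := Real.log_pos (by norm_num)
  have hd0 : 0 ≤ M.dist v w := by
    have := M.dist_triangle v w v
    rw [dist_self, M.dist_comm w v] at this
    linarith
  have b1 := M.exc_le_exc_of_shape hst hz hy
  have b2 := M.exc_le_exc_of_shape (by rwa [mul_comm]) hy hz
  -- The reverse comparison `b2` has its vertex at `w`; moving it to `v` costs another `4 d(v, w)`.
  have b3 : M.exc v z y ≤ M.exc v y z + Real.log 18 + 8 * M.dist v w := by
    rw [M.dist_comm w v] at b2
    rw [dist_eq_mu] at b2 ⊢
    unfold exc at b2 ⊢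
    linarith [M.mu_triangle z w v, M.mu_triangle v w y, M.mu_triangle y v w, M.mu_triangle w v z]
  obtain ⟨u, c1, c2, c3, c4, -, -, -, -⟩ := M.exists_vertex_retraction v z y
  refine ⟨u, ?_, ?_, ?_⟩
  · linarith [M.dist_comm z u, M.dist_comm u v, M.dist_comm z v]
  · linarith
  -- Half the sum of the two excesses at `u` is the excess of the path `y u z` for the distance.
  · have : M.exc u z y + M.exc u y z ≤ 2 * Real.log 3 + Real.log 18 + 8 * M.dist v w := by
      rcases min_choice (M.exc v z y) (M.exc v y z) with h | h <;> rw [h] at c3 c4 <;> linarith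
    simp only [dist_eq_mu] at this hvw ⊢
    unfold exc at this
    linarith

end ConeModel

/-! ## The octonions as a symmetric composition algebra -/

namespace Octonion

/-- The real part of `x * star y`. -/
instance : Inner ℝ Octonion := ⟨fun x y => ⟪x.fst, y.fst⟫_ℝ + ⟪x.snd, y.snd⟫_ℝ⟩

theorem inner_def (x y : Octonion) : ⟪x, y⟫_ℝ = ⟪x.fst, y.fst⟫_ℝ + ⟪x.snd, y.snd⟫_ℝ := rfl

/-- The Euclidean structure of the octonions. -/
@[reducible] def innerCore : InnerProductSpace.Core ℝ Octonion where
  conj_inner_symm x y := by simp [inner_def, real_inner_comm]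
  re_inner_nonneg x := by
    simp only [inner_def, real_inner_self_eq_norm_sq, RCLike.re_to_real]; positivity
  add_left x y z := by simp only [inner_def, add_fst, add_snd, inner_add_left]; ring
  smul_left x y r := by
    simp only [inner_def, smul_fst, smul_snd, real_inner_smul_left, conj_trivial]; ring
  definite x h := by
    rw [inner_def, real_inner_self_eq_norm_sq, real_inner_self_eq_norm_sq] at h
    have h1 : ‖x.fst‖ = 0 := by nlinarith [sq_nonneg ‖x.fst‖, sq_nonneg ‖x.snd‖]
    have h2 : ‖x.snd‖ = 0 := by nlinarith [sq_nonneg ‖x.fst‖, sq_nonneg ‖x.snd‖]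
    exact Octonion.ext (norm_eq_zero.1 h1) (norm_eq_zero.1 h2)

instance : NormedAddCommGroup Octonion := innerCore.toNormedAddCommGroup

instance : InnerProductSpace ℝ Octonion := InnerProductSpace.ofCore innerCore.toCore

theorem norm_sq_eq (x : Octonion) : ‖x‖ ^ 2 =
    x.fst.re ^ 2 + x.fst.imI ^ 2 + x.fst.imJ ^ 2 + x.fst.imK ^ 2 +
      (x.snd.re ^ 2 + x.snd.imI ^ 2 + x.snd.imJ ^ 2 + x.snd.imK ^ 2) := by
  rw [← real_inner_self_eq_norm_sq]
  change ⟪x.fst, x.fst⟫_ℝ + ⟪x.snd, x.snd⟫_ℝ = _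
  rw [Quaternion.inner_self, Quaternion.inner_self, Quaternion.normSq_def', Quaternion.normSq_def']

theorem star_smul' (r : ℝ) (x : Octonion) : star (r • x) = r • star x := by
  apply Octonion.ext <;> simp

theorem smul_mul' (r : ℝ) (x y : Octonion) : (r • x) * y = r • (x * y) := by
  apply Octonion.ext <;> simp [smul_sub, smul_add]

theorem mul_smul' (r : ℝ) (x y : Octonion) : x * (r • y) = r • (x * y) := by
  apply Octonion.ext <;> simp [smul_sub, smul_add]

/-- This and the next identity have the same right-hand side, which yields the associativity of the
inner product. -/
theorem inner_star_mul (x y z : Octonion) : ⟪star (x * y), z⟫_ℝ = re (x * y * z) := by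
  change ⟪(star (x * y)).fst, z.fst⟫_ℝ + ⟪(star (x * y)).snd, z.snd⟫_ℝ = _
  simp [Quaternion.inner_def, re]
  ring

theorem inner_star_mul' (x y z : Octonion) : ⟪x, star (y * z)⟫_ℝ = re (x * y * z) := by
  change ⟪x.fst, (star (y * z)).fst⟫_ℝ + ⟪x.snd, (star (y * z)).snd⟫_ℝ = _
  simp [Quaternion.inner_def, re]
  ring

/-- Alternativity replaces associativity; it is checked in the eight real coordinates. -/
theorem star_mul_mul_cancel (x y : Octonion) : star x * (x * y) = ‖x‖ ^ 2 • y := by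
  rw [norm_sq_eq]
  apply Octonion.ext <;> ext <;> simp <;> ring

theorem mul_mul_star_cancel (x y : Octonion) : y * x * star x = ‖x‖ ^ 2 • y := by
  rw [norm_sq_eq]
  apply Octonion.ext <;> ext <;> simp <;> ring

instance : SymmetricComposition Octonion where
  mul := LinearMap.mk₂ ℝ (fun x y => star (x * y)) (fun x y z => by rw [add_mul, star_add])
    (fun r x y => by rw [smul_mul', star_smul']) (fun x y z => by rw [mul_add, star_add])
    (fun r x y => by rw [mul_smul', star_smul'])
  inner_mul x y z := (inner_star_mul x y z).trans (inner_star_mul' x y z).symm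
  mul_mul_cancel_left x y := by
    change star (star (x * y) * x) = _
    rw [star_mul, star_star, star_mul_mul_cancel]
  mul_mul_cancel_right x y := by
    change star (x * star (y * x)) = _
    rw [star_mul, star_star, mul_mul_star_cancel]

instance : Nontrivial Octonion := ⟨⟨0, 1, fun h => by
  have := congrArg (fun x => x.fst.re) h
  exact zero_ne_one this⟩⟩

instance : FiniteDimensional ℝ Octonion :=
  FiniteDimensional.of_injective (V₂ := Quaternion ℝ × Quaternion ℝ)
    { toFun := fun x : Octonion => (x.fst, x.snd), map_add' := fun _ _ => rfl,
      map_smul' := fun _ _ => rfl } toProd_injective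

theorem mul_def (x y : Octonion) : SymmetricComposition.mul x y = star (x * y) := rfl

theorem norm_sq_eq_normSq (x : Octonion) : ‖x‖ ^ 2 = normSq x := by
  rw [norm_sq_eq]
  simp [normSq, re]
  ring

theorem re_mul_star_self (x : Octonion) : re (x * star x) = ‖x‖ ^ 2 :=
  (norm_sq_eq_normSq x).symm

theorem re_star_mul_self (x : Octonion) : re (star x * x) = ‖x‖ ^ 2 := by
  rw [norm_sq_eq]
  simp [re]
  ring

@[simp] theorem re_add (x y : Octonion) : re (x + y) = re x + re y := rfl

@[simp] theorem re_ofReal (r : ℝ) : re (ofReal r) = r := rfl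

@[simp] theorem star_ofReal (r : ℝ) : star (ofReal r) = ofReal r := by
  apply Octonion.ext <;> simp [ofReal]

theorem ofReal_eq (r : ℝ) : ofReal r = r • (1 : Octonion) := by
  apply Octonion.ext
  · exact (Algebra.algebraMap_eq_smul_one (A := Quaternion ℝ) r)
  · exact (smul_zero r).symm

theorem ofReal_mul_eq (r : ℝ) (x : Octonion) : ofReal r * x = r • x := by
  rw [ofReal_eq, smul_mul', one_mul]

theorem mul_ofReal_eq (r : ℝ) (x : Octonion) : x * ofReal r = r • x := by
  rw [ofReal_eq, mul_smul', mul_one]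

theorem ofReal_re {x : Octonion} (h : star x = x) : ofReal (re x) = x := by
  have h1 := congrArg Octonion.fst h
  have h2 := congrArg Octonion.snd h
  simp only [star_fst, star_snd] at h1 h2
  apply Octonion.ext
  · exact (Quaternion.star_eq_self.1 h1).symm
  · have h3 : (2 : ℝ) • x.snd = 0 := by rw [two_smul]; nth_rewrite 1 [← h2]; exact neg_add_cancel _
    exact ((smul_eq_zero.1 h3).resolve_left two_ne_zero).symm

end Octonion

/-! ### The Jordan square through trace and adjoint -/

namespace Herm3

variable {A : Type} [NormedAddCommGroup A] [InnerProductSpace ℝ A] [SymmetricComposition A]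

/-- The Jordan square. -/
def square (X : Herm3 A) : Herm3 A := sharp X + tr X • X - tr (sharp X) • diag 1

/-- The Cayley–Hamilton form of the square reduces equivariance to that of the trace and the
adjoint. -/
theorem square_map {g : Herm3 A ≃ₗ[ℝ] Herm3 A} (hg : g ∈ unitGroup A) (X : Herm3 A) :
    square (g X) = g (square X) := by
  simp only [square, map_sub, map_add, map_smul, sharp_map hg, tr_map hg, hg.2]

theorem square_diag (b : Fin 3 → ℝ) : square (diag b : Herm3 A) = diag (b ^ 2) := by
  ext i
  · fin_cases i <;> simp [square, sharp, tr, Matrix.vecHead, Matrix.vecTail] <;> ring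
  · fin_cases i <;> simp [square, sharp]

end Herm3

open Octonion

/-! ### Coordinates on the Albert algebra -/

namespace Albert

theorem star_apply (M : Albert) (i j : Fin 3) : star (M.1 i j) = M.1 j i :=
  congrFun (congrFun M.2 j) i

/-- The Albert algebra in coordinates. -/
def toHerm : Albert ≃ₗ[ℝ] Herm3 Octonion where
  toFun M := (![(M.1 0 0).re, (M.1 1 1).re, (M.1 2 2).re], ![M.1 1 2, M.1 2 0, M.1 0 1])
  map_add' M N := by ext1 <;> ext1 i <;> fin_cases i <;> rfl
  map_smul' r M := by ext1 <;> ext1 i <;> fin_cases i <;> rfl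
  invFun X := ⟨!![ofReal (X.1 0), X.2 2, star (X.2 1); star (X.2 2), ofReal (X.1 1), X.2 0;
    X.2 1, star (X.2 0), ofReal (X.1 2)], by
      change Matrix.conjTranspose _ = _
      ext1 i j
      rw [Matrix.conjTranspose_apply]
      fin_cases i <;> fin_cases j <;> simp⟩
  left_inv M := by
    apply Subtype.ext
    have h := Albert.star_apply M
    ext1 i j
    fin_cases i <;> fin_cases j <;> simp [h, ofReal_re (h _ _)]
  right_inv X := by ext1 <;> ext1 i <;> fin_cases i <;> simp

theorem toHerm_symm_val (X : Herm3 Octonion) : (toHerm.symm X).1 =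
    !![ofReal (X.1 0), X.2 2, star (X.2 1); star (X.2 2), ofReal (X.1 1), X.2 0;
      X.2 1, star (X.2 0), ofReal (X.1 2)] := rfl

theorem toHerm_apply (M : Albert) : toHerm M =
    (![(M.1 0 0).re, (M.1 1 1).re, (M.1 2 2).re], ![M.1 1 2, M.1 2 0, M.1 0 1]) := rfl

theorem toHerm_diag (a : Fin 3 → ℝ) : toHerm (Albert.diag a) = Herm3.diag a := by
  ext1
  · ext1 i; fin_cases i <;> simp [toHerm_apply, Albert.diag]
  · ext1 i; fin_cases i <;> simp [toHerm_apply, Albert.diag]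

theorem det_toHerm (M : Albert) : Herm3.det (toHerm M) = Albert.det M := by
  simp only [Herm3.det, Albert.det, toHerm_apply, Matrix.cons_val_zero, Matrix.cons_val_one,
    Matrix.cons_val, norm_sq_eq_normSq, Octonion.mul_def, inner_star_mul]

theorem toHerm_jmul_self (M : Albert) : toHerm (Albert.jmul M M) = square (toHerm M) := by
  obtain ⟨X, rfl⟩ := toHerm.symm.surjective M
  rw [LinearEquiv.apply_symm_apply, toHerm_apply]
  have e : (Albert.jmul (toHerm.symm X) (toHerm.symm X)).1 =
      (toHerm.symm X).1 * (toHerm.symm X).1 := by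
    change (1 / 2 : ℝ) • (_ + _) = _
    rw [← two_smul ℝ, smul_smul]
    norm_num
  rw [e, toHerm_symm_val]
  ext1
  · ext1 i
    fin_cases i <;>
      simp [Matrix.mul_apply, Fin.sum_univ_three, square, sharp, tr, re_mul_star_self,
        re_star_mul_self, ofReal_mul_eq, Matrix.vecHead, Matrix.vecTail] <;> simp [ofReal, re] <;> ring
  · ext1 i
    fin_cases i
    · simp [Matrix.mul_apply, Fin.sum_univ_three, square, sharp, tr, ofReal_mul_eq, mul_ofReal_eq,
        Octonion.mul_def, Matrix.vecHead, Matrix.vecTail]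
      module
    · simp [Matrix.mul_apply, Fin.sum_univ_three, square, sharp, tr, ofReal_mul_eq, mul_ofReal_eq,
        Octonion.mul_def, Matrix.vecHead, Matrix.vecTail]
      module
    · simp [Matrix.mul_apply, Fin.sum_univ_three, square, sharp, tr, ofReal_mul_eq, mul_ofReal_eq,
        Octonion.mul_def, Matrix.vecHead, Matrix.vecTail]
      module

/-- Transport of linear maps to coordinates. -/
def conj (g : Albert ≃ₗ[ℝ] Albert) : Herm3 Octonion ≃ₗ[ℝ] Herm3 Octonion :=
  toHerm.symm ≪≫ₗ g ≪≫ₗ toHerm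

theorem conj_toHerm (g : Albert ≃ₗ[ℝ] Albert) (M : Albert) : conj g (toHerm M) = toHerm (g M) := by
  simp [conj]

theorem conj_mem_detGroup {g : Albert ≃ₗ[ℝ] Albert} (hg : g ∈ E6) : conj g ∈ detGroup Octonion := by
  intro X
  obtain ⟨M, rfl⟩ := toHerm.surjective X
  rw [conj_toHerm, det_toHerm, det_toHerm]
  exact hg M

theorem conj_mem_unitGroup {g : Albert ≃ₗ[ℝ] Albert} (hg : g ∈ F4) :
    conj g ∈ unitGroup Octonion :=
  ⟨conj_mem_detGroup hg.1, by rw [← toHerm_diag, conj_toHerm, hg.2]⟩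

/-- Transport of linear maps from coordinates. -/
def unconj (g : Herm3 Octonion ≃ₗ[ℝ] Herm3 Octonion) : Albert ≃ₗ[ℝ] Albert :=
  toHerm ≪≫ₗ g ≪≫ₗ toHerm.symm

theorem toHerm_unconj (g : Herm3 Octonion ≃ₗ[ℝ] Herm3 Octonion) (M : Albert) :
    toHerm (unconj g M) = g (toHerm M) := by
  simp [unconj]

theorem unconj_mem_E6 {g : Herm3 Octonion ≃ₗ[ℝ] Herm3 Octonion} (hg : g ∈ detGroup Octonion) :
    unconj g ∈ E6 := by
  intro M
  rw [← det_toHerm, toHerm_unconj, hg, det_toHerm]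

theorem unconj_mem_F4 {g : Herm3 Octonion ≃ₗ[ℝ] Herm3 Octonion} (hg : g ∈ unitGroup Octonion) :
    unconj g ∈ F4 :=
  ⟨unconj_mem_E6 hg.1, toHerm.injective (by rw [toHerm_unconj, toHerm_diag, hg.2])⟩

end Albert

/-! ### The octonionic space as a cone model -/

namespace XO

open Albert

/-- The square of a point, in coordinates. -/
def sq (M : XO) : Herm3 Octonion := toHerm (Albert.jmul M.1 M.1)

theorem exists_map_eq (M : XO) : ∃ k ∈ unitGroup Octonion, ∃ a : Fin 3 → ℝ, (∀ i, 0 < a i) ∧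
    a 0 * a 1 * a 2 = 1 ∧ k (toHerm M.1) = Herm3.diag a := by
  obtain ⟨M, h1, k, hk, a, ha, h⟩ := M
  have e : conj k (toHerm M) = Herm3.diag a := by rw [conj_toHerm, h, toHerm_diag]
  refine ⟨conj k, conj_mem_unitGroup hk, a, ha, ?_, e⟩
  rw [← det_diag (A := Octonion), ← e, (conj_mem_unitGroup hk).1, det_toHerm, h1]

theorem exists_map_sq_eq (M : XO) : ∃ k ∈ unitGroup Octonion, ∃ a : Fin 3 → ℝ, (∀ i, 0 < a i) ∧
    a 0 * a 1 * a 2 = 1 ∧ k M.sq = Herm3.diag (a ^ 2) := by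
  obtain ⟨k, hk, a, ha, h1, h⟩ := M.exists_map_eq
  refine ⟨k, hk, a, ha, h1, ?_⟩
  rw [sq, toHerm_jmul_self, ← square_map hk, h, square_diag]

theorem posDef_sq (M : XO) : M.sq.PosDef := by
  obtain ⟨k, hk, a, ha, h1, h⟩ := M.exists_map_sq_eq
  have := (posDef_diag (A := Octonion) (b := a ^ 2) fun i => pow_pos (ha i) 2).map_unit
    (inv_mem hk)
  rwa [← h, show k⁻¹ (k M.sq) = M.sq from k.symm_apply_apply _] at this

theorem det_sq (M : XO) : M.sq.det = 1 := by
  obtain ⟨k, hk, a, ha, h1, h⟩ := M.exists_map_sq_eq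
  rw [← hk.1, h, det_diag]
  simp only [Pi.pow_apply, ← mul_pow, h1, one_pow]

theorem exists_of_map {k : Herm3 Octonion ≃ₗ[ℝ] Herm3 Octonion} (hk : k ∈ unitGroup Octonion)
    {a : Fin 3 → ℝ} (ha : ∀ i, 0 < a i) (h1 : a 0 * a 1 * a 2 = 1) :
    ∃ M : XO, k (toHerm M.1) = Herm3.diag a := by
  refine ⟨⟨toHerm.symm (k.symm (Herm3.diag a)), ?_, unconj k, unconj_mem_F4 hk, a, ha, ?_⟩, ?_⟩
  · rw [← det_toHerm, LinearEquiv.apply_symm_apply, ← hk.1, LinearEquiv.apply_symm_apply, det_diag,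
      h1]
  · apply toHerm.injective
    rw [toHerm_unconj, LinearEquiv.apply_symm_apply, LinearEquiv.apply_symm_apply, toHerm_diag]
  · simp

theorem exists_isDiag {a : Fin 3 → ℝ} (ha : ∀ i, 0 < a i) (h1 : a 0 * a 1 * a 2 = 1) :
    ∃ M : XO, IsDiagO M a := by
  obtain ⟨M, hM⟩ := exists_of_map (one_mem _) ha h1
  exact ⟨M, toHerm.injective (by rw [toHerm_diag]; exact hM)⟩

theorem sq_of_isDiag {M : XO} {a : Fin 3 → ℝ} (h : IsDiagO M a) : M.sq = Herm3.diag (a ^ 2) := by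
  rw [sq, toHerm_jmul_self, h, toHerm_diag, square_diag]

theorem pos_of_isDiag {M : XO} {a : Fin 3 → ℝ} (h : IsDiagO M a) (i : Fin 3) : 0 < a i := by
  obtain ⟨k, hk, b, hb, -, hkb⟩ := M.exists_map_eq
  have := (posDef_diag (A := Octonion) hb).map_unit (inv_mem hk)
  rw [← hkb, show k⁻¹ (k (toHerm M.1)) = toHerm M.1 from k.symm_apply_apply _, h, toHerm_diag]
    at this
  exact this.pos i

theorem exists_sq {P : Herm3 Octonion} (hP : P.PosDef) (h1 : P.det = 1) : ∃ M : XO, M.sq = P := by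
  obtain ⟨k, hk, b, -, -, hb⟩ := exists_map_eq_diag P
  have hku := rotGroup_le_unitGroup hk
  have hb0 : PosDef (Herm3.diag b : Herm3 Octonion) := hb ▸ hP.map_unit hku
  have hs : ∀ i, 0 < √(b i) := fun i => Real.sqrt_pos.2 (hb0.pos i)
  rw [← hku.1, hb, det_diag] at h1
  obtain ⟨M, hM⟩ := exists_of_map hku hs (by
    rw [← Real.sqrt_mul (hb0.pos 0).le, ← Real.sqrt_mul (mul_pos (hb0.pos 0) (hb0.pos 1)).le, h1,
      Real.sqrt_one])
  refine ⟨M, k.injective ?_⟩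
  rw [sq, toHerm_jmul_self, ← square_map hku, hM, hb, square_diag]
  congr 1
  ext i
  exact Real.sq_sqrt (hb0.pos i).le

theorem acts_iff (g : E6) (M N : XO) : ActsO g M N ↔ conj g.1 M.sq = N.sq := by
  rw [sq, sq, conj_toHerm, toHerm.injective.eq_iff]
  exact eq_comm

theorem acts_unconj {g : Herm3 Octonion ≃ₗ[ℝ] Herm3 Octonion} (hg : g ∈ detGroup Octonion)
    (M N : XO) : ActsO ⟨unconj g, unconj_mem_E6 hg⟩ M N ↔ g M.sq = N.sq := by
  rw [sq, sq, ← toHerm_unconj, toHerm.injective.eq_iff]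
  exact eq_comm

end XO

/-- Equality of upper and lower bounds replaces the statement that `b` is a rearrangement of `a ^
2`. -/
theorem log_iSup_add_log_iSup_inv {a b : Fin 3 → ℝ} (ha : ∀ i, 0 < a i) (hb : ∀ i, 0 < b i)
    (h10 : b 1 ≤ b 0) (h21 : b 2 ≤ b 1) (hu : ∀ c, (∀ i, (a ^ 2) i ≤ c) ↔ ∀ i, b i ≤ c)
    (hl : ∀ c, (∀ i, c ≤ (a ^ 2) i) ↔ ∀ i, c ≤ b i) :
    Real.log (⨆ i, a i) + Real.log (⨆ i, (a i)⁻¹) = (Real.log (b 0) - Real.log (b 2)) / 2 := by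
  have bdd : ∀ f : Fin 3 → ℝ, BddAbove (Set.range f) := fun f => (Set.finite_range f).bddAbove
  have e1 : ⨆ i, a i = √(b 0) := by
    apply le_antisymm
    · refine ciSup_le fun i => Real.le_sqrt_of_sq_le ((hu (b 0)).2 (fun j => ?_) i)
      fin_cases j
      exacts [le_rfl, h10, h21.trans h10]
    · have hs : ∀ i, a i ≤ ⨆ i, a i := le_ciSup (bdd a)
      refine Real.sqrt_le_iff.2 ⟨(ha 0).le.trans (hs 0), (hu _).1 (fun i => ?_) 0⟩
      exact pow_le_pow_left₀ (ha i).le (hs i) 2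
  have e2 : ⨆ i, (a i)⁻¹ = (√(b 2))⁻¹ := by
    have p2 := Real.sqrt_pos.2 (hb 2)
    apply le_antisymm
    · refine ciSup_le fun i => inv_anti₀ p2 ?_
      refine Real.sqrt_le_iff.2 ⟨(ha i).le, (hl (b 2)).2 (fun j => ?_) i⟩
      fin_cases j
      exacts [h21.trans h10, h21, le_rfl]
    · have hs : ∀ i, (a i)⁻¹ ≤ ⨆ i, (a i)⁻¹ := le_ciSup (bdd fun i => (a i)⁻¹)
      have h0 : 0 < ⨆ i, (a i)⁻¹ := (inv_pos.2 (ha 0)).trans_le (hs 0)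
      rw [inv_le_comm₀ p2 h0]
      refine Real.le_sqrt_of_sq_le ((hl _).1 (fun i => ?_) 2)
      exact pow_le_pow_left₀ (inv_pos.2 h0).le ((inv_le_comm₀ h0 (ha i)).2 (hs i)) 2
  rw [e1, e2, Real.log_inv, Real.log_sqrt (hb 0).le, Real.log_sqrt (hb 2).le]
  ring

namespace Herm3

variable {A : Type} [NormedAddCommGroup A] [InnerProductSpace ℝ A] [SymmetricComposition A]

theorem forall_le_iff_of_map {h : Herm3 A ≃ₗ[ℝ] Herm3 A} (hh : h ∈ orderGroup A) {a b : Fin 3 → ℝ}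
    (h1 : h (diag 1) = diag 1) (hab : h (diag a) = diag b) (c : ℝ) :
    (∀ i, a i ≤ c) ↔ ∀ i, b i ≤ c := by
  have := hh (diag a) (c • diag 1)
  rw [map_smul, h1, hab, smul_diag_one, le_diag_iff, le_diag_iff] at this
  exact this.symm

theorem forall_ge_iff_of_map {h : Herm3 A ≃ₗ[ℝ] Herm3 A} (hh : h ∈ orderGroup A) {a b : Fin 3 → ℝ}
    (h1 : h (diag 1) = diag 1) (hab : h (diag a) = diag b) (c : ℝ) :
    (∀ i, c ≤ a i) ↔ ∀ i, c ≤ b i := by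
  have := hh (c • diag 1) (diag a)
  rw [map_smul, h1, hab, smul_diag_one, le_diag_iff, le_diag_iff] at this
  exact this.symm

/-- If `h` in `genGroup` also maps `P` to `1`, then `g * h⁻¹` fixes `1` and lies in `unitGroup`. -/
theorem mem_orderGroup_of_map_eq_one [Nontrivial A] [FiniteDimensional ℝ A]
    {g : Herm3 A ≃ₗ[ℝ] Herm3 A} (hg : g ∈ detGroup A) {P : Herm3 A} (hP : PosDef P)
    (h1 : g P = diag 1) : g ∈ orderGroup A := by
  have hd : det P = 1 := by rw [← hg, h1, det_diag]; simp
  obtain ⟨h, hh, hhP⟩ := exists_map_eq_one hP hd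
  have hu : g * h⁻¹ ∈ unitGroup A := by
    refine ⟨mul_mem hg (inv_mem (genGroup_le_detGroup hh)), ?_⟩
    rw [← hhP, LinearEquiv.mul_apply, show h⁻¹ (h P) = P from h.symm_apply_apply P, h1, hhP]
  have := mul_mem (unitGroup_le_orderGroup hu) (genGroup_le_orderGroup hh)
  rwa [inv_mul_cancel_right] at this

end Herm3

namespace XO

open Albert

/-- Two admissible choices of `g` differ by a map fixing `1`, so the extreme entries agree and the
infimum is over one value. -/
theorem dist_eq (x y : XO) {g : Herm3 Octonion ≃ₗ[ℝ] Herm3 Octonion} (hg : g ∈ detGroup Octonion)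
    {b : Fin 3 → ℝ} (hb : ∀ i, 0 < b i) (h10 : b 1 ≤ b 0) (h21 : b 2 ≤ b 1)
    (hx : g x.sq = Herm3.diag 1) (hy : g y.sq = Herm3.diag b) :
    distO x y = (Real.log (b 0) - Real.log (b 2)) / 2 := by
  have key : ∀ r : ℝ, (∃ (g : E6) (I D : XO) (a : Fin 3 → ℝ), IsDiagO I 1 ∧ IsDiagO D a ∧
      ActsO g I x ∧ ActsO g D y ∧ r = Real.log (⨆ i, a i) + Real.log (⨆ i, (a i)⁻¹)) →
      r = (Real.log (b 0) - Real.log (b 2)) / 2 := by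
    rintro r ⟨g', I, D, a, hI, hD, hIx, hDy, rfl⟩
    rw [acts_iff, sq_of_isDiag hI, one_pow] at hIx
    rw [acts_iff, sq_of_isDiag hD] at hDy
    have hu : g * conj g'.1 ∈ unitGroup Octonion :=
      ⟨mul_mem hg (conj_mem_detGroup g'.2), by rw [LinearEquiv.mul_apply, hIx, hx]⟩
    have ho := unitGroup_le_orderGroup hu
    have e : (g * conj g'.1) (Herm3.diag (a ^ 2)) = Herm3.diag b := by
      rw [LinearEquiv.mul_apply, hDy, hy]
    exact log_iSup_add_log_iSup_inv (pos_of_isDiag hD) hb h10 h21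
      (forall_le_iff_of_map ho hu.2 e) (forall_ge_iff_of_map ho hu.2 e)
  have hd : b 0 * b 1 * b 2 = 1 := by rw [← det_diag (A := Octonion), ← hy, hg, det_sq]
  have hs : ∀ i, 0 < √(b i) := fun i => Real.sqrt_pos.2 (hb i)
  obtain ⟨I, hI⟩ := exists_isDiag (a := 1) (fun _ => one_pos) (by simp)
  obtain ⟨D, hD⟩ := exists_isDiag hs (by
    rw [← Real.sqrt_mul (hb 0).le, ← Real.sqrt_mul (mul_pos (hb 0) (hb 1)).le, hd, Real.sqrt_one])
  have hsq : (fun i => √(b i)) ^ 2 = b := funext fun i => Real.sq_sqrt (hb i).le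
  have hgi := inv_mem hg
  have hm : ∃ (g : E6) (I D : XO) (a : Fin 3 → ℝ), IsDiagO I 1 ∧ IsDiagO D a ∧
      ActsO g I x ∧ ActsO g D y ∧ Real.log (⨆ i, √(b i)) + Real.log (⨆ i, (√(b i))⁻¹) =
        Real.log (⨆ i, a i) + Real.log (⨆ i, (a i)⁻¹) := by
    refine ⟨⟨unconj g⁻¹, unconj_mem_E6 hgi⟩, I, D, _, hI, hD, ?_, ?_, rfl⟩
    · rw [acts_unconj hgi, sq_of_isDiag hI, one_pow, ← hx]
      exact g.symm_apply_apply _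
    · rw [acts_unconj hgi, sq_of_isDiag hD, hsq, ← hy]
      exact g.symm_apply_apply _
  have hset : {r | ∃ (g : E6) (I D : XO) (a : Fin 3 → ℝ), IsDiagO I 1 ∧ IsDiagO D a ∧
      ActsO g I x ∧ ActsO g D y ∧ r = Real.log (⨆ i, a i) + Real.log (⨆ i, (a i)⁻¹)} =
      {(Real.log (b 0) - Real.log (b 2)) / 2} :=
    Set.eq_singleton_iff_unique_mem.2 ⟨key _ hm ▸ hm, key⟩
  rw [distO, hset, csInf_singleton]

/-- The octonionic symmetric space as a slice of the cone of squares. -/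
def model : ConeModel Octonion XO where
  sq := sq
  dist := distO
  Shape t x y := HasShape (K := .O) t x y
  Equilateral t x y z := IsEquilateral (K := .O) t x y z
  posDef_sq := posDef_sq
  det_sq := det_sq
  exists_sq _ := exists_sq
  dist_eq x y _ hg _ hb h10 h21 hx hy := dist_eq x y (genGroup_le_detGroup hg) hb h10 h21 hx hy
  shape_spec := by
    rintro t x y ⟨g, p, q, hx, hy, hp, hq⟩
    replace hx := (acts_iff _ _ _).1 hx
    replace hy := (acts_iff _ _ _).1 hy
    rw [sq_of_isDiag hp, one_pow] at hx
    rw [sq_of_isDiag hq] at hy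
    exact ⟨_, mem_orderGroup_of_map_eq_one (conj_mem_detGroup g.2) (posDef_sq x) hx, hx, hy⟩
  equilateral_spec := by
    intro t x y z g hg hx hy hz
    have hgd := genGroup_le_detGroup hg
    obtain ⟨p, hp⟩ := exists_isDiag (a := 1) (fun _ => one_pos) (by simp)
    obtain ⟨q, hq⟩ := exists_isDiag (a := Real.exp (-t / 3) • ![Real.exp t, 1, 1])
      (fun i => by fin_cases i <;> simp [Real.exp_pos])
      (by simp [← Real.exp_add]; ring)
    obtain ⟨r, hr⟩ := exists_isDiag (a := Real.exp (-2 * t / 3) • ![Real.exp t, Real.exp t, 1])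
      (fun i => by fin_cases i <;> simp [Real.exp_pos])
      (by simp [← Real.exp_add]; ring)
    refine ⟨⟨unconj g, unconj_mem_E6 hgd⟩, p, q, r, (acts_unconj hgd _ _).2 ?_,
      (acts_unconj hgd _ _).2 ?_, (acts_unconj hgd _ _).2 ?_, hp, hq, hr⟩
    · rw [hx, sq_of_isDiag hp, one_pow]
    · rw [hy, sq_of_isDiag hq]
    · rw [hz, sq_of_isDiag hr]

end XO

/-! ## Quaternionic matrices -/

namespace Quaternion

theorem norm_sq_eq (x : Quaternion ℝ) :
    ‖x‖ ^ 2 = x.re ^ 2 + x.imI ^ 2 + x.imJ ^ 2 + x.imK ^ 2 := by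
  rw [sq, ← normSq_eq_norm_mul_self, normSq_def']

instance : SymmetricComposition (Quaternion ℝ) where
  mul := LinearMap.mk₂ ℝ (fun x y => star (x * y)) (fun x y z => by rw [add_mul, star_add])
    (fun r x y => by simp) (fun x y z => by rw [mul_add, star_add])
    (fun r x y => by simp)
  inner_mul x y z := by
    change ⟪star (x * y), z⟫_ℝ = ⟪x, star (y * z)⟫_ℝ
    simp [inner_def]
    ring
  mul_mul_cancel_left x y := by
    change star (star (x * y) * x) = _
    rw [star_mul, star_star, ← mul_assoc, star_mul_self, normSq_eq_norm_mul_self, coe_mul_eq_smul,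
      sq]
  mul_mul_cancel_right x y := by
    change star (x * star (y * x)) = _
    rw [star_mul, star_star, mul_assoc, self_mul_star, normSq_eq_norm_mul_self, mul_coe_eq_smul,
      sq]

theorem mul_def (x y : Quaternion ℝ) : SymmetricComposition.mul x y = star (x * y) := rfl

/-- The component `z` of `z + w j`. -/
def fstComplex : Quaternion ℝ →ₗ[ℝ] ℂ where
  toFun q := ⟨q.re, q.imI⟩
  map_add' _ _ := rfl
  map_smul' r q := by apply Complex.ext <;> simp

/-- The component `w` of `z + w j`. -/
def sndComplex : Quaternion ℝ →ₗ[ℝ] ℂ where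
  toFun q := ⟨q.imJ, q.imK⟩
  map_add' _ _ := rfl
  map_smul' r q := by apply Complex.ext <;> simp

theorem fstComplex_apply (q : Quaternion ℝ) : fstComplex q = ⟨q.re, q.imI⟩ := rfl

theorem sndComplex_apply (q : Quaternion ℝ) : sndComplex q = ⟨q.imJ, q.imK⟩ := rfl

theorem fstComplex_mul (x y : Quaternion ℝ) : fstComplex (x * y) =
    fstComplex x * fstComplex y - sndComplex x * star (sndComplex y) := by
  apply Complex.ext <;> simp [fstComplex_apply, sndComplex_apply] <;> ring

theorem sndComplex_mul (x y : Quaternion ℝ) : sndComplex (x * y) =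
    fstComplex x * sndComplex y + sndComplex x * star (fstComplex y) := by
  apply Complex.ext <;> simp [fstComplex_apply, sndComplex_apply] <;> ring

theorem fstComplex_star (x : Quaternion ℝ) : fstComplex (star x) = star (fstComplex x) := by
  apply Complex.ext <;> simp [fstComplex_apply]

theorem sndComplex_star (x : Quaternion ℝ) : sndComplex (star x) = -sndComplex x := by
  apply Complex.ext <;> simp [sndComplex_apply]

theorem fstComplex_coe (r : ℝ) : fstComplex (r : Quaternion ℝ) = r := by
  apply Complex.ext <;> simp [fstComplex_apply]

theorem sndComplex_coe (r : ℝ) : sndComplex (r : Quaternion ℝ) = 0 := by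
  apply Complex.ext <;> simp [sndComplex_apply]

theorem ext_complex {x y : Quaternion ℝ} (h : fstComplex x = fstComplex y)
    (hs : sndComplex x = sndComplex y) : x = y := by
  rw [fstComplex_apply, fstComplex_apply, Complex.mk.injEq] at h
  rw [sndComplex_apply, sndComplex_apply, Complex.mk.injEq] at hs
  exact QuaternionAlgebra.ext h.1 h.2 hs.1 hs.2

/-- The complex form of a quaternionic matrix. -/
def toComplex : Matrix (Fin 3) (Fin 3) (Quaternion ℝ) →ₗ[ℝ]
    Matrix (Fin 3 ⊕ Fin 3) (Fin 3 ⊕ Fin 3) ℂ where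
  toFun M := Matrix.fromBlocks (M.map fstComplex) (M.map sndComplex)
    (M.map fun q => -star (sndComplex q)) (M.map fun q => star (fstComplex q))
  map_add' M N := by
    rw [Matrix.fromBlocks_add]
    congr 1 <;> ext i j <;> simp [add_comm]
  map_smul' r M := by
    rw [RingHom.id_apply, Matrix.fromBlocks_smul]
    congr 1 <;> ext i j <;> simp

theorem toComplex_apply (M : Matrix (Fin 3) (Fin 3) (Quaternion ℝ)) : toComplex M =
    Matrix.fromBlocks (M.map fstComplex) (M.map sndComplex)
    (M.map fun q => -star (sndComplex q)) (M.map fun q => star (fstComplex q)) := rfl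

theorem toComplex_injective : Function.Injective toComplex := by
  intro M N h
  rw [toComplex_apply, toComplex_apply, Matrix.fromBlocks_inj] at h
  ext1 i j
  exact ext_complex (congrFun (congrFun h.1 i) j) (congrFun (congrFun h.2.1 i) j)

theorem toComplex_mul (M N : Matrix (Fin 3) (Fin 3) (Quaternion ℝ)) :
    toComplex (M * N) = toComplex M * toComplex N := by
  simp only [toComplex_apply, Matrix.fromBlocks_multiply]
  congr 1 <;> ext1 i j <;>
    simp only [Matrix.map_apply, Matrix.add_apply, Matrix.mul_apply, map_sum, fstComplex_mul,
      sndComplex_mul, star_sum, ← Finset.sum_add_distrib, ← Finset.sum_neg_distrib] <;>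
    refine Finset.sum_congr rfl fun k _ => ?_ <;>
    (try simp only [star_sub, star_add, star_mul, star_star]) <;> ring

theorem toComplex_conjTranspose (M : Matrix (Fin 3) (Fin 3) (Quaternion ℝ)) :
    toComplex M.conjTranspose = (toComplex M).conjTranspose := by
  simp only [toComplex_apply, Matrix.fromBlocks_conjTranspose]
  congr 1 <;> ext1 i j <;>
    simp [Matrix.conjTranspose_apply, fstComplex_star, sndComplex_star]

theorem toComplex_diagonal (a : Fin 3 → ℝ) :
    toComplex (Matrix.diagonal fun i => (a i : Quaternion ℝ)) =
      Matrix.fromBlocks (Matrix.diagonal fun i => (a i : ℂ)) 0 0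
        (Matrix.diagonal fun i => (a i : ℂ)) := by
  rw [toComplex_apply]
  congr 1 <;> ext1 i j <;> by_cases h : i = j <;>
    simp [h, fstComplex_coe, sndComplex_coe]

theorem toComplex_one : toComplex 1 = 1 := by
  have := toComplex_diagonal 1
  simpa using this

theorem J_mul_toComplex (M : Matrix (Fin 3) (Fin 3) (Quaternion ℝ)) :
    Matrix.J (Fin 3) ℂ * toComplex M * (Matrix.J (Fin 3) ℂ)⁻¹ = (toComplex M).map star := by
  rw [Matrix.J_inv, Matrix.J, toComplex_apply, Matrix.fromBlocks_neg, Matrix.fromBlocks_multiply,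
    Matrix.fromBlocks_multiply, Matrix.fromBlocks_map]
  congr 1 <;> ext1 i j <;> simp

theorem exists_toComplex_eq {G : Matrix (Fin 3 ⊕ Fin 3) (Fin 3 ⊕ Fin 3) ℂ}
    (h : Matrix.J (Fin 3) ℂ * G * (Matrix.J (Fin 3) ℂ)⁻¹ = G.map star) :
    ∃ M, toComplex M = G := by
  obtain ⟨A, B, C, D, rfl⟩ : ∃ A B C D, G = Matrix.fromBlocks A B C D :=
    ⟨_, _, _, _, (Matrix.fromBlocks_toBlocks G).symm⟩
  rw [Matrix.J_inv, Matrix.J, Matrix.fromBlocks_neg, Matrix.fromBlocks_multiply,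
    Matrix.fromBlocks_multiply, Matrix.fromBlocks_map, Matrix.fromBlocks_inj] at h
  have h1 := h.1
  have h2 := h.2.1
  simp at h1 h2
  refine ⟨.of fun i j => ⟨(A i j).re, (A i j).im, (B i j).re, (B i j).im⟩, ?_⟩
  rw [toComplex_apply, h1, neg_eq_iff_eq_neg.1 h2]
  congr 1

theorem isHermitian_iff (M : Matrix (Fin 3) (Fin 3) (Quaternion ℝ)) :
    (toComplex M).IsHermitian ↔ M.IsHermitian := by
  rw [Matrix.IsHermitian, Matrix.IsHermitian, ← toComplex_conjTranspose,
    toComplex_injective.eq_iff]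

end Quaternion

/-! ### The generators as quaternionic matrices -/

namespace Herm3

open Quaternion

/-- The Hermitian quaternionic matrix with given coordinates. -/
def toMatrix : Herm3 (Quaternion ℝ) →ₗ[ℝ] Matrix (Fin 3) (Fin 3) (Quaternion ℝ) where
  toFun X := !![(X.1 0 : Quaternion ℝ), X.2 2, star (X.2 1);
    star (X.2 2), (X.1 1 : Quaternion ℝ), X.2 0; X.2 1, star (X.2 0), (X.1 2 : Quaternion ℝ)]
  map_add' X Y := by ext1 i j; fin_cases i <;> fin_cases j <;> simp
  map_smul' r X := by
    ext1 i j
    fin_cases i <;> fin_cases j <;> simp [coe_mul_eq_smul]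

theorem toMatrix_apply (X : Herm3 (Quaternion ℝ)) : toMatrix X =
    !![(X.1 0 : Quaternion ℝ), X.2 2, star (X.2 1);
    star (X.2 2), (X.1 1 : Quaternion ℝ), X.2 0; X.2 1, star (X.2 0), (X.1 2 : Quaternion ℝ)] := rfl

theorem isHermitian_toMatrix (X : Herm3 (Quaternion ℝ)) : (toMatrix X).IsHermitian := by
  ext1 i j
  rw [Matrix.conjTranspose_apply, toMatrix_apply]
  fin_cases i <;> fin_cases j <;> simp

/-- The coordinates of a Hermitian quaternionic matrix. -/
def ofMatrix (M : Matrix (Fin 3) (Fin 3) (Quaternion ℝ)) : Herm3 (Quaternion ℝ) :=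
  (![(M 0 0).re, (M 1 1).re, (M 2 2).re], ![M 1 2, M 2 0, M 0 1])

theorem toMatrix_ofMatrix {M : Matrix (Fin 3) (Fin 3) (Quaternion ℝ)} (h : M.IsHermitian) :
    toMatrix (ofMatrix M) = M := by
  have h' : ∀ i j, star (M i j) = M j i := fun i j => congrFun (congrFun h j) i
  have hr : ∀ i, ((M i i).re : Quaternion ℝ) = M i i :=
    fun i => (Quaternion.star_eq_self.1 (h' i i)).symm
  ext1 i j
  fin_cases i <;> fin_cases j <;> simp [toMatrix_apply, ofMatrix, h', hr]

theorem ofMatrix_toMatrix (X : Herm3 (Quaternion ℝ)) : ofMatrix (toMatrix X) = X := by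
  ext1 <;> ext1 i <;> fin_cases i <;> simp [toMatrix_apply, ofMatrix]

theorem toMatrix_eq_conj {X Y : Herm3 (Quaternion ℝ)}
    {T : Matrix (Fin 3) (Fin 3) (Quaternion ℝ)}
    (h : ofMatrix (T * toMatrix X * T.conjTranspose) = Y) :
    toMatrix Y = T * toMatrix X * T.conjTranspose := by
  rw [← h, toMatrix_ofMatrix (Matrix.isHermitian_mul_mul_conjTranspose T (isHermitian_toMatrix X))]

/-- The quaternionic rotation in the last two coordinates. -/
def rotMatrix (u : Quaternion ℝ) (c s : ℝ) : Matrix (Fin 3) (Fin 3) (Quaternion ℝ) :=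
  !![1, 0, 0; 0, (c : Quaternion ℝ), s • u; 0, -(s • star u), (c : Quaternion ℝ)]

theorem toMatrix_rot (u : Quaternion ℝ) (c s : ℝ) (hu : ‖u‖ = 1) (h : c ^ 2 + s ^ 2 = 1)
    (X : Herm3 (Quaternion ℝ)) : toMatrix (rot u c s hu h X) =
      rotMatrix u c s * toMatrix X * (rotMatrix u c s).conjTranspose := by
  have hu' : u.re ^ 2 + u.imI ^ 2 + u.imJ ^ 2 + u.imK ^ 2 = 1 := by
    rw [← Quaternion.norm_sq_eq, hu, one_pow]
  apply toMatrix_eq_conj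
  rw [rot_apply]
  ext1 <;> ext1 i <;> fin_cases i
  · simp [ofMatrix, rotMatrix, toMatrix_apply, rotFun, Matrix.mul_apply, Fin.sum_univ_three]
  · simp [ofMatrix, rotMatrix, toMatrix_apply, rotFun, Matrix.mul_apply, Fin.sum_univ_three,
      Quaternion.inner_def]
    linear_combination s ^ 2 * X.1 2 * hu'
  · simp [ofMatrix, rotMatrix, toMatrix_apply, rotFun, Matrix.mul_apply, Fin.sum_univ_three,
      Quaternion.inner_def]
    linear_combination s ^ 2 * X.1 1 * hu'
  · ext
    · simp [ofMatrix, rotMatrix, toMatrix_apply, rotFun, Matrix.mul_apply, Fin.sum_univ_three,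
        Quaternion.inner_def]
      linear_combination s ^ 2 * (X.2 0).re * hu' + (X.2 0).re * h
    · simp [ofMatrix, rotMatrix, toMatrix_apply, rotFun, Matrix.mul_apply, Fin.sum_univ_three,
        Quaternion.inner_def]
      linear_combination s ^ 2 * (X.2 0).imI * hu' + (X.2 0).imI * h
    · simp [ofMatrix, rotMatrix, toMatrix_apply, rotFun, Matrix.mul_apply, Fin.sum_univ_three,
        Quaternion.inner_def]
      linear_combination s ^ 2 * (X.2 0).imJ * hu' + (X.2 0).imJ * h
    · simp [ofMatrix, rotMatrix, toMatrix_apply, rotFun, Matrix.mul_apply, Fin.sum_univ_three,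
        Quaternion.inner_def]
      linear_combination s ^ 2 * (X.2 0).imK * hu' + (X.2 0).imK * h
  · simp [ofMatrix, rotMatrix, toMatrix_apply, rotFun, Matrix.mul_apply, Fin.sum_univ_three,
      Quaternion.mul_def, coe_mul_eq_smul, mul_coe_eq_smul]
    abel
  · simp [ofMatrix, rotMatrix, toMatrix_apply, rotFun, Matrix.mul_apply, Fin.sum_univ_three,
      Quaternion.mul_def, coe_mul_eq_smul, mul_coe_eq_smul]

/-- The cyclic permutation matrix. -/
def cycMatrix : Matrix (Fin 3) (Fin 3) (Quaternion ℝ) := !![0, 1, 0; 0, 0, 1; 1, 0, 0]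

theorem toMatrix_cyc (X : Herm3 (Quaternion ℝ)) :
    toMatrix (cyc X) = cycMatrix * toMatrix X * cycMatrix.conjTranspose := by
  apply toMatrix_eq_conj
  rw [cyc_apply]
  ext1 <;> ext1 i <;> fin_cases i <;>
    simp [ofMatrix, cycMatrix, toMatrix_apply, Matrix.mul_apply, Fin.sum_univ_three]

theorem toMatrix_dil (a : Fin 3 → ℝ) (ha : ∀ i, 0 < a i) (X : Herm3 (Quaternion ℝ)) :
    toMatrix (dil a ha X) = Matrix.diagonal (fun i => (a i : Quaternion ℝ)) * toMatrix X *
      (Matrix.diagonal fun i => (a i : Quaternion ℝ)).conjTranspose := by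
  apply toMatrix_eq_conj
  rw [dil_apply, Matrix.diagonal_conjTranspose]
  ext1 <;> ext1 i <;> fin_cases i <;>
    simp [ofMatrix, toMatrix_apply, coe_mul_eq_smul, mul_coe_eq_smul, smul_smul] <;> ring_nf

theorem toMatrix_diag (a : Fin 3 → ℝ) :
    toMatrix (diag a) = Matrix.diagonal fun i => (a i : Quaternion ℝ) := by
  ext1 i j
  fin_cases i <;> fin_cases j <;> simp [toMatrix_apply]

theorem det_toComplex_map_coe (M : Matrix (Fin 3) (Fin 3) ℝ) :
    (toComplex (M.map fun r => (r : Quaternion ℝ))).det = (M.det : ℂ) ^ 2 := by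
  have : toComplex (M.map fun r => (r : Quaternion ℝ)) =
      Matrix.fromBlocks (M.map Complex.ofRealHom) 0 0 (M.map Complex.ofRealHom) := by
    rw [toComplex_apply]
    congr 1 <;> ext1 i j <;> simp [fstComplex_coe, sndComplex_coe]
  rw [this, Matrix.det_fromBlocks_zero₂₁, sq]
  change (Complex.ofRealHom.mapMatrix M).det * (Complex.ofRealHom.mapMatrix M).det = _
  rw [← RingHom.map_det]
  rfl

/-- Conjugation by `diag (1, u, 1)` reduces the rotation to a real one. -/
theorem det_toComplex_rotMatrix (u : Quaternion ℝ) (c s : ℝ) (hu : ‖u‖ = 1)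
    (h : c ^ 2 + s ^ 2 = 1) : (toComplex (rotMatrix u c s)).det = 1 := by
  have hu' : u * star u = 1 := by
    rw [self_mul_star, normSq_eq_norm_mul_self, hu]; simp
  have hc : c • (1 : Quaternion ℝ) = c := by rw [← coe_mul_eq_smul, mul_one]
  have hf : rotMatrix u c s = Matrix.diagonal ![1, u, 1] * rotMatrix 1 c s *
      Matrix.diagonal ![1, star u, 1] := by
    ext1 i j
    fin_cases i <;> fin_cases j <;>
      simp [rotMatrix, mul_coe_eq_smul, hu', hc]
  have hd : Matrix.diagonal ![1, u, 1] * Matrix.diagonal ![1, star u, 1] = 1 := by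
    rw [Matrix.diagonal_mul_diagonal, ← Matrix.diagonal_one]
    congr 1
    ext1 i
    fin_cases i <;> simp [hu']
  have hr : rotMatrix 1 c s =
      (!![1, 0, 0; 0, c, s; 0, -s, c] : Matrix (Fin 3) (Fin 3) ℝ).map fun r => (r : Quaternion ℝ) := by
    ext1 i j
    fin_cases i <;> fin_cases j <;> simp [rotMatrix, ← coe_mul_eq_smul]
  have hr1 : (toComplex (rotMatrix 1 c s)).det = 1 := by
    have hd1 : (!![1, 0, 0; 0, c, s; 0, -s, c] : Matrix (Fin 3) (Fin 3) ℝ).det = 1 := by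
      rw [Matrix.det_fin_three]
      simp
      linear_combination h
    rw [hr, det_toComplex_map_coe, hd1]
    simp
  rw [hf, toComplex_mul, toComplex_mul, Matrix.det_mul, Matrix.det_mul, hr1, mul_one,
    ← Matrix.det_mul, ← toComplex_mul, hd, toComplex_one, Matrix.det_one]

theorem det_toComplex_cycMatrix : (toComplex cycMatrix).det = 1 := by
  have hr : cycMatrix =
      (!![0, 1, 0; 0, 0, 1; 1, 0, 0] : Matrix (Fin 3) (Fin 3) ℝ).map fun r => (r : Quaternion ℝ) := by
    ext1 i j
    fin_cases i <;> fin_cases j <;> simp [cycMatrix]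
  rw [hr, det_toComplex_map_coe, Matrix.det_fin_three]
  simp

theorem det_toComplex_diagonal (a : Fin 3 → ℝ) :
    (toComplex (Matrix.diagonal fun i => (a i : Quaternion ℝ))).det =
      ((a 0 * a 1 * a 2 : ℝ) : ℂ) ^ 2 := by
  rw [toComplex_diagonal, Matrix.det_fromBlocks_zero₂₁, Matrix.det_diagonal, Fin.prod_univ_three,
    sq]
  push_cast
  rfl

end Herm3

/-! ### Products and inverses in `SL3H` -/

namespace SL3H

open Matrix

theorem isUnit {G : Matrix (Fin 3 ⊕ Fin 3) (Fin 3 ⊕ Fin 3) ℂ} (hG : G ∈ SL3H) : IsUnit G := by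
  rw [Matrix.isUnit_iff_isUnit_det, hG.2]
  exact isUnit_one

theorem exists_toComplex_eq {G : Matrix (Fin 3 ⊕ Fin 3) (Fin 3 ⊕ Fin 3) ℂ} (hG : G ∈ SL3H) :
    ∃ T, Quaternion.toComplex T = G :=
  Quaternion.exists_toComplex_eq hG.1

theorem toComplex_mem {T : Matrix (Fin 3) (Fin 3) (Quaternion ℝ)}
    (h : (Quaternion.toComplex T).det = 1) : Quaternion.toComplex T ∈ SL3H :=
  ⟨Quaternion.J_mul_toComplex T, h⟩

theorem one_mem : (1 : Matrix (Fin 3 ⊕ Fin 3) (Fin 3 ⊕ Fin 3) ℂ) ∈ SL3H := by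
  rw [← Quaternion.toComplex_one]
  exact toComplex_mem (by rw [Quaternion.toComplex_one, det_one])

theorem mul_mem {G H : Matrix (Fin 3 ⊕ Fin 3) (Fin 3 ⊕ Fin 3) ℂ} (hG : G ∈ SL3H) (hH : H ∈ SL3H) :
    G * H ∈ SL3H := by
  obtain ⟨T, rfl⟩ := exists_toComplex_eq hG
  obtain ⟨S, rfl⟩ := exists_toComplex_eq hH
  rw [← Quaternion.toComplex_mul]
  exact toComplex_mem (by rw [Quaternion.toComplex_mul, det_mul, hG.2, hH.2, one_mul])

theorem inv_mem {G : Matrix (Fin 3 ⊕ Fin 3) (Fin 3 ⊕ Fin 3) ℂ} (hG : G ∈ SL3H) : G⁻¹ ∈ SL3H := by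
  have hu := isUnit hG
  have hd : IsUnit G.det := (Matrix.isUnit_iff_isUnit_det G).1 hu
  refine ⟨?_, by rw [det_nonsing_inv, hG.2, Ring.inverse_one]⟩
  have h1 : G.map star * G⁻¹.map star = 1 := by
    rw [show G.map star = G.map (starRingEnd ℂ) from rfl,
      show G⁻¹.map star = G⁻¹.map (starRingEnd ℂ) from rfl, ← Matrix.map_mul,
      mul_nonsing_inv _ hd]
    simp
  rw [← inv_eq_right_inv h1, ← hG.1, Matrix.mul_inv_rev, Matrix.mul_inv_rev,
    nonsing_inv_nonsing_inv _ (isUnit_det_J _ _), Matrix.mul_assoc]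

end SL3H

/-! ### Complex form of the Jordan algebra: positivity, determinant, group action -/

namespace Herm3

open Quaternion

/-- The complex Hermitian matrix of an element of the Jordan algebra. -/
def toComplexMatrix :
    Herm3 (Quaternion ℝ) →ₗ[ℝ] Matrix (Fin 3 ⊕ Fin 3) (Fin 3 ⊕ Fin 3) ℂ :=
  toComplex ∘ₗ toMatrix

theorem toComplexMatrix_apply (X : Herm3 (Quaternion ℝ)) :
    toComplexMatrix X = toComplex (toMatrix X) := rfl

theorem toComplexMatrix_injective : Function.Injective toComplexMatrix :=
  toComplex_injective.comp (Function.LeftInverse.injective ofMatrix_toMatrix)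

theorem isHermitian_toComplexMatrix (X : Herm3 (Quaternion ℝ)) :
    (toComplexMatrix X).IsHermitian :=
  (isHermitian_iff _).2 (isHermitian_toMatrix X)

theorem exists_toComplexMatrix_eq {G : Matrix (Fin 3 ⊕ Fin 3) (Fin 3 ⊕ Fin 3) ℂ}
    (h : Matrix.J (Fin 3) ℂ * G * (Matrix.J (Fin 3) ℂ)⁻¹ = G.map star) (hG : G.IsHermitian) :
    ∃ X, toComplexMatrix X = G := by
  obtain ⟨M, rfl⟩ := Quaternion.exists_toComplex_eq h
  exact ⟨ofMatrix M, by rw [toComplexMatrix_apply, toMatrix_ofMatrix ((isHermitian_iff M).1 hG)]⟩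

theorem toComplexMatrix_diag (a : Fin 3 → ℝ) : toComplexMatrix (diag a) =
    Matrix.fromBlocks (Matrix.diagonal fun i => (a i : ℂ)) 0 0
      (Matrix.diagonal fun i => (a i : ℂ)) := by
  rw [toComplexMatrix_apply, toMatrix_diag, toComplex_diagonal]

theorem toComplexMatrix_diag' (a : Fin 3 → ℝ) : toComplexMatrix (diag a) =
    Matrix.diagonal (Sum.elim (fun i => (a i : ℂ)) fun i => (a i : ℂ)) := by
  rw [toComplexMatrix_diag, Matrix.fromBlocks_diagonal]

theorem toComplexMatrix_diag_one : toComplexMatrix (diag 1) = 1 := by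
  rw [toComplexMatrix_apply, toMatrix_diag]
  simpa using toComplex_one

theorem toComplexMatrix_diag_mul_self (a : Fin 3 → ℝ) :
    toComplexMatrix (diag a) * toComplexMatrix (diag a) = toComplexMatrix (diag (a ^ 2)) := by
  rw [toComplexMatrix_diag', toComplexMatrix_diag', Matrix.diagonal_mul_diagonal]
  congr 1
  ext1 i
  cases i <;> simp [sq]

theorem exists_conj_of_toMatrix {g : Herm3 (Quaternion ℝ) ≃ₗ[ℝ] Herm3 (Quaternion ℝ)}
    {T : Matrix (Fin 3) (Fin 3) (Quaternion ℝ)} (hd : (toComplex T).det = 1)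
    (h : ∀ X, toMatrix (g X) = T * toMatrix X * T.conjTranspose) :
    ∃ G ∈ SL3H, ∀ X, toComplexMatrix (g X) = G * toComplexMatrix X * G.conjTranspose :=
  ⟨_, SL3H.toComplex_mem hd, fun X => by
    simp only [toComplexMatrix_apply, h, toComplex_mul, toComplex_conjTranspose]⟩

theorem exists_conj_of_mem_genGroup {g : Herm3 (Quaternion ℝ) ≃ₗ[ℝ] Herm3 (Quaternion ℝ)}
    (hg : g ∈ genGroup (Quaternion ℝ)) :
    ∃ G ∈ SL3H, ∀ X, toComplexMatrix (g X) = G * toComplexMatrix X * G.conjTranspose := by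
  induction hg using Subgroup.closure_induction with
  | mem g hg =>
    rcases hg with (rfl | ⟨u, c, s, hu, h, rfl⟩) | ⟨a, ha, h1, rfl⟩
    · exact exists_conj_of_toMatrix det_toComplex_cycMatrix toMatrix_cyc
    · exact exists_conj_of_toMatrix (det_toComplex_rotMatrix u c s hu h) (toMatrix_rot u c s hu h)
    · exact exists_conj_of_toMatrix (by rw [det_toComplex_diagonal, h1]; simp) (toMatrix_dil a ha)
  | one => exact ⟨1, SL3H.one_mem, fun X => by simp⟩
  | mul g h _ _ hg hh =>
    obtain ⟨G, hG, hgG⟩ := hg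
    obtain ⟨H, hH, hhH⟩ := hh
    refine ⟨G * H, SL3H.mul_mem hG hH, fun X => ?_⟩
    rw [LinearEquiv.mul_apply, hgG, hhH, Matrix.conjTranspose_mul]
    simp only [Matrix.mul_assoc]
  | inv g _ hg =>
    obtain ⟨G, hG, hgG⟩ := hg
    refine ⟨G⁻¹, SL3H.inv_mem hG, fun X => ?_⟩
    have hd : IsUnit G.det := (Matrix.isUnit_iff_isUnit_det G).1 (SL3H.isUnit hG)
    have h := hgG (g⁻¹ X)
    rw [show g (g⁻¹ X) = X from g.apply_symm_apply X] at h
    rw [h, Matrix.conjTranspose_nonsing_inv]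
    have hd' : IsUnit G.conjTranspose.det := by rw [Matrix.det_conjTranspose]; exact hd.star
    simp only [Matrix.mul_assoc]
    rw [Matrix.mul_nonsing_inv _ hd', Matrix.mul_one, ← Matrix.mul_assoc,
      Matrix.nonsing_inv_mul _ hd, Matrix.one_mul]

theorem exists_conj_eq_diag (X : Herm3 (Quaternion ℝ)) :
    ∃ k ∈ unitGroup (Quaternion ℝ), ∃ G ∈ SL3H, ∃ b : Fin 3 → ℝ, k X = diag b ∧
      G * G.conjTranspose = 1 ∧
      ∀ Y, toComplexMatrix (k Y) = G * toComplexMatrix Y * G.conjTranspose := by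
  obtain ⟨k, hk, b, -, -, hb⟩ := exists_map_eq_diag X
  obtain ⟨G, hG, h⟩ := exists_conj_of_mem_genGroup (rotGroup_le_genGroup hk)
  refine ⟨k, rotGroup_le_unitGroup hk, G, hG, b, hb, ?_, h⟩
  have := h (diag 1)
  rw [(rotGroup_le_unitGroup hk).2, toComplexMatrix_diag_one, Matrix.mul_one] at this
  exact this.symm

/-- Diagonalising by an element realised as a matrix turns both notions of positivity into
nonnegative entries. -/
theorem posSemidef_toComplexMatrix_iff {X : Herm3 (Quaternion ℝ)} :
    (toComplexMatrix X).PosSemidef ↔ Le 0 X := by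
  obtain ⟨k, hk, G, hG, b, hb, -, h⟩ := exists_conj_eq_diag X
  rw [← Matrix.IsUnit.posSemidef_star_right_conjugate_iff (SL3H.isUnit hG), Matrix.star_eq_conjTranspose, ← h, hb,
    ← zero_le_map_iff (unitGroup_le_orderGroup hk), hb, zero_le_diag_iff, toComplexMatrix_diag',
    Matrix.posSemidef_diagonal_iff]
  simp

theorem posDef_toComplexMatrix_iff {X : Herm3 (Quaternion ℝ)} :
    (toComplexMatrix X).PosDef ↔ X.PosDef := by
  obtain ⟨k, hk, G, hG, b, hb, -, h⟩ := exists_conj_eq_diag X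
  have hX : X.PosDef ↔ (diag b : Herm3 (Quaternion ℝ)).PosDef := by
    refine ⟨fun h => hb ▸ h.map_unit hk, fun h => ?_⟩
    have := h.map_unit (inv_mem hk)
    rwa [← hb, show k⁻¹ (k X) = X from k.symm_apply_apply X] at this
  have hb' : (diag b : Herm3 (Quaternion ℝ)).PosDef ↔ ∀ i, 0 < b i := ⟨PosDef.pos, posDef_diag⟩
  rw [← Matrix.IsUnit.posDef_star_right_conjugate_iff (SL3H.isUnit hG),
    Matrix.star_eq_conjTranspose, ← h, hb, hX, hb', toComplexMatrix_diag',
    Matrix.posDef_diagonal_iff]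
  simp

theorem det_toComplexMatrix (X : Herm3 (Quaternion ℝ)) :
    (toComplexMatrix X).det = (X.det : ℂ) ^ 2 := by
  obtain ⟨k, hk, G, hG, b, hb, -, h⟩ := exists_conj_eq_diag X
  have := congrArg Matrix.det (h X)
  rw [hb, Matrix.det_mul, Matrix.det_mul, Matrix.det_conjTranspose, hG.2, star_one, one_mul,
    mul_one] at this
  rw [← this, ← hk.1, hb, det_diag, toComplexMatrix_apply, toMatrix_diag, det_toComplex_diagonal]

/-- Positivity of complex matrices is invariant under conjugation, so `G` need not be factored into
generators. -/
theorem exists_conj_equiv {G : Matrix (Fin 3 ⊕ Fin 3) (Fin 3 ⊕ Fin 3) ℂ} (hG : G ∈ SL3H) :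
    ∃ L ∈ orderGroup (Quaternion ℝ),
      ∀ X, toComplexMatrix (L X) = G * toComplexMatrix X * G.conjTranspose := by
  have key : ∀ G ∈ SL3H, ∀ X, ∃ Y, toComplexMatrix Y = G * toComplexMatrix X * G.conjTranspose := by
    intro G hG X
    obtain ⟨T, rfl⟩ := SL3H.exists_toComplex_eq hG
    refine exists_toComplexMatrix_eq ?_
      (Matrix.isHermitian_mul_mul_conjTranspose _ (isHermitian_toComplexMatrix X))
    rw [toComplexMatrix_apply, ← toComplex_conjTranspose, ← toComplex_mul, ← toComplex_mul]
    exact J_mul_toComplex _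
  have hd : IsUnit G.det := (Matrix.isUnit_iff_isUnit_det G).1 (SL3H.isUnit hG)
  have hd' : IsUnit G.conjTranspose.det := by rw [Matrix.det_conjTranspose]; exact hd.star
  choose f hf using key G hG
  choose f' hf' using key G⁻¹ (SL3H.inv_mem hG)
  let L : Herm3 (Quaternion ℝ) ≃ₗ[ℝ] Herm3 (Quaternion ℝ) :=
    { toFun := f
      map_add' := fun X Y => toComplexMatrix_injective (by
        rw [map_add, hf, hf, hf, map_add, Matrix.mul_add, Matrix.add_mul])
      map_smul' := fun r X => toComplexMatrix_injective (by
        rw [RingHom.id_apply, map_smul, hf, hf, map_smul, Matrix.mul_smul, Matrix.smul_mul])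
      invFun := f'
      left_inv := fun X => toComplexMatrix_injective (by
        rw [hf', hf, Matrix.conjTranspose_nonsing_inv]
        simp only [Matrix.mul_assoc]
        rw [Matrix.mul_nonsing_inv _ hd', Matrix.mul_one, ← Matrix.mul_assoc,
          Matrix.nonsing_inv_mul _ hd, Matrix.one_mul])
      right_inv := fun X => toComplexMatrix_injective (by
        rw [hf, hf', Matrix.conjTranspose_nonsing_inv]
        simp only [Matrix.mul_assoc]
        rw [Matrix.nonsing_inv_mul _ hd', Matrix.mul_one, ← Matrix.mul_assoc,
          Matrix.mul_nonsing_inv _ hd, Matrix.one_mul]) }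
  have hL : ∀ X, toComplexMatrix (L X) = G * toComplexMatrix X * G.conjTranspose := hf
  refine ⟨L, fun X Y => ?_, hL⟩
  rw [le_iff_zero_le_sub, le_iff_zero_le_sub (X := X), ← map_sub, ← posSemidef_toComplexMatrix_iff,
    ← posSemidef_toComplexMatrix_iff, hL, ← Matrix.star_eq_conjTranspose,
    Matrix.IsUnit.posSemidef_star_right_conjugate_iff (SL3H.isUnit hG)]

end Herm3

/-! ### The quaternionic space as a cone model -/

namespace XH

theorem isHermitian_mul_self (x : XH) : (x.1 * x.1).IsHermitian := by
  rw [Matrix.IsHermitian, Matrix.conjTranspose_mul, x.2.2.1]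

theorem exists_toComplexMatrix_eq (x : XH) : ∃ X, toComplexMatrix X = x.1 * x.1 :=
  Herm3.exists_toComplexMatrix_eq (SL3H.mul_mem x.2.1 x.2.1).1 x.isHermitian_mul_self

/-- The square of a point, in coordinates. -/
def sq (x : XH) : Herm3 (Quaternion ℝ) := x.exists_toComplexMatrix_eq.choose

theorem toComplexMatrix_sq (x : XH) : toComplexMatrix x.sq = x.1 * x.1 :=
  x.exists_toComplexMatrix_eq.choose_spec

theorem posDef_sq (x : XH) : x.sq.PosDef := by
  rw [← posDef_toComplexMatrix_iff, toComplexMatrix_sq]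
  have := Matrix.IsUnit.posDef_star_right_conjugate_iff (SL3H.isUnit x.2.1)
    (x := (1 : Matrix (Fin 3 ⊕ Fin 3) (Fin 3 ⊕ Fin 3) ℂ))
  rw [Matrix.mul_one, Matrix.star_eq_conjTranspose, x.2.2.1] at this
  exact this.2 Matrix.PosDef.one

theorem det_sq (x : XH) : x.sq.det = 1 := by
  have h := det_toComplexMatrix x.sq
  rw [toComplexMatrix_sq, Matrix.det_mul, x.2.1.2, one_mul] at h
  have h' : x.sq.det ^ 2 = 1 := by exact_mod_cast h.symm
  have h0 := x.posDef_sq.det_pos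
  nlinarith

theorem exists_val_eq {Y : Herm3 (Quaternion ℝ)} (hY : Y.PosDef) (h1 : Y.det = 1) :
    ∃ x : XH, x.1 = toComplexMatrix Y :=
  ⟨⟨toComplexMatrix Y, SL3H.toComplex_mem (by
    rw [← toComplexMatrix_apply, det_toComplexMatrix, h1]; simp),
    posDef_toComplexMatrix_iff.2 hY⟩, rfl⟩

theorem exists_sq {P : Herm3 (Quaternion ℝ)} (hP : P.PosDef) (h1 : P.det = 1) :
    ∃ x : XH, x.sq = P := by
  obtain ⟨k, hk, G, hG, b, hb, hGG, h⟩ := exists_conj_eq_diag P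
  have hb0 : PosDef (Herm3.diag b : Herm3 (Quaternion ℝ)) := hb ▸ hP.map_unit hk
  rw [← hk.1, hb, det_diag] at h1
  have hs : ∀ i, 0 < √(b i) := fun i => Real.sqrt_pos.2 (hb0.pos i)
  -- The square root is taken in the diagonal frame and carried back.
  obtain ⟨x, hx⟩ := exists_val_eq ((posDef_diag hs).map_unit (inv_mem hk)) (by
    rw [(inv_mem hk).1, det_diag, ← Real.sqrt_mul (hb0.pos 0).le,
      ← Real.sqrt_mul (mul_pos (hb0.pos 0) (hb0.pos 1)).le, h1, Real.sqrt_one])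
  refine ⟨x, toComplexMatrix_injective ?_⟩
  have hGG' : G.conjTranspose * G = 1 := mul_eq_one_comm.1 hGG
  have e1 : toComplexMatrix (diag fun i => √(b i)) = G * x.1 * G.conjTranspose := by
    rw [hx, ← h]
    exact congrArg _ (k.apply_symm_apply _).symm
  have e2 : G * (x.1 * x.1) * G.conjTranspose = G * toComplexMatrix P * G.conjTranspose := by
    rw [← h, hb]
    calc G * (x.1 * x.1) * G.conjTranspose
        = G * x.1 * (G.conjTranspose * G) * (x.1 * G.conjTranspose) := by
          rw [hGG', Matrix.mul_one]; simp only [Matrix.mul_assoc]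
      _ = (G * x.1 * G.conjTranspose) * (G * x.1 * G.conjTranspose) := by
          simp only [Matrix.mul_assoc]
      _ = toComplexMatrix (diag b) := by
          rw [← e1, toComplexMatrix_diag_mul_self]
          exact congrArg (fun c => toComplexMatrix (diag c))
            (funext fun i => Real.sq_sqrt (hb0.pos i).le)
  rw [toComplexMatrix_sq]
  have e3 := congrArg (fun M => G.conjTranspose * M * G) e2
  simp only [Matrix.mul_assoc, hGG', Matrix.mul_one] at e3
  simpa only [← Matrix.mul_assoc, hGG', Matrix.one_mul] using e3

theorem exists_isDiag {a : Fin 3 → ℝ} (ha : ∀ i, 0 < a i) (h1 : a 0 * a 1 * a 2 = 1) :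
    ∃ x : XH, IsDiagH x a := by
  obtain ⟨x, hx⟩ := exists_val_eq (posDef_diag ha) (by rw [det_diag, h1])
  exact ⟨x, by rw [IsDiagH, hx, toComplexMatrix_diag]⟩

theorem sq_of_isDiag {x : XH} {a : Fin 3 → ℝ} (h : IsDiagH x a) : x.sq = diag (a ^ 2) := by
  apply toComplexMatrix_injective
  rw [toComplexMatrix_sq, ← toComplexMatrix_diag_mul_self, toComplexMatrix_diag, h]

theorem acts_iff (g : SL3H) (x y : XH) : ActsH g x y ↔
    g.1 * toComplexMatrix x.sq * g.1.conjTranspose = toComplexMatrix y.sq := by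
  rw [toComplexMatrix_sq, toComplexMatrix_sq]
  exact eq_comm

open scoped Matrix.Norms.L2Operator in
theorem opNorm_sq_eq {M U : Matrix (Fin 3 ⊕ Fin 3) (Fin 3 ⊕ Fin 3) ℂ}
    (hU : U * U.conjTranspose = 1) {v : Fin 3 → ℝ} {s : ℝ} (hv : ∀ i, 0 ≤ v i) (hs : IsLUB (Set.range v) s)
    (h : (U * M) * (U * M).conjTranspose = toComplexMatrix (diag v)) : opNorm M ^ 2 = s := by
  have hUu : U ∈ unitary (Matrix (Fin 3 ⊕ Fin 3) (Fin 3 ⊕ Fin 3) ℂ) :=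
    ⟨mul_eq_one_comm.1 hU, hU⟩
  have e : opNorm M = ‖U * M‖ := (CStarRing.norm_mem_unitary_mul M hUu).symm
  have e2 : ‖(U * M) * (U * M).conjTranspose‖ = ‖U * M‖ * ‖U * M‖ := CStarRing.norm_self_mul_star
  rw [e, _root_.sq, ← e2, h, toComplexMatrix_diag', Matrix.l2_opNorm_diagonal]
  have h0 : 0 ≤ s := (hv 0).trans (hs.1 ⟨0, rfl⟩)
  apply le_antisymm
  · rw [pi_norm_le_iff_of_nonneg h0]
    rintro (i | i) <;>
      simpa [abs_of_nonneg (hv i)] using hs.1 ⟨i, rfl⟩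
  · refine hs.2 ?_
    rintro _ ⟨i, rfl⟩
    have := norm_le_pi_norm (Sum.elim (fun i => (v i : ℂ)) fun i => (v i : ℂ)) (Sum.inl i)
    simpa [abs_of_nonneg (hv i)] using this

open scoped Matrix.Norms.L2Operator in
theorem opNorm_conjTranspose (M : Matrix (Fin 3 ⊕ Fin 3) (Fin 3 ⊕ Fin 3) ℂ) :
    opNorm M.conjTranspose = opNorm M :=
  Matrix.l2_opNorm_conjTranspose M

/-- `G x` is unitary because `G x² G* = 1`. Multiplying `x⁻¹ y` by it gives `G y`, and `G y² G*` is
diagonal, so the operator norm can be read off. -/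
theorem dist_eq (x y : XH) {g : Herm3 (Quaternion ℝ) ≃ₗ[ℝ] Herm3 (Quaternion ℝ)}
    (hg : g ∈ genGroup (Quaternion ℝ)) {b : Fin 3 → ℝ} (hb : ∀ i, 0 < b i) (h10 : b 1 ≤ b 0)
    (h21 : b 2 ≤ b 1) (hx : g x.sq = diag 1) (hy : g y.sq = diag b) :
    distH x y = (Real.log (b 0) - Real.log (b 2)) / 2 := by
  obtain ⟨G, hG, h⟩ := exists_conj_of_mem_genGroup hg
  have hxG := h x.sq
  have hyG := h y.sq
  rw [hx, toComplexMatrix_sq, toComplexMatrix_diag_one] at hxG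
  rw [hy, toComplexMatrix_sq] at hyG
  clear hx hy
  obtain ⟨x, hxS, hxP⟩ := x
  obtain ⟨y, hyS, hyP⟩ := y
  dsimp only at hxG hyG
  have hx1 : x.conjTranspose = x := hxP.1
  have hy1 : y.conjTranspose = y := hyP.1
  have hxd : IsUnit x.det := (Matrix.isUnit_iff_isUnit_det x).1 (SL3H.isUnit hxS)
  have hyd : IsUnit y.det := (Matrix.isUnit_iff_isUnit_det y).1 (SL3H.isUnit hyS)
  have hU : (G * x) * (G * x).conjTranspose = 1 := by
    rw [hxG, Matrix.conjTranspose_mul, hx1]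
    simp only [Matrix.mul_assoc]
  have hGx : G.conjTranspose * (G * (x * x)) = 1 := mul_eq_one_comm.1 hxG.symm
  have e1 : opNorm (x⁻¹ * y) ^ 2 = b 0 := by
    refine opNorm_sq_eq hU (fun i => (hb i).le) (v := b) ⟨?_, fun c hc => hc ⟨0, rfl⟩⟩ ?_
    · rintro _ ⟨i, rfl⟩
      fin_cases i
      exacts [le_rfl, h10, h21.trans h10]
    · rw [show G * x * (x⁻¹ * y) = G * y by
        rw [Matrix.mul_assoc, Matrix.mul_nonsing_inv_cancel_left _ _ hxd],
        Matrix.conjTranspose_mul, hy1, hyG]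
      simp only [Matrix.mul_assoc]
  have e2 : opNorm (y⁻¹ * x) ^ 2 = (b 2)⁻¹ := by
    -- The adjoint of `y⁻¹ x` is `x y⁻¹`, to which the same unitary applies.
    rw [← opNorm_conjTranspose, Matrix.conjTranspose_mul, Matrix.conjTranspose_nonsing_inv, hx1,
      hy1]
    refine opNorm_sq_eq hU (fun i => (inv_pos.2 (hb i)).le) (v := fun i => (b i)⁻¹)
      ⟨?_, fun c hc => hc ⟨2, rfl⟩⟩ ?_
    · rintro _ ⟨i, rfl⟩
      refine inv_anti₀ (hb 2) ?_
      fin_cases i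
      exacts [h21.trans h10, h21, le_rfl]
    · have hD : toComplexMatrix (diag fun i => (b i)⁻¹) * toComplexMatrix (diag b) = 1 := by
        rw [toComplexMatrix_diag', toComplexMatrix_diag', Matrix.diagonal_mul_diagonal,
          ← Matrix.diagonal_one]
        congr 1
        ext1 i
        cases i <;> simp [(hb _).ne']
      refine (left_inv_eq_right_inv hD ?_).symm
      rw [hyG, Matrix.conjTranspose_mul, Matrix.conjTranspose_mul, Matrix.conjTranspose_mul,
        Matrix.conjTranspose_nonsing_inv, hx1, hy1]
      calc G * (y * y) * G.conjTranspose * (G * x * (x * y⁻¹) * (y⁻¹ * x * (x * G.conjTranspose)))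
          = G * (y * y) * (G.conjTranspose * (G * (x * x))) * y⁻¹ * y⁻¹ *
              (x * x) * G.conjTranspose := by simp only [Matrix.mul_assoc]
        _ = G * (x * x) * G.conjTranspose := by
            rw [hGx, Matrix.mul_one]
            congr 2
            rw [Matrix.mul_assoc G, Matrix.mul_assoc y, Matrix.mul_nonsing_inv _ hyd,
              Matrix.mul_one, Matrix.mul_assoc, Matrix.mul_nonsing_inv _ hyd, Matrix.mul_one]
        _ = 1 := hxG.symm
  have l1 : Real.log (b 0) = 2 * Real.log (opNorm (x⁻¹ * y)) := by rw [← e1, Real.log_pow]; norm_num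
  have l2 : -Real.log (b 2) = 2 * Real.log (opNorm (y⁻¹ * x)) := by
    rw [← Real.log_inv, ← e2, Real.log_pow]; norm_num
  change Real.log (opNorm (x⁻¹ * y)) + Real.log (opNorm (y⁻¹ * x)) = _
  linarith

/-- The quaternionic symmetric space as a slice of the cone of positive definite matrices. -/
def model : ConeModel (Quaternion ℝ) XH where
  sq := sq
  dist := distH
  Shape t x y := HasShape (K := .H) t x y
  Equilateral t x y z := IsEquilateral (K := .H) t x y z
  posDef_sq := posDef_sq
  det_sq := det_sq
  exists_sq _ := exists_sq
  dist_eq x y _ hg _ hb h10 h21 hx hy := dist_eq x y hg hb h10 h21 hx hy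
  shape_spec := by
    rintro t x y ⟨g, p, q, hx, hy, hp, hq⟩
    obtain ⟨L, hL, hLg⟩ := exists_conj_equiv g.2
    refine ⟨L, hL, toComplexMatrix_injective ?_, toComplexMatrix_injective ?_⟩
    · rw [hLg, (acts_iff _ _ _).1 hx, sq_of_isDiag hp, one_pow]
    · rw [hLg, (acts_iff _ _ _).1 hy, sq_of_isDiag hq]
  equilateral_spec := by
    intro t x y z g hg hx hy hz
    obtain ⟨G, hG, h⟩ := exists_conj_of_mem_genGroup hg
    obtain ⟨p, hp⟩ := exists_isDiag (a := 1) (fun _ => one_pos) (by simp)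
    obtain ⟨q, hq⟩ := exists_isDiag (a := Real.exp (-t / 3) • ![Real.exp t, 1, 1])
      (fun i => by fin_cases i <;> simp [Real.exp_pos])
      (by simp [← Real.exp_add]; ring)
    obtain ⟨r, hr⟩ := exists_isDiag (a := Real.exp (-2 * t / 3) • ![Real.exp t, Real.exp t, 1])
      (fun i => by fin_cases i <;> simp [Real.exp_pos])
      (by simp [← Real.exp_add]; ring)
    refine ⟨⟨G, hG⟩, p, q, r, (acts_iff _ _ _).2 ?_, (acts_iff _ _ _).2 ?_,
      (acts_iff _ _ _).2 ?_, hp, hq, hr⟩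
    · rw [← h, hx, sq_of_isDiag hp, one_pow]
    · rw [← h, hy, sq_of_isDiag hq]
    · rw [← h, hz, sq_of_isDiag hr]

end XH

/-! ### Assembly of both parts with a common `δ` -/

theorem ConeModel.exists_delta {A : Type} [NormedAddCommGroup A] [InnerProductSpace ℝ A]
    [SymmetricComposition A] [Nontrivial A] [FiniteDimensional ℝ A] {K : DivAlg}
    (M : ConeModel A (SpaceK K)) (hd : ∀ x y, M.dist x y = distK x y)
    (hs : ∀ t x y, HasShape t x y → M.Shape t x y)
    (he : ∀ t x y z, M.Equilateral t x y z → IsEquilateral t x y z) (δ₀ : ℝ) (hδ₀ : 0 < δ₀) :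
    ∃ δ : ℝ, 0 < δ ∧
      (∀ x y z : SpaceK K, ∃ x' y' z' : SpaceK K, (∃ t : ℝ, IsEquilateral t x' y' z') ∧
        IsDeltaPath δ ![x, x', y', y] ∧ IsDeltaPath δ ![y, y', z', z] ∧
        IsDeltaPath δ ![z, z', x', x]) ∧
      (∀ (s t : ℝ), 0 ≤ s * t → ∀ z v w y : SpaceK K, distK v w < δ₀ →
        HasShape t v z → HasShape s w y → IsRetractable δ z v y) := by
  obtain ⟨δ, hδ, h⟩ := M.exists_equilateral_retraction
  have hlog3 : 0 ≤ Real.log 3 := Real.log_nonneg (by norm_num)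
  have hlog18 : 0 ≤ Real.log 18 := Real.log_nonneg (by norm_num)
  have path4 : ∀ x x' y' y : SpaceK K, M.dist x x' + M.dist x' y' + M.dist y' y ≤ M.dist x y + δ →
      IsDeltaPath (δ + (Real.log 3 + Real.log 18 + 4 * δ₀)) ![x, x', y', y] := by
    intro x x' y' y h
    simp only [hd] at h
    rw [IsDeltaPath, Fin.sum_univ_three]
    change distK x x' + distK x' y' + distK y' y ≤ distK x y + _
    linarith
  have path3 : ∀ x u y : SpaceK K,
      M.dist x u + M.dist u y ≤ M.dist x y + (Real.log 3 + Real.log 18 + 4 * δ₀) →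
      IsDeltaPath (δ + (Real.log 3 + Real.log 18 + 4 * δ₀)) ![x, u, y] := by
    intro x u y h
    simp only [hd] at h
    rw [IsDeltaPath, Fin.sum_univ_two]
    change distK x u + distK u y ≤ distK x y + _
    linarith
  refine ⟨δ + (Real.log 3 + Real.log 18 + 4 * δ₀), by positivity, fun x y z => ?_,
    fun s t hst z v w y hvw hz hy => ?_⟩
  · obtain ⟨x', y', z', ⟨t, ht⟩, h1, h2, h3⟩ := h x y z
    exact ⟨x', y', z', ⟨t, he _ _ _ _ ht⟩, path4 _ _ _ _ h1, path4 _ _ _ _ h2, path4 _ _ _ _ h3⟩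
  · obtain ⟨u, h1, h2, h3⟩ :=
      M.exists_retraction_of_shape hst (by rwa [hd]) (hs _ _ _ hz) (hs _ _ _ hy)
    exact ⟨u, path3 _ _ _ h1, path3 _ _ _ h2, path3 _ _ _ h3⟩

end

theorem lemma3p2 (K : DivAlg) (δ₀ : ℝ) (hδ₀ : 0 < δ₀) :
    ∃ δ : ℝ, 0 < δ ∧
      (∀ x y z : SpaceK K, ∃ x' y' z' : SpaceK K, (∃ t : ℝ, IsEquilateral t x' y' z') ∧
        IsDeltaPath δ ![x, x', y', y] ∧ IsDeltaPath δ ![y, y', z', z] ∧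
        IsDeltaPath δ ![z, z', x', x]) ∧
      (∀ (s t : ℝ), 0 ≤ s * t → ∀ z v w y : SpaceK K, distK v w < δ₀ →
        HasShape t v z → HasShape s w y → IsRetractable δ z v y) := by
  cases K with
  | H =>
    exact XH.model.exists_delta (K := .H) (fun _ _ => rfl) (fun _ _ _ h => h) (fun _ _ _ _ h => h)
      δ₀ hδ₀
  | O =>
    exact XO.model.exists_delta (K := .O) (fun _ _ => rfl) (fun _ _ _ h => h) (fun _ _ _ _ h => h)
      δ₀ hδ₀
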